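/- **Corollary (Bäcklund transformation for the system (e1)–(e2)).** Let $\mathbb K$ be $\mathbb R$ or $\mathbb C$, let $\varepsilon,\Delta\in\{1,-1\}$, and equip $\mathbb K^3$ with the ($\mathbb K$-bilinear) scalar product $u\cdot v=u_0v_0+\varepsilon(u_1v_1+u_2v_2)$ and the corresponding vector product $\times$. Let $D\subseteq\mathbb R^2$ be open, with coordinates $(x,y)$, and let $A,B,C\in C^1(D,\mathbb R)$ be given functions with $AB-C^2=\Delta$. For scalar or vector functions $g$ on $D$ put $$L_{A,B,C}\,g=(A\,g_x+C\,g_y)_x+(C\,g_x+B\,g_y)_y .$$ Let $N\in C^2(D,\mathbb K^3)$ and $f:D\to\mathbb K$ be a solution of the system $$\text{(e1)}\quad L_{A,B,C}N=fN,\qquad\qquad \text{(e2)}\quad L_{A,B,C}(N\cdot N)=0,$$ such that $r:=N\cdot N$ is at every point the square of a nonzero element of $\mathbb K$ (that is, $r>0$ if $\mathbb K=\mathbb R$ and $r\neq0$ if $\mathbb K=\mathbb C$). *The transformation.* A *transform* of $N$ on an open set $U\subseteq D$ is given by the following data on $U$. * A $C^2$ frame $(n_0,n_1,n_2)$ of mutually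 orthogonal vector fields with $n_0\cdot n_0=1$, $n_1\cdot n_1=n_2\cdot n_2=\varepsilon$, and a function $\sigma$ with $N=\sigma n_0$ (so $\sigma^2=r$; write $\sigma=\sqrt r$). Its rotation coefficients are defined by $n_{i,x}=\sum_j p_i{}^j n_j$, $n_{i,y}=\sum_j q_i{}^j n_j$ ($i,j=0,1,2$). * A differentiable solution $p$ of $$(\mathrm P)\qquad \Delta r_x+Cp_x+Bp_y=0,\qquad \Delta r_y-Ap_x-Cp_y=0,$$ with $p\ne0$ and $p^2+r^2\Delta\neq0$ everywhere on $U$. * A differentiable solution $(x^0,x^1,x^2)$, with $x^0\ne0$ everywhere on $U$, of the linear system (where $\mu\in\{1,2\}$) $$(\mathrm{LS})\quad\begin{aligned} x^0_{,x}&=\tfrac{p^2}{p^2+r^2\Delta}\Big\{\sum_{\mu=1,2}\big[(\tfrac rpC-1)p_\mu{}^0+\tfrac rpB\,q_\mu{}^0\big]x^\mu+\tfrac r{p^2}\big[(C+\tfrac rp\Delta)p_x+Bp_y\big]x^0\Big\},\\ x^\mu_{,x}&=-\sum_{i=0}^2x^i p_i{}^\mu+\tfrac rp\,(C\,p_0{}^\mu+B\,q_0{}^\mu)\,x^0,\\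 x^0_{,y}&=-\tfrac{p^2}{p^2+r^2\Delta}\Big\{\sum_{\mu=1,2}\big[(\tfrac rpC+1)q_\mu{}^0+\tfrac rpA\,p_\mu{}^0\big]x^\mu+\tfrac r{p^2}\big[(C-\tfrac rp\Delta)p_y+Ap_x\big]x^0\Big\},\\ x^\mu_{,y}&=-\sum_{i=0}^2x^i q_i{}^\mu-\tfrac rp\,(A\,p_0{}^\mu+C\,q_0{}^\mu)\,x^0, \end{aligned}$$ which satisfies the constraint $Q=0$, where $Q:=(x^0)^2\big(1+\tfrac{r^2}{p^2}\Delta\big)+\varepsilon\big((x^1)^2+(x^2)^2\big)$. The transform is then $$N'=\frac{p}{\sqrt r}\sum_{i=0}^2\frac{x^i}{x^0}\,n_i .$$ Put $(A',B',C')=-\tfrac1\Delta(A,B,C)$, $\theta=x^0\sqrt r/p$ and $f'=\theta\,L_{A',B',C'}(1/\theta)$. *Claims.* 1. (Distinguished normal field.) If $D$ is simply connected, there is a differentiable $R:D\to\mathbb K^3$ satisfying the Lelieuvre formulae $$R_x=(BN_y+CN_x)\times N,\qquad R_y=N\times(AN_x+CN_y).$$ For every such $R$ (on any $D$), at each point where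 $\det(N,N_x,N_y)\neq0$: $R_x$ and $R_y$ are linearly independent and orthogonal to $N$; the Gauss curvature of $R$ is $K=\Delta/(N\cdot N)^2$; and if $N\cdot N$ is a positive real number there, then $N=|K|^{-1/4}\,n_0$ with $n_0=N/\sqrt{N\cdot N}$. 2. (Compatibility of (P).) If $D$ is simply connected, then for every $z_0\in D$ and $k\in\mathbb K$ the system (P) has exactly one differentiable solution $p$ on $D$ with $p(z_0)=k$. 3. (Compatibility of (LS).) Let a frame as above and a solution $p$ of (P) with $p\ne0$, $p^2+r^2\Delta\ne0$ be given on $D$. If $D$ is simply connected, then (LS) has, for every prescribed value of $(x^0,x^1,x^2)$ at a point of $D$, exactly one differentiable solution on $D$. If $D$ is connected, $Q$ is constant on $D$ for every solution of (LS). 4. (Local existence of transforms.) If $z_0\in D$ and $\nu\in\mathbb K^3$ satisfy $\nu\cdot N(z_0)\neq0$, $(\nu\cdot N(z_0))^2+\Delta\,r(z_0)^2\neq0$ and $\nu\cdot\nu=-\Delta\,r(z_0)$, then on some open neighbourhood of $z_0$ in $D$ there is a transform $N'$ of $N$ with $N'(z_0)=\nu$. 5. (Auto-Bäcklund property.) Let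 $U\subseteq D$ be open. For every transform $N'$ of $N$ on $U$ one has $A'B'-C'^2=\Delta$; the pair $(N',f')$ is a $C^2$ solution on $U$ of (e1)–(e2) with coefficients $A',B',C'$, i.e. $L_{A',B',C'}N'=f'N'$ and $L_{A',B',C'}(N'\cdot N')=0$; equivalently, since $(A',B',C')=-\Delta(A,B,C)$, the pair $(N',-\Delta f')$ solves (e1)–(e2) on $U$ with the original coefficients $A,B,C$. Moreover $N\cdot N'=p$ and $N'\cdot N'=-\Delta\,N\cdot N$; and if $R$ satisfies the Lelieuvre formulae for $N$ and $A,B,C$ on $U$, then for every constant vector $c$ the position vector $R'=R+N\times N'+c$ satisfies those for $N'$ and $A',B',C'$ on $U$. -/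

import Mathlib

/-! Fields on a region of the plane with parameters `(x, y)`, with values in `𝕜³`, where `𝕜` is
`ℝ` or `ℂ`. The space `𝕜³` carries the scalar product `u₀v₀ + ε (u₁v₁ + u₂v₂)` with `ε = 1`
(Euclidean) or `ε = -1` (Minkowski), extended bilinearly if `𝕜 = ℂ`. -/

namespace Bianchi

noncomputable section

/-- Partial derivative in the first variable. -/
def dx {E : Type*} [NormedAddCommGroup E] [NormedSpace ℝ E] (g : ℝ × ℝ → E) (z : ℝ × ℝ) : E :=
  fderiv ℝ g z (1, 0)

/-- Partial derivative in the second variable. -/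
def dy {E : Type*} [NormedAddCommGroup E] [NormedSpace ℝ E] (g : ℝ × ℝ → E) (z : ℝ × ℝ) : E :=
  fderiv ℝ g z (0, 1)

/-- The operator `∂ₓ (A ∂ₓ + C ∂ᵧ) + ∂ᵧ (C ∂ₓ + B ∂ᵧ)`. -/
def selfAdjOp {E : Type*} [NormedAddCommGroup E] [NormedSpace ℝ E]
    (A B C : ℝ × ℝ → ℝ) (g : ℝ × ℝ → E) (z : ℝ × ℝ) : E :=
  dx (fun w => A w • dx g w + C w • dy g w) z + dy (fun w => C w • dx g w + B w • dy g w) z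

/-- The (pseudo) scalar product. -/
def dot {𝕜 : Type*} [RCLike 𝕜] (ε : ℝ) (u v : Fin 3 → 𝕜) : 𝕜 :=
  u 0 * v 0 + (ε : 𝕜) * (u 1 * v 1 + u 2 * v 2)

/-- The vector product of the (pseudo) scalar product (`dot ε (cross ε u v) w` is the volume
of `u, v, w`, for `ε = ± 1`). -/
def cross {𝕜 : Type*} [RCLike 𝕜] (ε : ℝ) (u v : Fin 3 → 𝕜) : Fin 3 → 𝕜 :=
  ![u 1 * v 2 - u 2 * v 1, (ε : 𝕜) * (u 2 * v 0 - u 0 * v 2), (ε : 𝕜) * (u 0 * v 1 - u 1 * v 0)]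

/-- The volume form. -/
def vol {𝕜 : Type*} [RCLike 𝕜] (u v w : Fin 3 → 𝕜) : 𝕜 :=
  (Matrix.of ![u, v, w]).det

/-- The function `r = N · N`. -/
def sqNorm {𝕜 : Type*} [RCLike 𝕜] (ε : ℝ) (N : ℝ × ℝ → Fin 3 → 𝕜) (z : ℝ × ℝ) : 𝕜 :=
  dot ε (N z) (N z)

/-- `(N, f)` solves on `D` the system
`[∂ₓ (A ∂ₓ + C ∂ᵧ) + ∂ᵧ (C ∂ₓ + B ∂ᵧ)] N = f N`,
`[∂ₓ (A ∂ₓ + C ∂ᵧ) + ∂ᵧ (C ∂ₓ + B ∂ᵧ)] (N · N) = 0`. -/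
structure IsSolution {𝕜 : Type*} [RCLike 𝕜] (ε : ℝ) (D : Set (ℝ × ℝ)) (A B C : ℝ × ℝ → ℝ)
    (N : ℝ × ℝ → Fin 3 → 𝕜) (f : ℝ × ℝ → 𝕜) : Prop where
  contDiffOn : ContDiffOn ℝ 2 N D
  field_eq : ∀ z ∈ D, selfAdjOp A B C N z = f z • N z
  sqNorm_eq : ∀ z ∈ D, selfAdjOp A B C (sqNorm ε N) z = 0

/-! ### The surface of a normal field -/

/-- `R` is a position vector obtained from `N` by the Lelieuvre formulae
`Rₓ = (B Nᵧ + C Nₓ) × N`, `Rᵧ = N × (A Nₓ + C Nᵧ)`. -/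
structure IsLelieuvre {𝕜 : Type*} [RCLike 𝕜] (ε : ℝ) (D : Set (ℝ × ℝ)) (A B C : ℝ × ℝ → ℝ)
    (N R : ℝ × ℝ → Fin 3 → 𝕜) : Prop where
  differentiableOn : DifferentiableOn ℝ R D
  dx_eq : ∀ z ∈ D, dx R z = cross ε (B z • dy N z + C z • dx N z) (N z)
  dy_eq : ∀ z ∈ D, dy R z = cross ε (N z) (A z • dx N z + C z • dy N z)

/-- The Gauss curvature `det II / det I` of the parametrized surface `R`. With `m = Rₓ × Rᵧ`, the
unit normal is `m / √(m · m)` and `det I = m · m`, so that the quotient is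
`((Rₓₓ · m) (Rᵧᵧ · m) - (Rₓᵧ · m)²) / (m · m)²`. -/
def gaussCurvature {𝕜 : Type*} [RCLike 𝕜] (ε : ℝ) (R : ℝ × ℝ → Fin 3 → 𝕜) (z : ℝ × ℝ) : 𝕜 :=
  let m := cross ε (dx R z) (dy R z)
  (dot ε (dx (dx R) z) m * dot ε (dy (dy R) z) m - dot ε (dy (dx R) z) m ^ 2) / dot ε m m ^ 2

/-! ### The transformation -/

/-- The squares of the frame vectors: `n₀ · n₀ = 1`, `n₁ · n₁ = n₂ · n₂ = ε`. -/
def frameSign (ε : ℝ) (i : Fin 3) : ℝ := if i = 0 then 1 else ε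

/-- `(n₀, n₁, n₂)` is an orthonormal frame, and `N = σ n₀` (so `σ` is a square root of `N · N`,
`n₀` is the unit normal, and `n₁`, `n₂` are tangent). -/
structure IsFrame {𝕜 : Type*} [RCLike 𝕜] (ε : ℝ) (D : Set (ℝ × ℝ)) (N : ℝ × ℝ → Fin 3 → 𝕜)
    (σ : ℝ × ℝ → 𝕜) (n : Fin 3 → ℝ × ℝ → Fin 3 → 𝕜) : Prop where
  contDiffOn : ∀ i, ContDiffOn ℝ 2 (n i) D
  orthonormal : ∀ z ∈ D, ∀ i j,
    dot ε (n i z) (n j z) = if i = j then (frameSign ε i : 𝕜) else 0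
  normal : ∀ z ∈ D, N z = σ z • n 0 z

/-- The rotation coefficients `p_i^j` of an orthonormal frame: `∂ₓ nᵢ = ∑ⱼ p_i^j nⱼ`. -/
def rotP {𝕜 : Type*} [RCLike 𝕜] (ε : ℝ) (n : Fin 3 → ℝ × ℝ → Fin 3 → 𝕜) (i j : Fin 3)
    (z : ℝ × ℝ) : 𝕜 :=
  (frameSign ε j : 𝕜) * dot ε (dx (n i) z) (n j z)

/-- The rotation coefficients `q_i^j` of an orthonormal frame: `∂ᵧ nᵢ = ∑ⱼ q_i^j nⱼ`. -/
def rotQ {𝕜 : Type*} [RCLike 𝕜] (ε : ℝ) (n : Fin 3 → ℝ × ℝ → Fin 3 → 𝕜) (i j : Fin 3)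
    (z : ℝ × ℝ) : 𝕜 :=
  (frameSign ε j : 𝕜) * dot ε (dy (n i) z) (n j z)

/-- The system for the function `p`, where `Δ = AB - C² = ± 1`:
`Δ rₓ + C pₓ + B pᵧ = 0`, `Δ rᵧ - A pₓ - C pᵧ = 0`. -/
structure IsPotential {𝕜 : Type*} [RCLike 𝕜] (ε Δ : ℝ) (D : Set (ℝ × ℝ)) (A B C : ℝ × ℝ → ℝ)
    (N : ℝ × ℝ → Fin 3 → 𝕜) (p : ℝ × ℝ → 𝕜) : Prop where
  differentiableOn : DifferentiableOn ℝ p D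
  eq_x : ∀ z ∈ D, Δ • dx (sqNorm ε N) z + C z • dx p z + B z • dy p z = 0
  eq_y : ∀ z ∈ D, Δ • dy (sqNorm ε N) z - A z • dx p z - C z • dy p z = 0

/-- The linear system for the functions `x⁰, x¹, x²`. -/
structure IsLinearSolution {𝕜 : Type*} [RCLike 𝕜] (ε Δ : ℝ) (D : Set (ℝ × ℝ))
    (A B C : ℝ × ℝ → ℝ) (N : ℝ × ℝ → Fin 3 → 𝕜) (n : Fin 3 → ℝ × ℝ → Fin 3 → 𝕜)
    (p : ℝ × ℝ → 𝕜) (x : Fin 3 → ℝ × ℝ → 𝕜) : Prop where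
  differentiableOn : ∀ i, DifferentiableOn ℝ (x i) D
  zero_x : ∀ z ∈ D, dx (x 0) z = p z ^ 2 / (p z ^ 2 + sqNorm ε N z ^ 2 * (Δ : 𝕜)) *
    ((∑ μ ∈ ({1, 2} : Finset (Fin 3)),
        ((sqNorm ε N z / p z * (C z : 𝕜) - 1) * rotP ε n μ 0 z
          + sqNorm ε N z / p z * (B z : 𝕜) * rotQ ε n μ 0 z) * x μ z)
      + sqNorm ε N z / p z ^ 2 *
        (((C z : 𝕜) + sqNorm ε N z / p z * (Δ : 𝕜)) * dx p z + (B z : 𝕜) * dy p z) * x 0 z)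
  pos_x : ∀ z ∈ D, ∀ μ : Fin 3, μ ≠ 0 → dx (x μ) z =
    -(∑ i, x i z * rotP ε n i μ z)
      + sqNorm ε N z / p z * ((C z : 𝕜) * rotP ε n 0 μ z + (B z : 𝕜) * rotQ ε n 0 μ z) * x 0 z
  zero_y : ∀ z ∈ D, dy (x 0) z = -(p z ^ 2 / (p z ^ 2 + sqNorm ε N z ^ 2 * (Δ : 𝕜))) *
    ((∑ μ ∈ ({1, 2} : Finset (Fin 3)),
        ((sqNorm ε N z / p z * (C z : 𝕜) + 1) * rotQ ε n μ 0 z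
          + sqNorm ε N z / p z * (A z : 𝕜) * rotP ε n μ 0 z) * x μ z)
      + sqNorm ε N z / p z ^ 2 *
        (((C z : 𝕜) - sqNorm ε N z / p z * (Δ : 𝕜)) * dy p z + (A z : 𝕜) * dx p z) * x 0 z)
  pos_y : ∀ z ∈ D, ∀ μ : Fin 3, μ ≠ 0 → dy (x μ) z =
    -(∑ i, x i z * rotQ ε n i μ z)
      - sqNorm ε N z / p z * ((A z : 𝕜) * rotP ε n 0 μ z + (C z : 𝕜) * rotQ ε n 0 μ z) * x 0 z

/-- The quantity `(x⁰)² (1 + (r²/p²) Δ) + ε ((x¹)² + (x²)²)`. -/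
def constraintQty {𝕜 : Type*} [RCLike 𝕜] (ε Δ : ℝ) (N : ℝ × ℝ → Fin 3 → 𝕜) (p : ℝ × ℝ → 𝕜)
    (x : Fin 3 → ℝ × ℝ → 𝕜) (z : ℝ × ℝ) : 𝕜 :=
  x 0 z ^ 2 * (1 + sqNorm ε N z ^ 2 / p z ^ 2 * (Δ : 𝕜))
    + (ε : 𝕜) * (x 1 z ^ 2 + x 2 z ^ 2)

/-- `N'` is the transform of `N` on `D` constructed from `σ = √r`, the frame `n`, the function `p`
and the solution `x` of the linear system:
`N' = (p / √r) ∑ᵢ (xⁱ / x⁰) nᵢ`. The denominators that occur are required not to vanish. -/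
structure IsTransform {𝕜 : Type*} [RCLike 𝕜] (ε Δ : ℝ) (D : Set (ℝ × ℝ)) (A B C : ℝ × ℝ → ℝ)
    (N : ℝ × ℝ → Fin 3 → 𝕜) (σ : ℝ × ℝ → 𝕜) (n : Fin 3 → ℝ × ℝ → Fin 3 → 𝕜)
    (p : ℝ × ℝ → 𝕜) (x : Fin 3 → ℝ × ℝ → 𝕜) (N' : ℝ × ℝ → Fin 3 → 𝕜) : Prop where
  frame : IsFrame ε D N σ n
  potential : IsPotential ε Δ D A B C N p
  p_ne : ∀ z ∈ D, p z ≠ 0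
  denom_ne : ∀ z ∈ D, p z ^ 2 + sqNorm ε N z ^ 2 * (Δ : 𝕜) ≠ 0
  linear : IsLinearSolution ε Δ D A B C N n p x
  x_ne : ∀ z ∈ D, x 0 z ≠ 0
  constraint : ∀ z ∈ D, constraintQty ε Δ N p x z = 0
  field_eq : ∀ z ∈ D, N' z = ∑ i, (p z / σ z * (x i z / x 0 z)) • n i z

/-- The function `θ = x⁰ √r / p`. -/
def theta {𝕜 : Type*} [RCLike 𝕜] (σ p : ℝ × ℝ → 𝕜) (x : Fin 3 → ℝ × ℝ → 𝕜) (z : ℝ × ℝ) : 𝕜 :=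
  x 0 z * σ z / p z

/-- The coefficient `a' = - a / Δ` of the transformed equation. -/
def newCoeff (Δ : ℝ) (a : ℝ × ℝ → ℝ) (z : ℝ × ℝ) : ℝ := -a z / Δ

/-- The transformed function `f'`, i.e. `θ` times the operator with the coefficients `a', b', c'`
applied to `1/θ`. -/
def newF {𝕜 : Type*} [RCLike 𝕜] (Δ : ℝ) (A B C : ℝ × ℝ → ℝ) (σ p : ℝ × ℝ → 𝕜)
    (x : Fin 3 → ℝ × ℝ → 𝕜) (z : ℝ × ℝ) : 𝕜 :=
  theta σ p x z *
    selfAdjOp (newCoeff Δ A) (newCoeff Δ B) (newCoeff Δ C) (fun w => (theta σ p x w)⁻¹) z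

end

end Bianchi

namespace Bianchi

open Filter Topology Set MeasureTheory

/-! Put X = θN'. Since θ = x⁰√r/p, the components of X in the frame are exactly x⁰, x¹, x², and (LS)
is the frame form of a system in which the frame does not occur: with θ = (X·N)/p, X_x = θ(C N_x + B
N_y) − (Cθ_x + Bθ_y)N, X_y = (Aθ_x + Cθ_y)N − θ(A N_x + C N_y). This is a Moutard transformation.
The derivatives of θ are not extra unknowns: differentiating pθ = X·N and inserting the system gives
two linear equations for θ_x, θ_y with determinant p² + r²Δ, so both right-hand sides are linear in
X (`mPL`, `mQL`).

Compatibility. The mixed derivatives of X agree as soon as θ LN = (Lθ)N, i.e. Lθ = fθ. The two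
linear equations, differentiated once more and combined with (e1), (e2) and (P), yield a homogeneous
2×2 system, again of determinant p² + r²Δ, for θ_xy − θ_yx and Lθ − fθ; so both vanish
(`MoutardRel.operator_theta`, `IsNormalPair.isFlat`). Likewise (P) says that p has differential (C
r_x + B r_y) dx − (A r_x + C r_y) dy, which is closed by (e2), and the Lelieuvre form is closed by
(e1). A flat linear system with C¹ coefficients on a simply connected open set has a global solution
(`exists_isParallel`): it is solved on small squares by a contraction and the local solutions are
glued by lifting the identity to a covering space.

First integral and Bäcklund property. X·X + Δrθ² is constant along solutions, and in the frame it is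
Q. On its zero level N'·N' = −Δr, which gives (e2) for N'. The fluxes A X_x + C X_y and C X_x + B
X_y equal Δθ²(N/θ)_y and −Δθ²(N/θ)_x; expanding L(X/θ) with them leaves only L(1/θ)X, so LN' =
θL(1/θ)N' (`IsMoutardPair.operator_field`). The formula for R' is then vector algebra.

A transform with N'(z₀) = ν is the solution with X(z₀) = ν and p(z₀) = ν·N(z₀): then θ(z₀) = 1, and
the condition on ν·ν says that the first integral is zero. -/

noncomputable section

/-! ### Gluing of local solutions by covering spaces -/

/-- Local transport maps on a simply connected space which agree locally glue to a global
horizontal section with a prescribed value. -/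
theorem exists_horizontal_section {X F : Type*} [TopologicalSpace X] [SimplyConnectedSpace X]
    [LocallyPathConnectedSpace X] (U : X → Set X) (hU : ∀ i, IsOpen (U i)) (hmem : ∀ i, i ∈ U i)
    (T : X → X → X → F → F) (hself : ∀ i, ∀ y ∈ U i, ∀ e, T i y y e = e)
    (hcomp : ∀ i, ∀ y ∈ U i, ∀ z ∈ U i, ∀ w ∈ U i, ∀ e, T i z w (T i y z e) = T i y w e)
    (hloc : ∀ i j, ∀ y ∈ U i ∩ U j, ∀ e, ∀ᶠ z in 𝓝 y, T i y z e = T j y z e)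
    (x₀ : X) (e₀ : F) :
    ∃ u : X → F, u x₀ = e₀ ∧ ∀ i, ∀ y ∈ U i, ∀ᶠ z in 𝓝 y, u z = T i y z (u y) := by
  -- The discrete topology on the fibre turns the bundle into a covering, whose continuous sections
  -- are the horizontal ones.
  let _ : TopologicalSpace F := ⊥
  have : DiscreteTopology F := ⟨rfl⟩
  let Z : FiberBundleCore X X F :=
    { baseSet := U
      isOpen_baseSet := hU
      indexAt := id
      mem_baseSet_at := hmem
      -- Chart `i` records a vector over `y` by its transport to the centre `i`. A change of chart
      -- carries it back to `y` with `T i` and on to the centre `j` with `T j`; by `hloc` this is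
      -- locally constant in `y`.
      coordChange := fun i j y v => T j y j (T i i y v)
      coordChange_self := fun i x hx v => by
        rw [hcomp i _ (hmem i) _ hx _ (hmem i), hself i _ (hmem i)]
      continuousOn_coordChange := fun i j => by
        rintro ⟨y, v⟩ ⟨⟨hyi, hyj⟩, -⟩
        refine ContinuousAt.continuousWithinAt ?_
        rw [continuousAt_prod_of_discrete_right]
        refine ContinuousAt.congr (f := fun _ => T j y j (T i i y v)) continuousAt_const ?_
        filter_upwards [hloc i j y ⟨hyi, hyj⟩ (T i i y v), (hU i).mem_nhds hyi,
          (hU j).mem_nhds hyj] with z hz hzi hzj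
        rw [← hcomp i _ (hmem i) _ hyi _ hzi, hz, hcomp j _ hyj _ hzj _ (hmem j)]
      coordChange_comp := fun i j k x hx v => by
        obtain ⟨⟨hxi, hxj⟩, hxk⟩ := hx
        rw [hcomp j _ hxj _ (hmem j) _ hxj, hself j _ hxj] }
  have cov : IsCoveringMap Z.proj := FiberBundle.isCoveringMap (F := F) (E := Z.Fiber)
  -- A lift of the identity of a simply connected space to the covering is a global section.
  obtain ⟨G, ⟨hG0, hG⟩, -⟩ := cov.existsUnique_continuousMap_lifts (ContinuousMap.id X) x₀
    (⟨x₀, e₀⟩ : Z.TotalSpace) rfl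
  obtain ⟨u, hu⟩ : ∃ u : X → F, ∀ y, G y = (⟨y, u y⟩ : Z.TotalSpace) := by
    have hcast : ∀ p : Z.TotalSpace, ∀ y, p.1 = y → ∃ v : F, p = ⟨y, v⟩ := by
      rintro ⟨a, b⟩ y rfl
      exact ⟨b, rfl⟩
    choose u hu using fun y => hcast (G y) y (congrFun hG y)
    exact ⟨u, hu⟩
  refine ⟨u, ?_, fun i y hy => ?_⟩
  · have := (hu x₀).symm.trans hG0
    exact eq_of_heq (Bundle.TotalSpace.mk.inj this).2
  have hval : ∀ z ∈ U i, ((Z.localTriv i) (G z)).2 = T i z i (u z) := by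
    intro z hz
    rw [hu]
    change T i z i (T z z z (u z)) = _
    rw [hself z z (hmem z)]
  have hc : ContinuousAt (fun z => ((Z.localTriv i) (G z)).2) y := by
    have h1 : ContinuousAt (Z.localTriv i) (G y) :=
      (Z.localTriv i).continuousAt (by
        rw [FiberBundleCore.mem_localTriv_source, hu]
        exact hy)
    exact ContinuousAt.snd (ContinuousAt.comp (f := G) h1 G.continuous.continuousAt)
  have hev : ∀ᶠ z in 𝓝 y, ((Z.localTriv i) (G z)).2 = ((Z.localTriv i) (G y)).2 := by
    have := hc.tendsto
    rwa [nhds_discrete F, tendsto_pure] at this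
  filter_upwards [hev, (hU i).mem_nhds hy] with z hz hzi
  rw [hval z hzi, hval y hy] at hz
  have := congrArg (T i i z) hz
  rwa [hcomp i _ hzi _ (hmem i) _ hzi, hself i _ hzi, hcomp i _ hy _ (hmem i) _ hzi] at this

/-! ### Local existence for flat linear systems -/

theorem swap_intervalIntegral {E : Type*} [NormedAddCommGroup E] [NormedSpace ℝ E]
    {g : ℝ × ℝ → E} (hg : Continuous g) (a b c d : ℝ) :
    ∫ s in a..b, ∫ t in c..d, g (s, t) = ∫ t in c..d, ∫ s in a..b, g (s, t) := by
  simp only [intervalIntegral.intervalIntegral_eq_integral_uIoc, integral_smul]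
  rw [integral_integral_swap (f := fun s t => g (s, t)), smul_comm]
  rw [Measure.prod_restrict]
  exact (hg.continuousOn.integrableOn_compact
    (isCompact_uIcc.prod isCompact_uIcc)).mono_set (prod_mono uIoc_subset_uIcc uIoc_subset_uIcc)

/-- Projection of the line to a closed interval. -/
def clamp (a δ t : ℝ) : ℝ := max (a - δ) (min (a + δ) t)

theorem continuous_clamp (a δ : ℝ) : Continuous (clamp a δ) := by
  unfold clamp
  fun_prop

theorem abs_clamp_sub_le (a : ℝ) {δ : ℝ} (hδ : 0 < δ) (t : ℝ) : |clamp a δ t - a| ≤ δ := by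
  unfold clamp
  rw [abs_le]
  constructor
  · linarith [le_max_left (a - δ) (min (a + δ) t)]
  · have : max (a - δ) (min (a + δ) t) ≤ a + δ := max_le (by linarith) (min_le_left _ _)
    linarith

theorem clamp_of_abs_le {a δ t : ℝ} (h : |t - a| ≤ δ) : clamp a δ t = t := by
  rw [abs_le] at h
  unfold clamp
  rw [min_eq_right (by linarith), max_eq_right (by linarith)]

section LocalExistence

variable {E : Type*} [NormedAddCommGroup E] [NormedSpace ℝ E]

theorem norm_integral_clm_apply_le {P : ℝ → E →L[ℝ] E} {X : ℝ → E} {a b K M : ℝ} (hK : 0 ≤ K)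
    (hP : ∀ t ∈ uIcc a b, ‖P t‖ ≤ K) (hX : ∀ t ∈ uIcc a b, ‖X t‖ ≤ M) :
    ‖∫ t in a..b, P t (X t)‖ ≤ K * M * |b - a| :=
  intervalIntegral.norm_integral_le_of_norm_le_const fun t ht =>
    ((P t).le_opNorm _).trans (mul_le_mul (hP t (uIoc_subset_uIcc ht))
      (hX t (uIoc_subset_uIcc ht)) (norm_nonneg _) hK)

variable [CompleteSpace E]

theorem mem_ball_prod_iff {q z : ℝ × ℝ} {δ : ℝ} :
    z ∈ Metric.ball q δ ↔ |z.1 - q.1| < δ ∧ |z.2 - q.2| < δ := by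
  simp [Prod.dist_eq, Real.dist_eq]

/-- Banach's fixed point theorem for the integral equation along the path that runs from `y` first
horizontally, then vertically. Each leg has length at most 2δ, so the integral operator has norm at
most 4δK ≤ 1/2. -/
theorem exists_bounded_solution_integral_eq {P Q : ℝ × ℝ → E →L[ℝ] E} (hP : Continuous P)
    (hQ : Continuous Q) {K δ : ℝ} (hδ : 0 < δ) (hK : 0 ≤ K) (hPK : ∀ z, ‖P z‖ ≤ K)
    (hQK : ∀ z, ‖Q z‖ ≤ K) (hδK : 8 * (δ * K) ≤ 1) {q y : ℝ × ℝ} (hy : y ∈ Metric.ball q δ)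
    (e : E) :
    ∃ X : ℝ × ℝ → E, Continuous X ∧ (∃ M, ∀ z, ‖X z‖ ≤ M) ∧ ∀ z ∈ Metric.ball q δ,
      X z = e + (∫ s in y.1..z.1, P (s, y.2) (X (s, y.2))) +
        ∫ t in y.2..z.2, Q (z.1, t) (X (z.1, t)) := by
  rw [mem_ball_prod_iff] at hy
  -- Clamping the endpoint to the square makes the operator act on bounded continuous functions on
  -- the whole plane and changes nothing inside the square.
  let T : (ℝ × ℝ → E) → ℝ × ℝ → E := fun X z =>
    (∫ s in y.1..clamp q.1 δ z.1, P (s, y.2) (X (s, y.2))) +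
      ∫ t in y.2..clamp q.2 δ z.2, Q (clamp q.1 δ z.1, t) (X (clamp q.1 δ z.1, t))
  have hT : ∀ X : ℝ × ℝ → E, Continuous X → Continuous (T X) := by
    intro X hX
    have h1 := continuous_clamp q.1 δ
    have h2 := continuous_clamp q.2 δ
    refine Continuous.add ?_ ?_
    · refine intervalIntegral.continuous_parametric_intervalIntegral_of_continuous
        (f := fun (_ : ℝ × ℝ) s => P (s, y.2) (X (s, y.2))) ?_ (by fun_prop)
      simp only [Function.uncurry_def]
      fun_prop
    · refine intervalIntegral.continuous_parametric_intervalIntegral_of_continuous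
        (f := fun (z : ℝ × ℝ) t => Q (clamp q.1 δ z.1, t) (X (clamp q.1 δ z.1, t))) ?_ (by fun_prop)
      simp only [Function.uncurry_def]
      fun_prop
  have hle : ∀ X : ℝ × ℝ → E, ∀ M, 0 ≤ M → (∀ z, ‖X z‖ ≤ M) → ∀ z, ‖T X z‖ ≤ 1 / 2 * M := by
    intro X M hM hXM z
    have h1 : |clamp q.1 δ z.1 - y.1| ≤ 2 * δ := by
      have := abs_sub_le (clamp q.1 δ z.1) q.1 y.1
      rw [abs_sub_comm q.1] at this
      linarith [abs_clamp_sub_le q.1 hδ z.1, hy.1]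
    have h2 : |clamp q.2 δ z.2 - y.2| ≤ 2 * δ := by
      have := abs_sub_le (clamp q.2 δ z.2) q.2 y.2
      rw [abs_sub_comm q.2] at this
      linarith [abs_clamp_sub_le q.2 hδ z.2, hy.2]
    have h3 := norm_integral_clm_apply_le (P := fun s => P (s, y.2)) (X := fun s => X (s, y.2))
      (a := y.1) (b := clamp q.1 δ z.1) hK (fun _ _ => hPK _) (fun _ _ => hXM _)
    have h4 := norm_integral_clm_apply_le (P := fun t => Q (clamp q.1 δ z.1, t))
      (X := fun t => X (clamp q.1 δ z.1, t))
      (a := y.2) (b := clamp q.2 δ z.2) hK (fun _ _ => hQK _) (fun _ _ => hXM _)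
    have hKM : 0 ≤ K * M := mul_nonneg hK hM
    calc ‖T X z‖ ≤ K * M * |clamp q.1 δ z.1 - y.1| + K * M * |clamp q.2 δ z.2 - y.2| :=
          (norm_add_le _ _).trans (add_le_add h3 h4)
      _ ≤ K * M * (2 * δ) + K * M * (2 * δ) := by gcongr
      _ ≤ 1 / 2 * M := by nlinarith
  have hsub : ∀ X Y : ℝ × ℝ → E, Continuous X → Continuous Y → T (X - Y) = T X - T Y := by
    intro X Y hX hY
    funext z
    simp only [T, Pi.sub_apply, map_sub]
    rw [intervalIntegral.integral_sub, intervalIntegral.integral_sub]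
    · abel
    all_goals
      apply Continuous.intervalIntegrable
      fun_prop
  let Φ : BoundedContinuousFunction (ℝ × ℝ) E → BoundedContinuousFunction (ℝ × ℝ) E := fun X =>
    BoundedContinuousFunction.ofNormedAddCommGroup (fun z => e + T X z)
      (continuous_const.add (hT X X.continuous)) (‖e‖ + 1 / 2 * ‖X‖) fun z =>
        (norm_add_le _ _).trans (add_le_add le_rfl (hle X _ (norm_nonneg _) X.norm_coe_le_norm z))
  have hΦ : ContractingWith (1 / 2) Φ := by
    refine ⟨by norm_num, LipschitzWith.of_dist_le_mul fun X Y => ?_⟩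
    rw [BoundedContinuousFunction.dist_le (by positivity)]
    intro z
    have h := hle (X - Y) (dist X Y) dist_nonneg (fun z => by
      rw [Pi.sub_apply, ← dist_eq_norm]
      exact BoundedContinuousFunction.dist_coe_le_dist z) z
    rw [hsub _ _ X.continuous Y.continuous, Pi.sub_apply] at h
    rw [dist_eq_norm]
    simpa [Φ] using h
  let X := ContractingWith.fixedPoint Φ hΦ
  have hX : ∀ z, X z = e + T X z := fun z =>
    congrArg (fun Y : BoundedContinuousFunction (ℝ × ℝ) E => Y z) hΦ.fixedPoint_isFixedPt.symm
  refine ⟨X, X.continuous, ⟨‖X‖, X.norm_coe_le_norm⟩, fun z hz => ?_⟩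
  rw [mem_ball_prod_iff] at hz
  rw [hX z]
  simp only [T]
  rw [clamp_of_abs_le hz.1.le, clamp_of_abs_le hz.2.le, add_assoc]


theorem hasDerivAt_integral_of_continuous {h : ℝ → E} (hh : Continuous h) (a t : ℝ) :
    HasDerivAt (fun b => ∫ s in a..b, h s) (h t) t :=
  intervalIntegral.integral_hasDerivAt_right (hh.intervalIntegrable _ _)
    hh.stronglyMeasurable.stronglyMeasurableAtFilter hh.continuousAt

/-- The local existence theorem for a flat linear system on a small square. -/
theorem exists_hasFDerivAt_of_flat_of_small {P Q Py Qx : ℝ × ℝ → E →L[ℝ] E} (hP : Continuous P)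
    (hQ : Continuous Q) (hPyc : Continuous Py) (hQxc : Continuous Qx) {K δ : ℝ} (hδ : 0 < δ)
    (hK : 0 ≤ K) (hPK : ∀ z, ‖P z‖ ≤ K) (hQK : ∀ z, ‖Q z‖ ≤ K) (hQxK : ∀ z, ‖Qx z‖ ≤ K)
    (hδK : 8 * (δ * K) ≤ 1) (hδ1 : δ ≤ 1 / 2) {q : ℝ × ℝ}
    (hPy : ∀ z ∈ Metric.ball q δ, HasDerivAt (fun t => P (z.1, t)) (Py z) z.2)
    (hQx : ∀ z ∈ Metric.ball q δ, HasDerivAt (fun s => Q (s, z.2)) (Qx z) z.1)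
    (hflat : ∀ z ∈ Metric.ball q δ, ∀ v, Py z v + P z (Q z v) = Qx z v + Q z (P z v))
    {y : ℝ × ℝ} (hy : y ∈ Metric.ball q δ) (e : E) :
    ∃ X : ℝ × ℝ → E, X y = e ∧ ∀ z ∈ Metric.ball q δ, HasFDerivAt X
      ((ContinuousLinearMap.toSpanSingleton ℝ (P z (X z))).coprod
        (ContinuousLinearMap.toSpanSingleton ℝ (Q z (X z)))) z := by
  obtain ⟨X, hXc, ⟨M, hM⟩, hX⟩ :=
    exists_bounded_solution_integral_eq hP hQ hδ hK hPK hQK hδK hy e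
  have hy' := mem_ball_prod_iff.1 hy
  have hball : ∀ {z}, z ∈ Metric.ball q δ → ∀ {s t}, s ∈ uIcc y.1 z.1 → t ∈ uIcc y.2 z.2 →
      (s, t) ∈ Metric.ball q δ := by
    intro z hz s t hs ht
    rw [mem_ball_prod_iff] at hz ⊢
    have h1 : ∀ {a b c d : ℝ}, |a - d| < δ → |b - d| < δ → c ∈ uIcc a b → |c - d| < δ := by
      intro a b c d ha hb hc
      rw [abs_lt] at *
      rcases mem_uIcc.1 hc with h | h <;> constructor <;> linarith [h.1, h.2]
    exact ⟨h1 hy'.1 hz.1 hs, h1 hy'.2 hz.2 ht⟩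
  have hXy : ∀ z ∈ Metric.ball q δ, HasDerivAt (fun t => X (z.1, t)) (Q z (X z)) z.2 := by
    intro z hz
    have h0 := hasDerivAt_integral_of_continuous
      (h := fun t => Q (z.1, t) (X (z.1, t))) (by fun_prop) y.2 z.2
    refine (h0.const_add (e + ∫ s in y.1..z.1, P (s, y.2) (X (s, y.2)))).congr_of_eventuallyEq ?_
    have h1 : ∀ᶠ t in 𝓝 z.2, (z.1, t) ∈ Metric.ball q δ :=
      (Continuous.prodMk_right z.1).continuousAt.eventually (Metric.isOpen_ball.mem_nhds hz)
    filter_upwards [h1] with t ht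
    exact hX _ ht
  let g : ℝ × ℝ → E := fun z => Py z (X z) + P z (Q z (X z))
  have hg : Continuous g := by fun_prop
  have hPX : ∀ z ∈ Metric.ball q δ, HasDerivAt (fun t => P (z.1, t) (X (z.1, t))) (g z) z.2 :=
    fun z hz => (hPy z hz).clm_apply (hXy z hz)
  -- `X` satisfies the vertical equation by construction. `Y` integrates the horizontal one from the
  -- line s = `y.1`; its derivative in the first variable is `P X`, so everything reduces to X = Y.
  let Y : ℝ × ℝ → E := fun z => X (y.1, z.2) + ∫ s in y.1..z.1, P (s, z.2) (X (s, z.2))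
  have hYc : Continuous Y := by
    refine Continuous.add (by fun_prop) ?_
    refine intervalIntegral.continuous_parametric_intervalIntegral_of_continuous
        (f := fun (z : ℝ × ℝ) s => P (s, z.2) (X (s, z.2))) ?_ (by fun_prop)
    simp only [Function.uncurry_def]
    fun_prop
  have hYx : ∀ z, HasDerivAt (fun s => Y (s, z.2)) (P z (X z)) z.1 := fun z =>
    HasDerivAt.const_add (X (y.1, z.2)) (hasDerivAt_integral_of_continuous
      (h := fun s => P (s, z.2) (X (s, z.2))) (by fun_prop) y.1 z.1)
  -- Flatness replaces ∂ₜ(P X) by Qₓ X + Q P X, which is ∂ₛ(Q Y) + Qₓ(X − Y). This avoids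
  -- differentiating `X` in the first variable and leaves a homogeneous integral equation for X − Y.
  have hW : ∀ z ∈ Metric.ball q δ, X z - Y z = ∫ t in y.2..z.2,
      (Q (z.1, t) (X (z.1, t) - Y (z.1, t)) -
        ∫ s in y.1..z.1, Qx (s, t) (X (s, t) - Y (s, t))) := by
    intro z hz
    have e1 : (z.1, y.2) ∈ Metric.ball q δ := hball hz right_mem_uIcc left_mem_uIcc
    have e2 : (y.1, z.2) ∈ Metric.ball q δ := hball hz left_mem_uIcc right_mem_uIcc
    have h1 := hX z hz
    have h2 := hX _ e2
    simp only [intervalIntegral.integral_same, add_zero] at h2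
    have h3 : ∀ s ∈ uIcc y.1 z.1, P (s, z.2) (X (s, z.2)) =
        P (s, y.2) (X (s, y.2)) + ∫ t in y.2..z.2, g (s, t) := by
      intro s hs
      rw [intervalIntegral.integral_eq_sub_of_hasDerivAt
        (f := fun t => P (s, t) (X (s, t))) (f' := fun t => g (s, t))
        (fun t ht => hPX (s, t) (hball hz hs ht)) (Continuous.intervalIntegrable (by fun_prop) _ _)]
      abel
    have hgs : Continuous fun s => ∫ t in y.2..z.2, g (s, t) := by
      refine intervalIntegral.continuous_parametric_intervalIntegral_of_continuous'
        (f := fun s t => g (s, t)) ?_ _ _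
      simpa [Function.uncurry_def] using hg
    have hgt : Continuous fun t => ∫ s in y.1..z.1, g (s, t) := by
      refine intervalIntegral.continuous_parametric_intervalIntegral_of_continuous'
        (f := fun t s => g (s, t)) ?_ _ _
      simp only [Function.uncurry_def]
      fun_prop
    have h4 : Y z = X (y.1, z.2) + ((∫ s in y.1..z.1, P (s, y.2) (X (s, y.2))) +
        ∫ t in y.2..z.2, ∫ s in y.1..z.1, g (s, t)) := by
      simp only [Y]
      rw [intervalIntegral.integral_congr h3, intervalIntegral.integral_add
        (Continuous.intervalIntegrable (by fun_prop) _ _) (hgs.intervalIntegrable _ _),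
        swap_intervalIntegral hg]
    have h5 : ∀ t ∈ uIcc y.2 z.2, Q (z.1, t) (X (z.1, t) - Y (z.1, t)) -
        (∫ s in y.1..z.1, Qx (s, t) (X (s, t) - Y (s, t))) =
        Q (z.1, t) (X (z.1, t)) - Q (y.1, t) (X (y.1, t)) - ∫ s in y.1..z.1, g (s, t) := by
      intro t ht
      have h6 : ∫ s in y.1..z.1, (Qx (s, t) (Y (s, t)) + Q (s, t) (P (s, t) (X (s, t)))) =
          Q (z.1, t) (Y (z.1, t)) - Q (y.1, t) (Y (y.1, t)) :=
        intervalIntegral.integral_eq_sub_of_hasDerivAt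
          (f := fun s => Q (s, t) (Y (s, t)))
          (fun s hs => (hQx (s, t) (hball hz hs ht)).clm_apply (hYx (s, t)))
          (Continuous.intervalIntegrable (by fun_prop) _ _)
      have h7 : Y (y.1, t) = X (y.1, t) := by simp [Y]
      have h8 : ∫ s in y.1..z.1, g (s, t) = ∫ s in y.1..z.1,
          ((Qx (s, t) (Y (s, t)) + Q (s, t) (P (s, t) (X (s, t)))) +
            Qx (s, t) (X (s, t) - Y (s, t))) := by
        refine intervalIntegral.integral_congr fun s hs => ?_
        simp only [g]
        rw [hflat _ (hball hz hs ht), map_sub]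
        abel
      rw [h8, intervalIntegral.integral_add (Continuous.intervalIntegrable (by fun_prop) _ _)
        (Continuous.intervalIntegrable (by fun_prop) _ _), h6, h7, map_sub]
      abel
    rw [intervalIntegral.integral_congr h5, intervalIntegral.integral_sub
      (Continuous.intervalIntegrable (by fun_prop) _ _) (hgt.intervalIntegrable _ _),
      intervalIntegral.integral_sub (Continuous.intervalIntegrable (by fun_prop) _ _)
      (Continuous.intervalIntegrable (by fun_prop) _ _), h4, h1, h2]
    abel
  -- The homogeneous equation halves every bound for X − Y on the square; iterating it forces X = Y.
  have hstep : ∀ m, 0 ≤ m → (∀ z ∈ Metric.ball q δ, ‖X z - Y z‖ ≤ m) →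
      ∀ z ∈ Metric.ball q δ, ‖X z - Y z‖ ≤ 1 / 2 * m := by
    intro m hm hb z hz
    have hz' := mem_ball_prod_iff.1 hz
    have l1 : |z.1 - y.1| ≤ 2 * δ := by
      have := abs_sub_le z.1 q.1 y.1
      rw [abs_sub_comm q.1] at this
      linarith [hz'.1, hy'.1]
    have l2 : |z.2 - y.2| ≤ 2 * δ := by
      have := abs_sub_le z.2 q.2 y.2
      rw [abs_sub_comm q.2] at this
      linarith [hz'.2, hy'.2]
    have hKm : 0 ≤ K * m := mul_nonneg hK hm
    rw [hW z hz]
    have h1 : ∀ t ∈ uIoc y.2 z.2, ‖Q (z.1, t) (X (z.1, t) - Y (z.1, t)) -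
        ∫ s in y.1..z.1, Qx (s, t) (X (s, t) - Y (s, t))‖ ≤ 2 * (K * m) := by
      intro t ht
      have ht' := uIoc_subset_uIcc ht
      refine (norm_sub_le _ _).trans ?_
      have h2 : ‖Q (z.1, t) (X (z.1, t) - Y (z.1, t))‖ ≤ K * m :=
        ((Q (z.1, t)).le_opNorm _).trans
          (mul_le_mul (hQK _) (hb _ (hball hz right_mem_uIcc ht')) (norm_nonneg _) hK)
      have h3 := norm_integral_clm_apply_le (P := fun s => Qx (s, t))
        (X := fun s => X (s, t) - Y (s, t)) (a := y.1) (b := z.1) hK (fun _ _ => hQxK _)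
        (fun s hs => hb _ (hball hz hs ht'))
      have h4 : K * m * |z.1 - y.1| ≤ K * m * 1 :=
        mul_le_mul_of_nonneg_left (by linarith) hKm
      linarith
    calc _ ≤ 2 * (K * m) * |z.2 - y.2| := intervalIntegral.norm_integral_le_of_norm_le_const h1
      _ ≤ 2 * (K * m) * (2 * δ) := by gcongr
      _ ≤ 1 / 2 * m := by nlinarith
  have hXY : ∀ z ∈ Metric.ball q δ, X z = Y z := by
    obtain ⟨m, hm0, hm⟩ : ∃ m, 0 ≤ m ∧ ∀ z ∈ Metric.ball q δ, ‖X z - Y z‖ ≤ m := by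
      refine ⟨M + (M + K * M * (2 * δ)), ?_, fun z hz => ?_⟩
      · have hM0 := (norm_nonneg _).trans (hM 0)
        positivity
      have hM0 := (norm_nonneg _).trans (hM 0)
      have hz' := mem_ball_prod_iff.1 hz
      have l1 : |z.1 - y.1| ≤ 2 * δ := by
        have := abs_sub_le z.1 q.1 y.1
        rw [abs_sub_comm q.1] at this
        linarith [hz'.1, hy'.1]
      refine (norm_sub_le _ _).trans (add_le_add (hM _) ((norm_add_le _ _).trans
        (add_le_add (hM _) ((norm_integral_clm_apply_le (P := fun s => P (s, z.2))
          (X := fun s => X (s, z.2)) hK (fun _ _ => hPK _) (fun _ _ => hM _)).trans ?_))))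
      gcongr
    have hn : ∀ n : ℕ, ∀ z ∈ Metric.ball q δ, ‖X z - Y z‖ ≤ (1 / 2) ^ n * m := by
      intro n
      induction n with
      | zero => simpa using hm
      | succ n ih =>
        intro z hz
        have := hstep _ (by positivity) ih z hz
        rwa [← mul_assoc, ← pow_succ'] at this
    intro z hz
    have hlim : Tendsto (fun n : ℕ => (1 / 2 : ℝ) ^ n * m) atTop (𝓝 0) := by
      simpa using (tendsto_pow_atTop_nhds_zero_of_lt_one (by norm_num)
        (by norm_num : (1 / 2 : ℝ) < 1)).mul_const m
    have := ge_of_tendsto' hlim (fun n => hn n z hz)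
    exact sub_eq_zero.1 (norm_le_zero_iff.1 this)
  have hXx : ∀ z ∈ Metric.ball q δ, HasDerivAt (fun s => X (s, z.2)) (P z (X z)) z.1 := by
    intro z hz
    refine (hYx z).congr_of_eventuallyEq ?_
    have h1 : ∀ᶠ s in 𝓝 z.1, (s, z.2) ∈ Metric.ball q δ :=
      (Continuous.prodMk_left z.2).continuousAt.eventually (Metric.isOpen_ball.mem_nhds hz)
    filter_upwards [h1] with s hs
    exact hXY _ hs
  refine ⟨X, by simpa using hX y hy, fun z hz => ?_⟩
  have hev : ∀ᶠ w in 𝓝 z, w ∈ Metric.ball q δ := Metric.isOpen_ball.mem_nhds hz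
  have := hasStrictFDerivAt_uncurry_coprod (𝕜 := ℝ) (u := z) (f := fun s t => X (s, t))
    (f₁ := fun s t => ContinuousLinearMap.toSpanSingleton ℝ (P (s, t) (X (s, t))))
    (f₂ := fun s t => ContinuousLinearMap.toSpanSingleton ℝ (Q (s, t) (X (s, t))))
    (hev.mono fun w hw => (hXx w hw).hasFDerivAt) (hev.mono fun w hw => (hXy w hw).hasFDerivAt)
    (Continuous.continuousAt
      ((ContinuousLinearMap.toSpanSingletonCLE (𝕜 := ℝ) (E := E)).continuous.comp
        (f := fun z : ℝ × ℝ => P z (X z)) (by fun_prop)))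
    (Continuous.continuousAt
      ((ContinuousLinearMap.toSpanSingletonCLE (𝕜 := ℝ) (E := E)).continuous.comp
        (f := fun z : ℝ × ℝ => Q z (X z)) (by fun_prop)))
  exact this.hasFDerivAt

end LocalExistence

/-! ### Flat linear systems and closed forms on simply connected sets -/

section Flat

variable {E : Type*} [NormedAddCommGroup E] [NormedSpace ℝ E]

/-- The linear map on the plane with the partial derivatives `a` and `b`. -/
def planeDeriv (a b : E) : ℝ × ℝ →L[ℝ] E :=
  (ContinuousLinearMap.toSpanSingleton ℝ a).coprod (ContinuousLinearMap.toSpanSingleton ℝ b)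

@[simp] theorem planeDeriv_apply (a b : E) (v : ℝ × ℝ) :
    planeDeriv a b v = v.1 • a + v.2 • b := by
  simp [planeDeriv]

/-- `X` solves `∂ₓ X = P X`, `∂ᵧ X = Q X` on `U`. -/
def IsParallel (P Q : ℝ × ℝ → E →L[ℝ] E) (U : Set (ℝ × ℝ)) (X : ℝ × ℝ → E) : Prop :=
  ∀ z ∈ U, HasFDerivAt X (planeDeriv (P z (X z)) (Q z (X z))) z

/-- Integrability of the linear system `∂ₓ X = P X`, `∂ᵧ X = Q X`. -/
def IsFlat (P Q : ℝ × ℝ → E →L[ℝ] E) (D : Set (ℝ × ℝ)) : Prop :=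
  ∀ z ∈ D, ∀ v, fderiv ℝ P z (0, 1) v + P z (Q z v) = fderiv ℝ Q z (1, 0) v + Q z (P z v)

variable {P Q : ℝ × ℝ → E →L[ℝ] E} {D U : Set (ℝ × ℝ)}

theorem IsParallel.mono {V : Set (ℝ × ℝ)} {X : ℝ × ℝ → E} (h : IsParallel P Q U X) (hV : V ⊆ U) :
    IsParallel P Q V X := fun z hz => h z (hV hz)

theorem exists_isParallel_ball [CompleteSpace E] (hD : IsOpen D) (hP : ContDiffOn ℝ 1 P D)
    (hQ : ContDiffOn ℝ 1 Q D) (hflat : IsFlat P Q D) {q : ℝ × ℝ} (hq : q ∈ D) :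
    ∃ δ > 0, Metric.ball q δ ⊆ D ∧ ∀ y ∈ Metric.ball q δ, ∀ e,
      ∃ X, X y = e ∧ IsParallel P Q (Metric.ball q δ) X := by
  obtain ⟨δ₀, hδ₀, hδD⟩ := Metric.nhds_basis_closedBall.mem_iff.1 (hD.mem_nhds hq)
  have hP' : ContinuousOn (fderiv ℝ P) D := hP.continuousOn_fderiv_of_isOpen hD le_rfl
  have hQ' : ContinuousOn (fderiv ℝ Q) D := hQ.continuousOn_fderiv_of_isOpen hD le_rfl
  have hcpt : IsCompact (Metric.closedBall q δ₀) := isCompact_closedBall q δ₀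
  obtain ⟨K₁, hK₁⟩ := hcpt.exists_bound_of_continuousOn (hP.continuousOn.mono hδD)
  obtain ⟨K₂, hK₂⟩ := hcpt.exists_bound_of_continuousOn (hQ.continuousOn.mono hδD)
  have hQx : ContinuousOn (fun z => fderiv ℝ Q z (1, 0)) D := hQ'.clm_apply continuousOn_const
  have hPy : ContinuousOn (fun z => fderiv ℝ P z (0, 1)) D := hP'.clm_apply continuousOn_const
  obtain ⟨K₃, hK₃⟩ := hcpt.exists_bound_of_continuousOn (hQx.mono hδD)
  set K := max (max K₁ K₂) (max K₃ 1) with hKdef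
  have hK1 : 1 ≤ K := (le_max_right _ _).trans (le_max_right _ _)
  have hK0 : 0 < K := by linarith
  set δ := min δ₀ (1 / (8 * K)) with hδdef
  have hδ : 0 < δ := lt_min hδ₀ (by positivity)
  have hδK : 8 * (δ * K) ≤ 1 := by
    have : δ ≤ 1 / (8 * K) := min_le_right _ _
    rw [le_div_iff₀ (by positivity)] at this
    linarith
  have hδ1 : δ ≤ 1 / 2 := by nlinarith
  -- The retraction onto a closed square extends the coefficients to bounded continuous functions on
  -- the plane, as the fixed point argument requires.
  let c : ℝ × ℝ → ℝ × ℝ := fun z => (clamp q.1 δ₀ z.1, clamp q.2 δ₀ z.2)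
  have hc : Continuous c := by
    have h1 := continuous_clamp q.1 δ₀
    have h2 := continuous_clamp q.2 δ₀
    fun_prop
  have hcm : ∀ z, c z ∈ Metric.closedBall q δ₀ := fun z => by
    rw [Metric.mem_closedBall, Prod.dist_eq, max_le_iff, Real.dist_eq, Real.dist_eq]
    exact ⟨abs_clamp_sub_le _ hδ₀ _, abs_clamp_sub_le _ hδ₀ _⟩
  have hsub : Metric.ball q δ ⊆ Metric.ball q δ₀ := Metric.ball_subset_ball (min_le_left _ _)
  have hcz : ∀ z ∈ Metric.ball q δ₀, c z = z := by
    intro z hz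
    rw [mem_ball_prod_iff] at hz
    exact Prod.ext (clamp_of_abs_le hz.1.le) (clamp_of_abs_le hz.2.le)
  have hcomp : ∀ {F : ℝ × ℝ → E →L[ℝ] E}, ContinuousOn F D → Continuous fun z => F (c z) :=
    fun hF => (hF.mono hδD).comp_continuous hc hcm
  have hD' : Metric.ball q δ₀ ⊆ D := Metric.ball_subset_closedBall.trans hδD
  refine ⟨δ, hδ, hsub.trans hD', fun y hy e => ?_⟩
  have hPy' : ∀ z ∈ Metric.ball q δ,
      HasDerivAt (fun t => P (c (z.1, t))) (fderiv ℝ P (c z) (0, 1)) z.2 := by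
    intro z hz
    simp only [hcz z (hsub hz)]
    have h1 : HasFDerivAt P (fderiv ℝ P z) z := ((hP.differentiableOn one_ne_zero).differentiableAt
      (hD.mem_nhds (hD' (hsub hz)))).hasFDerivAt
    have h2 : HasDerivAt (fun t => P (z.1, t)) (fderiv ℝ P z (0, 1)) z.2 :=
      h1.comp_hasDerivAt z.2 ((hasDerivAt_const z.2 z.1).prodMk (hasDerivAt_id z.2))
    refine h2.congr_of_eventuallyEq ?_
    have h3 : ∀ᶠ t in 𝓝 z.2, (z.1, t) ∈ Metric.ball q δ :=
      (Continuous.prodMk_right z.1).continuousAt.eventually (Metric.isOpen_ball.mem_nhds hz)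
    filter_upwards [h3] with t ht
    rw [hcz _ (hsub ht)]
  have hQx' : ∀ z ∈ Metric.ball q δ,
      HasDerivAt (fun s => Q (c (s, z.2))) (fderiv ℝ Q (c z) (1, 0)) z.1 := by
    intro z hz
    simp only [hcz z (hsub hz)]
    have h1 : HasFDerivAt Q (fderiv ℝ Q z) z := ((hQ.differentiableOn one_ne_zero).differentiableAt
      (hD.mem_nhds (hD' (hsub hz)))).hasFDerivAt
    have h2 : HasDerivAt (fun s => Q (s, z.2)) (fderiv ℝ Q z (1, 0)) z.1 :=
      h1.comp_hasDerivAt z.1 ((hasDerivAt_id z.1).prodMk (hasDerivAt_const z.1 z.2))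
    refine h2.congr_of_eventuallyEq ?_
    have h3 : ∀ᶠ s in 𝓝 z.1, (s, z.2) ∈ Metric.ball q δ :=
      (Continuous.prodMk_left z.2).continuousAt.eventually (Metric.isOpen_ball.mem_nhds hz)
    filter_upwards [h3] with t ht
    rw [hcz _ (hsub ht)]
  have hflat' : ∀ z ∈ Metric.ball q δ, ∀ v, fderiv ℝ P (c z) (0, 1) v + P (c z) (Q (c z) v) =
      fderiv ℝ Q (c z) (1, 0) v + Q (c z) (P (c z) v) := by
    intro z hz v
    simp only [hcz z (hsub hz)]
    exact hflat z (hD' (hsub hz)) v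
  obtain ⟨X, hXy, hX⟩ := exists_hasFDerivAt_of_flat_of_small (P := fun z => P (c z))
    (Q := fun z => Q (c z)) (Py := fun z => fderiv ℝ P (c z) (0, 1))
    (Qx := fun z => fderiv ℝ Q (c z) (1, 0)) (hcomp hP.continuousOn) (hcomp hQ.continuousOn)
    (hcomp hPy) (hcomp hQx) hδ hK0.le
    (fun z => (hK₁ _ (hcm z)).trans ((le_max_left _ _).trans (le_max_left _ _)))
    (fun z => (hK₂ _ (hcm z)).trans ((le_max_right _ _).trans (le_max_left _ _)))
    (fun z => (hK₃ _ (hcm z)).trans ((le_max_left _ _).trans (le_max_right _ _)))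
    hδK hδ1 (q := q) hPy' hQx' hflat' hy e
  refine ⟨X, hXy, fun z hz => ?_⟩
  have := hX z hz
  simp only [hcz z (hsub hz)] at this
  exact this

theorem IsParallel.sub {X Y : ℝ × ℝ → E} (hX : IsParallel P Q U X) (hY : IsParallel P Q U Y) :
    IsParallel P Q U (X - Y) := by
  intro z hz
  refine ((hX z hz).sub (hY z hz)).congr_fderiv ?_
  ext <;> simp

/-- Grönwall's inequality along the segment from `y` to `z`: on it the derivative of X is bounded by
a multiple of the norm of X. -/
theorem IsParallel.eq_zero_of_convex {X : ℝ × ℝ → E} (hX : IsParallel P Q U X) {K : ℝ}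
    (hU : Convex ℝ U) (hPK : ∀ z ∈ U, ‖P z‖ ≤ K) (hQK : ∀ z ∈ U, ‖Q z‖ ≤ K) {y : ℝ × ℝ}
    (hy : y ∈ U) (hXy : X y = 0) {z : ℝ × ℝ} (hz : z ∈ U) : X z = 0 := by
  let γ : ℝ → ℝ × ℝ := fun t => y + t • (z - y)
  have hγU : ∀ t ∈ Icc (0 : ℝ) 1, γ t ∈ U := fun t ht => hU.add_smul_sub_mem hy hz ht
  have hγ : ∀ t, HasDerivAt γ (z - y) t := fun t => by
    have := ((hasDerivAt_id t).smul_const (z - y)).const_add y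
    rwa [one_smul] at this
  have hd : ∀ t ∈ Icc (0 : ℝ) 1, HasDerivAt (fun t => X (γ t))
      (planeDeriv (P (γ t) (X (γ t))) (Q (γ t) (X (γ t))) (z - y)) t := fun t ht =>
    (hX _ (hγU t ht)).comp_hasDerivAt t (hγ t)
  have h1 := eq_zero_of_abs_deriv_le_mul_abs_self_of_eq_zero_right (f := fun t => X (γ t))
    (f' := fun t => planeDeriv (P (γ t) (X (γ t))) (Q (γ t) (X (γ t))) (z - y))
    (K := ‖z - y‖ * K + ‖z - y‖ * K) (a := 0) (b := 1)
    (fun t ht => (hd t ht).continuousAt.continuousWithinAt)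
    (fun t ht => (hd t (Ico_subset_Icc_self ht)).hasDerivWithinAt) (by simpa [γ] using hXy)
    (fun t ht => by
      have hm := hγU t (Ico_subset_Icc_self ht)
      rw [planeDeriv_apply]
      refine (norm_add_le _ _).trans ?_
      rw [norm_smul, norm_smul, add_mul, mul_assoc]
      refine add_le_add (mul_le_mul (norm_fst_le (z - y)) ?_ (norm_nonneg _) (norm_nonneg _))
        (mul_le_mul (norm_snd_le (z - y)) ?_ (norm_nonneg _) (norm_nonneg _))
      · exact ((P _).le_opNorm _).trans (by gcongr; exact hPK _ hm)
      · exact ((Q _).le_opNorm _).trans (by gcongr; exact hQK _ hm)) 1 (by simp)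
  simpa [γ] using h1

/-- The set where two solutions agree is open and relatively closed, because on a small ball
agreement at one point implies agreement everywhere. -/
theorem IsParallel.eqOn (hU : IsOpen U) (hUc : IsPreconnected U) (hP : ContinuousOn P U)
    (hQ : ContinuousOn Q U) {X Y : ℝ × ℝ → E} (hX : IsParallel P Q U X) (hY : IsParallel P Q U Y)
    {y : ℝ × ℝ} (hy : y ∈ U) (hXY : X y = Y y) : EqOn X Y U := by
  have hZ := hX.sub hY
  have hloc : ∀ q ∈ U, ∃ δ > 0, ∀ y ∈ Metric.ball q δ, y ∈ U ∧ (X y = Y y →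
      ∀ z ∈ Metric.ball q δ, X z = Y z) := by
    intro q hq
    obtain ⟨δ, hδ, hδU⟩ := Metric.nhds_basis_closedBall.mem_iff.1 (hU.mem_nhds hq)
    have hcpt : IsCompact (Metric.closedBall q δ) := isCompact_closedBall q δ
    obtain ⟨K₁, hK₁⟩ := hcpt.exists_bound_of_continuousOn (hP.mono hδU)
    obtain ⟨K₂, hK₂⟩ := hcpt.exists_bound_of_continuousOn (hQ.mono hδU)
    have hb : Metric.ball q δ ⊆ Metric.closedBall q δ := Metric.ball_subset_closedBall
    refine ⟨δ, hδ, fun y hy => ⟨hδU (hb hy), fun h z hz => sub_eq_zero.1 ?_⟩⟩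
    exact (hZ.mono (hb.trans hδU)).eq_zero_of_convex (convex_ball q δ)
      (K := max K₁ K₂) (fun z hz => (hK₁ z (hb hz)).trans (le_max_left _ _))
      (fun z hz => (hK₂ z (hb hz)).trans (le_max_right _ _)) hy (sub_eq_zero.2 h) hz
  have hsub : U ⊆ {z | z ∈ U ∧ X z = Y z} := by
    refine hUc.subset_of_closure_inter_subset ?_ ⟨y, hy, hy, hXY⟩ ?_
    · rw [isOpen_iff_mem_nhds]
      rintro q ⟨hq, hqe⟩
      obtain ⟨δ, hδ, h⟩ := hloc q hq
      filter_upwards [Metric.ball_mem_nhds q hδ] with z hz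
      exact ⟨(h z hz).1, (h q (Metric.mem_ball_self hδ)).2 hqe z hz⟩
    · rintro q ⟨hqc, hq⟩
      obtain ⟨δ, hδ, h⟩ := hloc q hq
      obtain ⟨z, ⟨-, hze⟩, hz⟩ := Metric.mem_closure_iff.1 hqc δ hδ
      rw [dist_comm] at hz
      exact ⟨hq, (h z hz).2 hze q (Metric.mem_ball_self hδ)⟩
  exact fun z hz => (hsub hz).2

/-- A flat linear system on a simply connected open set has a solution with a prescribed value. -/
theorem exists_isParallel [CompleteSpace E] (hD : IsOpen D) (hDs : IsSimplyConnected D)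
    (hP : ContDiffOn ℝ 1 P D) (hQ : ContDiffOn ℝ 1 Q D) (hflat : IsFlat P Q D) {q : ℝ × ℝ}
    (hq : q ∈ D) (e : E) : ∃ X, X q = e ∧ IsParallel P Q D X := by
  have := hDs.simplyConnectedSpace
  have := hD.locallyPathConnectedSpace
  choose! δ hδ hδD S hS0 hS using fun q (hq : q ∈ D) => exists_isParallel_ball hD hP hQ hflat hq
  -- Uniqueness on balls makes the local solution operators a transport: they compose within a ball
  -- and agree near points of overlap.
  have huniq : ∀ i ∈ D, ∀ X Y : ℝ × ℝ → E, IsParallel P Q (Metric.ball i (δ i)) X →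
      IsParallel P Q (Metric.ball i (δ i)) Y → ∀ y ∈ Metric.ball i (δ i), X y = Y y →
      ∀ z ∈ Metric.ball i (δ i), X z = Y z := fun i hi X Y hX hY y hy h z hz =>
    IsParallel.eqOn Metric.isOpen_ball (convex_ball _ _).isPreconnected
      (hP.continuousOn.mono (hδD i hi)) (hQ.continuousOn.mono (hδD i hi)) hX hY hy h hz
  obtain ⟨u, hu0, hu⟩ := exists_horizontal_section (X := D) (F := E)
    (fun i => Subtype.val ⁻¹' Metric.ball (i : ℝ × ℝ) (δ i))
    (fun i => Metric.isOpen_ball.preimage continuous_subtype_val)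
    (fun i => Metric.mem_ball_self (hδ i i.2))
    (fun i y z e => S i y e z)
    (fun i y hy e => hS0 i i.2 y hy e)
    (fun i y hy z hz w hw e => huniq i i.2 _ _ (hS i i.2 z hz _) (hS i i.2 y hy e) z hz
      (hS0 i i.2 z hz _) w hw)
    (fun i j y hy e => by
      obtain ⟨ρ, hρ, hρs⟩ := Metric.isOpen_iff.1
        (Metric.isOpen_ball.inter Metric.isOpen_ball) (y : ℝ × ℝ) hy
      have h1 : EqOn (S i y e) (S j y e) (Metric.ball (y : ℝ × ℝ) ρ) :=
        IsParallel.eqOn (P := P) (Q := Q) Metric.isOpen_ball (convex_ball _ _).isPreconnected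
        (hP.continuousOn.mono fun z hz => hδD i i.2 (hρs hz).1)
        (hQ.continuousOn.mono fun z hz => hδD i i.2 (hρs hz).1)
        ((hS i i.2 y hy.1 e).mono fun z hz => (hρs hz).1)
        ((hS j j.2 y hy.2 e).mono fun z hz => (hρs hz).2) (Metric.mem_ball_self hρ)
        ((hS0 i i.2 y hy.1 e).trans (hS0 j j.2 y hy.2 e).symm)
      filter_upwards [continuous_subtype_val.continuousAt.eventually
        (Metric.ball_mem_nhds (y : ℝ × ℝ) hρ)] with z hz
      exact h1 hz) ⟨q, hq⟩ e
  classical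
  refine ⟨fun z => if hz : z ∈ D then u ⟨z, hz⟩ else 0, by simpa [hq] using hu0, fun z hz => ?_⟩
  have h1 := hu ⟨z, hz⟩ ⟨z, hz⟩ (Metric.mem_ball_self (hδ z hz))
  have h2 := hS z hz z (Metric.mem_ball_self (hδ z hz)) (u ⟨z, hz⟩) z
    (Metric.mem_ball_self (hδ z hz))
  rw [hS0 z hz z (Metric.mem_ball_self (hδ z hz))] at h2
  simp only [dif_pos hz]
  refine h2.congr_of_eventuallyEq ?_
  rw [nhds_subtype_eq_comap_nhdsWithin, eventually_comap] at h1
  rw [hD.nhdsWithin_eq hz] at h1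
  filter_upwards [h1, hD.mem_nhds hz] with w hw hwD
  rw [dif_pos hwD]
  exact hw ⟨w, hwD⟩ rfl

/-- A closed continuously differentiable one-form on a simply connected open set is exact. -/
theorem exists_hasFDerivAt_of_closed [CompleteSpace E] (hD : IsOpen D) (hDs : IsSimplyConnected D)
    {a b : ℝ × ℝ → E} (ha : ContDiffOn ℝ 1 a D) (hb : ContDiffOn ℝ 1 b D)
    (hab : ∀ z ∈ D, dy a z = dx b z) {q : ℝ × ℝ} (hq : q ∈ D) (e : E) :
    ∃ g, g q = e ∧ ∀ z ∈ D, HasFDerivAt g (planeDeriv (a z) (b z)) z := by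
  -- The inhomogeneous equations g_x = a, g_y = b become linear after adjoining a scalar s: (g, s)_x
  -- = (s a, 0), (g, s)_y = (s b, 0). Products of these operators vanish, so flatness is closedness;
  -- s stays equal to 1.
  let Λ : E →L[ℝ] (E × ℝ →L[ℝ] E × ℝ) :=
    ((ContinuousLinearMap.compL ℝ (E × ℝ) E (E × ℝ)) (ContinuousLinearMap.inl ℝ E ℝ)).comp
      ((ContinuousLinearMap.smulRightL ℝ (E × ℝ) E) (ContinuousLinearMap.snd ℝ E ℝ))
  have hΛ : ∀ c v, Λ c v = (v.2 • c, 0) := fun c v => by simp [Λ]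
  have hΛd : ∀ {c : ℝ × ℝ → E}, ContDiffOn ℝ 1 c D → ∀ z ∈ D, ∀ w,
      fderiv ℝ (fun z => Λ (c z)) z w = Λ (fderiv ℝ c z w) := fun {c} hc z hz w => by
    have := (Λ.hasFDerivAt.comp z ((hc.differentiableOn one_ne_zero).differentiableAt
      (hD.mem_nhds hz)).hasFDerivAt).fderiv
    simpa [Function.comp_def] using congrArg (fun L => L w) this
  obtain ⟨X, hX0, hX⟩ := exists_isParallel (P := fun z => Λ (a z)) (Q := fun z => Λ (b z)) hD hDs
    (Λ.contDiff.comp_contDiffOn ha) (Λ.contDiff.comp_contDiffOn hb) (fun z hz v => by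
      rw [hΛd ha z hz, hΛd hb z hz]
      simp only [hΛ, zero_smul, Prod.mk_add_mk, add_zero]
      congr 2
      exact hab z hz) hq (e, 1)
  have hX2 : ∀ z ∈ D, (X z).2 = 1 := by
    have h1 : ∀ z ∈ D, HasFDerivAt (fun z => (X z).2) 0 z := fun z hz => by
      refine (hX z hz).snd.congr_fderiv ?_
      ext <;> simp [hΛ]
    intro z hz
    rw [hD.is_const_of_fderiv_eq_zero (𝕜 := ℝ) (f := fun z => (X z).2)
      hDs.isPathConnected.isConnected.isPreconnected
      (fun z hz => (h1 z hz).differentiableAt.differentiableWithinAt)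
      (fun z hz => (h1 z hz).fderiv) hz hq, hX0]
  refine ⟨fun z => (X z).1, by simp [hX0], fun z hz => ?_⟩
  refine (hX z hz).fst.congr_fderiv ?_
  ext <;> simp [hΛ, hX2 z hz]

end Flat

/-! ### Partial derivatives -/

section Calculus

variable {E : Type*} [NormedAddCommGroup E] [NormedSpace ℝ E] {D : Set (ℝ × ℝ)}

theorem fderiv_eq_planeDeriv (g : ℝ × ℝ → E) (z : ℝ × ℝ) :
    fderiv ℝ g z = planeDeriv (dx g z) (dy g z) := by
  ext <;> simp [dx, dy]

theorem dx_of_hasFDerivAt {g : ℝ × ℝ → E} {a b : E} {z : ℝ × ℝ}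
    (h : HasFDerivAt g (planeDeriv a b) z) : dx g z = a := by
  simp [dx, h.fderiv]

theorem dy_of_hasFDerivAt {g : ℝ × ℝ → E} {a b : E} {z : ℝ × ℝ}
    (h : HasFDerivAt g (planeDeriv a b) z) : dy g z = b := by
  simp [dy, h.fderiv]

theorem dx_congr {g h : ℝ × ℝ → E} {z : ℝ × ℝ} (hgh : g =ᶠ[𝓝 z] h) : dx g z = dx h z := by
  simp [dx, hgh.fderiv_eq]

theorem dy_congr {g h : ℝ × ℝ → E} {z : ℝ × ℝ} (hgh : g =ᶠ[𝓝 z] h) : dy g z = dy h z := by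
  simp [dy, hgh.fderiv_eq]

theorem contDiffOn_dx {n m : ℕ} (hmn : m + 1 ≤ n) {g : ℝ × ℝ → E} (hD : IsOpen D)
    (hg : ContDiffOn ℝ n g D) : ContDiffOn ℝ m (dx g) D :=
  (hg.fderiv_of_isOpen hD (by exact_mod_cast hmn)).clm_apply contDiffOn_const

theorem contDiffOn_dy {n m : ℕ} (hmn : m + 1 ≤ n) {g : ℝ × ℝ → E} (hD : IsOpen D)
    (hg : ContDiffOn ℝ n g D) : ContDiffOn ℝ m (dy g) D :=
  (hg.fderiv_of_isOpen hD (by exact_mod_cast hmn)).clm_apply contDiffOn_const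

theorem contDiffOn_succ_of_dx_dy {n : ℕ} {g : ℝ × ℝ → E} (hD : IsOpen D)
    (hg : DifferentiableOn ℝ g D) (hx : ContDiffOn ℝ n (dx g) D) (hy : ContDiffOn ℝ n (dy g) D) :
    ContDiffOn ℝ (n + 1 : ℕ) g D := by
  push_cast
  rw [contDiffOn_succ_iff_fderiv_of_isOpen hD]
  refine ⟨hg, by simp, ?_⟩
  have h : fderiv ℝ g = fun z => planeDeriv (dx g z) (dy g z) :=
    funext (fderiv_eq_planeDeriv g)
  rw [h]
  have h2 : (fun z => planeDeriv (dx g z) (dy g z)) = fun z =>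
      (ContinuousLinearMap.fst ℝ ℝ ℝ).smulRight (dx g z) +
        (ContinuousLinearMap.snd ℝ ℝ ℝ).smulRight (dy g z) := by
    funext z
    ext <;> simp
  rw [h2]
  exact (contDiffOn_const.smulRight hx).add (contDiffOn_const.smulRight hy)

theorem dx_dy_comm {g : ℝ × ℝ → E} (hD : IsOpen D) (hg : ContDiffOn ℝ 2 g D) {z : ℝ × ℝ}
    (hz : z ∈ D) : dx (dy g) z = dy (dx g) z := by
  have h1 : ContDiffAt ℝ 2 g z := hg.contDiffAt (hD.mem_nhds hz)
  have h2 : DifferentiableAt ℝ (fderiv ℝ g) z :=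
    (h1.fderiv_right (m := 1) (by norm_num)).differentiableAt one_ne_zero
  have h3 := h1.isSymmSndFDerivAt (by simp)
  have h4 : ∀ v w, fderiv ℝ (fun y => fderiv ℝ g y v) z w = fderiv ℝ (fderiv ℝ g) z w v := by
    intro v w
    rw [fderiv_clm_apply h2 (differentiableAt_const v)]
    simp
  exact (h4 (0, 1) (1, 0)).trans ((h3 (1, 0) (0, 1)).trans (h4 (1, 0) (0, 1)).symm)

theorem _root_.ContDiffOn.differentiableAt_of_isOpen {n : WithTop ℕ∞} {g : ℝ × ℝ → E}
    (hg : ContDiffOn ℝ n g D) (hn : n ≠ 0) (hD : IsOpen D) {z : ℝ × ℝ} (hz : z ∈ D) :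
    DifferentiableAt ℝ g z :=
  (hg.differentiableOn hn).differentiableAt (hD.mem_nhds hz)

end Calculus

/-! ### Product rules for the scalar and vector products -/

section Products

variable {𝕜 : Type*} [RCLike 𝕜] {ε : ℝ}

@[simp] theorem dot_add_left (u v w : Fin 3 → 𝕜) : dot ε (u + v) w = dot ε u w + dot ε v w := by
  simp only [dot, Pi.add_apply]; ring

@[simp] theorem dot_add_right (u v w : Fin 3 → 𝕜) : dot ε u (v + w) = dot ε u v + dot ε u w := by
  simp only [dot, Pi.add_apply]; ring

@[simp] theorem dot_sub_left (u v w : Fin 3 → 𝕜) : dot ε (u - v) w = dot ε u w - dot ε v w := by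
  simp only [dot, Pi.sub_apply]; ring

@[simp] theorem dot_sub_right (u v w : Fin 3 → 𝕜) : dot ε u (v - w) = dot ε u v - dot ε u w := by
  simp only [dot, Pi.sub_apply]; ring

@[simp] theorem dot_smul_left (k : 𝕜) (u v : Fin 3 → 𝕜) : dot ε (k • u) v = k * dot ε u v := by
  simp only [dot, Pi.smul_apply, smul_eq_mul]; ring

@[simp] theorem dot_smul_right (k : 𝕜) (u v : Fin 3 → 𝕜) : dot ε u (k • v) = k * dot ε u v := by
  simp only [dot, Pi.smul_apply, smul_eq_mul]; ring

theorem dot_comm (u v : Fin 3 → 𝕜) : dot ε u v = dot ε v u := by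
  simp only [dot]; ring

@[fun_prop]
theorem differentiableAt_dot {u v : ℝ × ℝ → Fin 3 → 𝕜} {z : ℝ × ℝ} (hu : DifferentiableAt ℝ u z)
    (hv : DifferentiableAt ℝ v z) : DifferentiableAt ℝ (fun w => dot ε (u w) (v w)) z := by
  rw [differentiableAt_pi] at hu hv
  have := hu 0; have := hu 1; have := hu 2; have := hv 0; have := hv 1; have := hv 2
  simp only [dot]
  fun_prop

theorem fderiv_dot {u v : ℝ × ℝ → Fin 3 → 𝕜} {z : ℝ × ℝ} (hu : DifferentiableAt ℝ u z)
    (hv : DifferentiableAt ℝ v z) (a : ℝ × ℝ) : fderiv ℝ (fun w => dot ε (u w) (v w)) z a =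
      dot ε (fderiv ℝ u z a) (v z) + dot ε (u z) (fderiv ℝ v z a) := by
  have h : HasFDerivAt (fun w => dot ε (u w) (v w)) _ z :=
    ((hasFDerivAt_pi'.1 hu.hasFDerivAt 0).mul (hasFDerivAt_pi'.1 hv.hasFDerivAt 0)).add
      ((((hasFDerivAt_pi'.1 hu.hasFDerivAt 1).mul (hasFDerivAt_pi'.1 hv.hasFDerivAt 1)).add
        ((hasFDerivAt_pi'.1 hu.hasFDerivAt 2).mul (hasFDerivAt_pi'.1 hv.hasFDerivAt 2))).const_mul
          (ε : 𝕜))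
  rw [h.fderiv]
  simp [dot, RCLike.real_smul_eq_coe_mul]
  ring

@[fun_prop]
theorem differentiableAt_cross {u v : ℝ × ℝ → Fin 3 → 𝕜} {z : ℝ × ℝ}
    (hu : DifferentiableAt ℝ u z) (hv : DifferentiableAt ℝ v z) :
    DifferentiableAt ℝ (fun w => cross ε (u w) (v w)) z := by
  rw [differentiableAt_pi] at hu hv ⊢
  have := hu 0; have := hu 1; have := hu 2; have := hv 0; have := hv 1; have := hv 2
  intro i
  fin_cases i <;> simp [cross] <;> fun_prop

theorem fderiv_cross {u v : ℝ × ℝ → Fin 3 → 𝕜} {z : ℝ × ℝ} (hu : DifferentiableAt ℝ u z)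
    (hv : DifferentiableAt ℝ v z) (a : ℝ × ℝ) : fderiv ℝ (fun w => cross ε (u w) (v w)) z a =
      cross ε (fderiv ℝ u z a) (v z) + cross ε (u z) (fderiv ℝ v z a) := by
  have h0 := hasFDerivAt_pi'.1 hu.hasFDerivAt
  have h1 := hasFDerivAt_pi'.1 hv.hasFDerivAt
  have h2 := hasFDerivAt_pi'.1 (differentiableAt_cross (ε := ε) hu hv).hasFDerivAt
  have h3 : ∀ i, fderiv ℝ (fun w => cross ε (u w) (v w)) z a i =
      fderiv ℝ (fun w => cross ε (u w) (v w) i) z a := fun i => by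
    rw [(h2 i).fderiv]; rfl
  ext i
  rw [h3]
  fin_cases i
  · have h : HasFDerivAt (fun w => cross ε (u w) (v w) 0) _ z :=
      ((h0 1).mul (h1 2)).sub ((h0 2).mul (h1 1))
    simp only [Fin.zero_eta, h.fderiv]
    simp [cross]
    ring
  · have h : HasFDerivAt (fun w => cross ε (u w) (v w) 1) _ z :=
      (((h0 2).mul (h1 0)).sub ((h0 0).mul (h1 2))).const_mul (ε : 𝕜)
    simp only [Fin.mk_one, h.fderiv]
    simp [cross]
    ring
  · have h : HasFDerivAt (fun w => cross ε (u w) (v w) 2) _ z :=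
      (((h0 0).mul (h1 1)).sub ((h0 1).mul (h1 0))).const_mul (ε : 𝕜)
    simp only [Fin.reduceFinMk, h.fderiv]
    simp [cross]
    ring

theorem contDiffOn_dot {n : WithTop ℕ∞} {D : Set (ℝ × ℝ)} {u v : ℝ × ℝ → Fin 3 → 𝕜}
    (hu : ContDiffOn ℝ n u D) (hv : ContDiffOn ℝ n v D) :
    ContDiffOn ℝ n (fun w => dot ε (u w) (v w)) D := by
  rw [contDiffOn_pi] at hu hv
  exact ((hu 0).mul (hv 0)).add (contDiffOn_const.mul (((hu 1).mul (hv 1)).add ((hu 2).mul (hv 2))))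

theorem contDiffOn_cross {n : WithTop ℕ∞} {D : Set (ℝ × ℝ)} {u v : ℝ × ℝ → Fin 3 → 𝕜}
    (hu : ContDiffOn ℝ n u D) (hv : ContDiffOn ℝ n v D) :
    ContDiffOn ℝ n (fun w => cross ε (u w) (v w)) D := by
  rw [contDiffOn_pi] at hu hv ⊢
  intro i
  fin_cases i
  · exact ((hu 1).mul (hv 2)).sub ((hu 2).mul (hv 1))
  · exact contDiffOn_const.mul (((hu 2).mul (hv 0)).sub ((hu 0).mul (hv 2)))
  · exact contDiffOn_const.mul (((hu 0).mul (hv 1)).sub ((hu 1).mul (hv 0)))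

variable {z : ℝ × ℝ}

theorem fderiv_mul_apply {φ ψ : ℝ × ℝ → 𝕜} (hφ : DifferentiableAt ℝ φ z)
    (hψ : DifferentiableAt ℝ ψ z) (a : ℝ × ℝ) :
    fderiv ℝ (fun w => φ w * ψ w) z a = fderiv ℝ φ z a * ψ z + φ z * fderiv ℝ ψ z a := by
  rw [fderiv_fun_mul hφ hψ]
  simp
  ring

theorem fderiv_smul_apply {φ : ℝ × ℝ → 𝕜} {u : ℝ × ℝ → Fin 3 → 𝕜} (hφ : DifferentiableAt ℝ φ z)
    (hu : DifferentiableAt ℝ u z) (a : ℝ × ℝ) :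
    fderiv ℝ (fun w => φ w • u w) z a = fderiv ℝ φ z a • u z + φ z • fderiv ℝ u z a := by
  rw [fderiv_fun_smul hφ hu]
  simp [add_comm]

theorem fderiv_add_apply {E : Type*} [NormedAddCommGroup E] [NormedSpace ℝ E]
    {u v : ℝ × ℝ → E} (hu : DifferentiableAt ℝ u z) (hv : DifferentiableAt ℝ v z) (a : ℝ × ℝ) :
    fderiv ℝ (fun w => u w + v w) z a = fderiv ℝ u z a + fderiv ℝ v z a := by
  rw [fderiv_fun_add hu hv]; rfl

theorem fderiv_sub_apply {E : Type*} [NormedAddCommGroup E] [NormedSpace ℝ E]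
    {u v : ℝ × ℝ → E} (hu : DifferentiableAt ℝ u z) (hv : DifferentiableAt ℝ v z) (a : ℝ × ℝ) :
    fderiv ℝ (fun w => u w - v w) z a = fderiv ℝ u z a - fderiv ℝ v z a := by
  rw [fderiv_fun_sub hu hv]; rfl

theorem dx_mul {φ ψ : ℝ × ℝ → 𝕜} (h₁ : DifferentiableAt ℝ φ z)
    (h₂ : DifferentiableAt ℝ ψ z) :
    dx (fun w => φ w * ψ w) z = dx φ z * ψ z + φ z * dx ψ z :=
  fderiv_mul_apply h₁ h₂ _

theorem dx_smul {φ : ℝ × ℝ → 𝕜} {u : ℝ × ℝ → Fin 3 → 𝕜} (h₁ : DifferentiableAt ℝ φ z)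
    (h₂ : DifferentiableAt ℝ u z) :
    dx (fun w => φ w • u w) z = dx φ z • u z + φ z • dx u z :=
  fderiv_smul_apply h₁ h₂ _

theorem dx_dot {u v : ℝ × ℝ → Fin 3 → 𝕜} (h₁ : DifferentiableAt ℝ u z)
    (h₂ : DifferentiableAt ℝ v z) :
    dx (fun w => dot ε (u w) (v w)) z = dot ε (dx u z) (v z) + dot ε (u z) (dx v z) :=
  fderiv_dot h₁ h₂ _

theorem dx_cross {u v : ℝ × ℝ → Fin 3 → 𝕜} (h₁ : DifferentiableAt ℝ u z)
    (h₂ : DifferentiableAt ℝ v z) :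
    dx (fun w => cross ε (u w) (v w)) z = cross ε (dx u z) (v z) + cross ε (u z) (dx v z) :=
  fderiv_cross h₁ h₂ _

theorem dx_add {E : Type*} [NormedAddCommGroup E] [NormedSpace ℝ E] {g h : ℝ × ℝ → E}
    (h₁ : DifferentiableAt ℝ g z)
    (h₂ : DifferentiableAt ℝ h z) :
    dx (fun w => g w + h w) z = dx g z + dx h z :=
  fderiv_add_apply h₁ h₂ _

theorem dx_sub {E : Type*} [NormedAddCommGroup E] [NormedSpace ℝ E] {g h : ℝ × ℝ → E}
    (h₁ : DifferentiableAt ℝ g z)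
    (h₂ : DifferentiableAt ℝ h z) :
    dx (fun w => g w - h w) z = dx g z - dx h z :=
  fderiv_sub_apply h₁ h₂ _

theorem dy_mul {φ ψ : ℝ × ℝ → 𝕜} (h₁ : DifferentiableAt ℝ φ z)
    (h₂ : DifferentiableAt ℝ ψ z) :
    dy (fun w => φ w * ψ w) z = dy φ z * ψ z + φ z * dy ψ z :=
  fderiv_mul_apply h₁ h₂ _

theorem dy_smul {φ : ℝ × ℝ → 𝕜} {u : ℝ × ℝ → Fin 3 → 𝕜} (h₁ : DifferentiableAt ℝ φ z)
    (h₂ : DifferentiableAt ℝ u z) :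
    dy (fun w => φ w • u w) z = dy φ z • u z + φ z • dy u z :=
  fderiv_smul_apply h₁ h₂ _

theorem dy_dot {u v : ℝ × ℝ → Fin 3 → 𝕜} (h₁ : DifferentiableAt ℝ u z)
    (h₂ : DifferentiableAt ℝ v z) :
    dy (fun w => dot ε (u w) (v w)) z = dot ε (dy u z) (v z) + dot ε (u z) (dy v z) :=
  fderiv_dot h₁ h₂ _

theorem dy_cross {u v : ℝ × ℝ → Fin 3 → 𝕜} (h₁ : DifferentiableAt ℝ u z)
    (h₂ : DifferentiableAt ℝ v z) :
    dy (fun w => cross ε (u w) (v w)) z = cross ε (dy u z) (v z) + cross ε (u z) (dy v z) :=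
  fderiv_cross h₁ h₂ _

theorem dy_add {E : Type*} [NormedAddCommGroup E] [NormedSpace ℝ E] {g h : ℝ × ℝ → E}
    (h₁ : DifferentiableAt ℝ g z)
    (h₂ : DifferentiableAt ℝ h z) :
    dy (fun w => g w + h w) z = dy g z + dy h z :=
  fderiv_add_apply h₁ h₂ _

theorem dy_sub {E : Type*} [NormedAddCommGroup E] [NormedSpace ℝ E] {g h : ℝ × ℝ → E}
    (h₁ : DifferentiableAt ℝ g z)
    (h₂ : DifferentiableAt ℝ h z) :
    dy (fun w => g w - h w) z = dy g z - dy h z :=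
  fderiv_sub_apply h₁ h₂ _

end Products

/-! ### The Moutard relations and the equation for θ -/

section Moutard

variable {𝕜 : Type*} [RCLike 𝕜] {ε : ℝ}

/-- A normal field `N` together with a potential `p`, with coefficients in `𝕜`. -/
structure IsNormalPair (ε : ℝ) (Δ : 𝕜) (D : Set (ℝ × ℝ)) (A B C : ℝ × ℝ → 𝕜)
    (N : ℝ × ℝ → Fin 3 → 𝕜) (f p : ℝ × ℝ → 𝕜) : Prop where
  isOpen : IsOpen D
  contDiffOn_A : ContDiffOn ℝ 1 A D
  contDiffOn_B : ContDiffOn ℝ 1 B D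
  contDiffOn_C : ContDiffOn ℝ 1 C D
  contDiffOn_N : ContDiffOn ℝ 2 N D
  contDiffOn_p : ContDiffOn ℝ 2 p D
  disc_sq : Δ * Δ = 1
  disc : ∀ z ∈ D, A z * B z - C z ^ 2 = Δ
  field_eq : ∀ z ∈ D, dx (fun w => A w • dx N w + C w • dy N w) z +
    dy (fun w => C w • dx N w + B w • dy N w) z = f z • N z
  quad_eq : ∀ z ∈ D, A z * dot ε (dx N z) (dx N z) + 2 * C z * dot ε (dx N z) (dy N z) +
    B z * dot ε (dy N z) (dy N z) = -(f z * sqNorm ε N z)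
  dx_p : ∀ z ∈ D, dx p z = 2 * (C z * dot ε (N z) (dx N z) + B z * dot ε (N z) (dy N z))
  dy_p : ∀ z ∈ D, dy p z = -2 * (A z * dot ε (N z) (dx N z) + C z * dot ε (N z) (dy N z))
  p_ne : ∀ z ∈ D, p z ≠ 0
  denom_ne : ∀ z ∈ D, p z ^ 2 + sqNorm ε N z ^ 2 * Δ ≠ 0

/-- The first-order relations at `w` between the function `θ`, its derivatives `α`, `β`, and the
field `X = θ N'`. -/
structure MoutardRel (ε : ℝ) (A B C : ℝ × ℝ → 𝕜) (N : ℝ × ℝ → Fin 3 → 𝕜) (p : ℝ × ℝ → 𝕜)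
    (X : ℝ × ℝ → Fin 3 → 𝕜) (θ α β : ℝ × ℝ → 𝕜) (w : ℝ × ℝ) : Prop where
  theta_eq : p w * θ w = dot ε (X w) (N w)
  eq_x : p w * α w + dot ε (N w) (N w) * (C w * α w + B w * β w) =
    dot ε (X w) (dx N w) - θ w * dx p w / 2
  eq_y : p w * β w - dot ε (N w) (N w) * (A w * α w + C w * β w) =
    dot ε (X w) (dy N w) - θ w * dy p w / 2

variable {Δ : 𝕜} {D : Set (ℝ × ℝ)} {A B C : ℝ × ℝ → 𝕜} {N X : ℝ × ℝ → Fin 3 → 𝕜}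
  {f p θ α β : ℝ × ℝ → 𝕜} {z : ℝ × ℝ}

/-- `α` is defined algebraically; differentiating pθ = X·N and using (P) in the form p_x/2 = C N·N_x
+ B N·N_y turns its defining relation into pθ_x = pα. The hypothesis on `X` concerns the single
point `z`, so that test fields parallel only at `z` are covered. -/
theorem MoutardRel.dx_theta (hc : IsNormalPair ε Δ D A B C N f p) (hz : z ∈ D)
    (hX : DifferentiableAt ℝ X z) (hθ : DifferentiableAt ℝ θ z)
    (hrel : ∀ᶠ w in 𝓝 z, MoutardRel ε A B C N p X θ α β w)
    (hXx : dx X z = θ z • (C z • dx N z + B z • dy N z) - (C z * α z + B z * β z) • N z) :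
    dx θ z = α z := by
  have hN := hc.contDiffOn_N.differentiableAt_of_isOpen two_ne_zero hc.isOpen hz
  have hp := hc.contDiffOn_p.differentiableAt_of_isOpen two_ne_zero hc.isOpen hz
  have h1 : (fun w => p w * θ w) =ᶠ[𝓝 z] fun w => dot ε (X w) (N w) :=
    hrel.mono fun w hw => hw.theta_eq
  have h2 := dx_congr h1
  rw [dx_mul hp hθ, dx_dot hX hN, hXx] at h2
  have h3 := hrel.self_of_nhds.eq_x
  have h4 := hc.dx_p z hz
  simp only [dot_sub_left, dot_add_left, dot_smul_left] at h2
  rw [dot_comm (dx N z) (N z), dot_comm (dy N z) (N z)] at h2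
  refine mul_left_cancel₀ (hc.p_ne z hz) ?_
  linear_combination h2 - h3 - θ z * h4 / 2

theorem MoutardRel.dy_theta (hc : IsNormalPair ε Δ D A B C N f p) (hz : z ∈ D)
    (hX : DifferentiableAt ℝ X z) (hθ : DifferentiableAt ℝ θ z)
    (hrel : ∀ᶠ w in 𝓝 z, MoutardRel ε A B C N p X θ α β w)
    (hXy : dy X z = (A z * α z + C z * β z) • N z - θ z • (A z • dx N z + C z • dy N z)) :
    dy θ z = β z := by
  have hN := hc.contDiffOn_N.differentiableAt_of_isOpen two_ne_zero hc.isOpen hz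
  have hp := hc.contDiffOn_p.differentiableAt_of_isOpen two_ne_zero hc.isOpen hz
  have h1 : (fun w => p w * θ w) =ᶠ[𝓝 z] fun w => dot ε (X w) (N w) :=
    hrel.mono fun w hw => hw.theta_eq
  have h2 := dy_congr h1
  rw [dy_mul hp hθ, dy_dot hX hN, hXy] at h2
  have h3 := hrel.self_of_nhds.eq_y
  have h4 := hc.dy_p z hz
  simp only [dot_sub_left, dot_add_left, dot_smul_left] at h2
  rw [dot_comm (dx N z) (N z), dot_comm (dy N z) (N z)] at h2
  refine mul_left_cancel₀ (hc.p_ne z hz) ?_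
  linear_combination h2 - h3 - θ z * h4 / 2

/-- The function `θ` solves the scalar equation of the components of `N`. -/
theorem MoutardRel.operator_theta (hc : IsNormalPair ε Δ D A B C N f p) (hz : z ∈ D)
    (hX : DifferentiableAt ℝ X z) (hθ : DifferentiableAt ℝ θ z) (hα : DifferentiableAt ℝ α z)
    (hβ : DifferentiableAt ℝ β z)
    (hrel : ∀ᶠ w in 𝓝 z, MoutardRel ε A B C N p X θ α β w)
    (hXx : dx X z = θ z • (C z • dx N z + B z • dy N z) - (C z * α z + B z * β z) • N z)
    (hXy : dy X z = (A z * α z + C z * β z) • N z - θ z • (A z • dx N z + C z • dy N z)) :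
    dx (fun w => A w * α w + C w * β w) z + dy (fun w => C w * α w + B w * β w) z =
      f z * θ z := by
  have hD := hc.isOpen
  have hN := hc.contDiffOn_N.differentiableAt_of_isOpen two_ne_zero hD hz
  have hp := hc.contDiffOn_p.differentiableAt_of_isOpen two_ne_zero hD hz
  have hA := hc.contDiffOn_A.differentiableAt_of_isOpen one_ne_zero hD hz
  have hB := hc.contDiffOn_B.differentiableAt_of_isOpen one_ne_zero hD hz
  have hC := hc.contDiffOn_C.differentiableAt_of_isOpen one_ne_zero hD hz
  have hNx : DifferentiableAt ℝ (dx N) z :=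
    (contDiffOn_dx (n := 2) (m := 1) le_rfl hD hc.contDiffOn_N).differentiableAt_of_isOpen
      one_ne_zero hD hz
  have hNy : DifferentiableAt ℝ (dy N) z :=
    (contDiffOn_dy (n := 2) (m := 1) le_rfl hD hc.contDiffOn_N).differentiableAt_of_isOpen
      one_ne_zero hD hz
  have hpx : DifferentiableAt ℝ (dx p) z :=
    (contDiffOn_dx (n := 2) (m := 1) le_rfl hD hc.contDiffOn_p).differentiableAt_of_isOpen
      one_ne_zero hD hz
  have hpy : DifferentiableAt ℝ (dy p) z :=
    (contDiffOn_dy (n := 2) (m := 1) le_rfl hD hc.contDiffOn_p).differentiableAt_of_isOpen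
      one_ne_zero hD hz
  have hpxy := dx_dy_comm hD hc.contDiffOn_p hz
  have hNxy := dx_dy_comm hD hc.contDiffOn_N hz
  have hθx := MoutardRel.dx_theta hc hz hX hθ hrel hXx
  have hθy := MoutardRel.dy_theta hc hz hX hθ hrel hXy
  set a : ℝ × ℝ → 𝕜 := fun w => A w * α w + C w * β w with ha_def
  set b : ℝ × ℝ → 𝕜 := fun w => C w * α w + B w * β w with hb_def
  have ha : DifferentiableAt ℝ a z := by fun_prop
  have hb : DifferentiableAt ℝ b z := by fun_prop
  set m : ℝ × ℝ → Fin 3 → 𝕜 := fun w => A w • dx N w + C w • dy N w with hm_def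
  set n : ℝ × ℝ → Fin 3 → 𝕜 := fun w => C w • dx N w + B w • dy N w with hn_def
  have hm : DifferentiableAt ℝ m z := by fun_prop
  have hn : DifferentiableAt ℝ n z := by fun_prop
  have hLN : dx m z + dy n z = f z • N z := hc.field_eq z hz
  have hev : ∀ᶠ w in 𝓝 z, w ∈ D := hD.mem_nhds hz
  -- `e1` and `e2` are the two relations for α, β; `e3` and `e4` are their combinations with the
  -- coefficients (A, C) and (C, B). The curl of the first pair and the divergence of the second
  -- isolate the two unknown defects.
  have e1 : (fun w => p w * α w + dot ε (N w) (N w) * b w + 2⁻¹ * (θ w * dx p w)) =ᶠ[𝓝 z]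
      fun w => dot ε (X w) (dx N w) := hrel.mono fun w hw => by
    have := hw.eq_x
    simp only [hb_def]
    linear_combination this
  have e2 : (fun w => p w * β w - dot ε (N w) (N w) * a w + 2⁻¹ * (θ w * dy p w)) =ᶠ[𝓝 z]
      fun w => dot ε (X w) (dy N w) := hrel.mono fun w hw => by
    have := hw.eq_y
    simp only [ha_def]
    linear_combination this
  have e3 : (fun w => p w * a w + dot ε (N w) (N w) * (Δ * β w) +
      θ w * (Δ * dot ε (N w) (dy N w))) =ᶠ[𝓝 z] fun w => dot ε (X w) (m w) := by
    filter_upwards [hrel, hev] with w hw hwD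
    have h1 := hw.eq_x
    have h2 := hw.eq_y
    have h3 := hc.dx_p w hwD
    have h4 := hc.dy_p w hwD
    have h5 := hc.disc w hwD
    simp only [ha_def, hm_def, dot_add_right, dot_smul_right]
    rw [h3] at h1
    rw [h4] at h2
    rw [← h5]
    linear_combination A w * h1 + C w * h2
  have e4 : (fun w => p w * b w - dot ε (N w) (N w) * (Δ * α w) -
      θ w * (Δ * dot ε (N w) (dx N w))) =ᶠ[𝓝 z] fun w => dot ε (X w) (n w) := by
    filter_upwards [hrel, hev] with w hw hwD
    have h1 := hw.eq_x
    have h2 := hw.eq_y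
    have h3 := hc.dx_p w hwD
    have h4 := hc.dy_p w hwD
    have h5 := hc.disc w hwD
    simp only [hb_def, hn_def, dot_add_right, dot_smul_right]
    rw [h3] at h1
    rw [h4] at h2
    rw [← h5]
    linear_combination C w * h1 + B w * h2
  have hΔ : DifferentiableAt ℝ (fun _ : ℝ × ℝ => Δ) z := by fun_prop
  have d1 := dy_congr e1
  have d2 := dx_congr e2
  have d3 := dx_congr e3
  have d4 := dy_congr e4
  have c1 : dx (fun _ : ℝ × ℝ => Δ) z = 0 := by simp [dx]
  have c2 : dy (fun _ : ℝ × ℝ => Δ) z = 0 := by simp [dy]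
  have c3 : dx (fun _ : ℝ × ℝ => (2⁻¹ : 𝕜)) z = 0 := by simp [dx]
  have c4 : dy (fun _ : ℝ × ℝ => (2⁻¹ : 𝕜)) z = 0 := by simp [dy]
  simp (disch := fun_prop) only [dy_add, dy_sub, dy_mul, dy_dot, c2, c4] at d1 d4
  simp (disch := fun_prop) only [dx_add, dx_sub, dx_mul, dx_dot, c1, c3] at d2 d3
  have hXN := congrArg (dot ε (X z)) hLN
  rw [dot_add_right, dot_smul_right, ← hrel.self_of_nhds.theta_eq] at hXN
  have hq := hc.quad_eq z hz
  have hpx' := hc.dx_p z hz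
  have hpy' := hc.dy_p z hz
  have hdisc := hc.disc z hz
  rw [hθy, hXy] at d1 d4
  rw [hθx, hXx] at d2 d3
  rw [hpxy, hNxy] at d2
  rw [hNxy] at d3
  simp only [sqNorm] at hq
  simp only [hm_def, hn_def, dot_add_left, dot_add_right, dot_sub_left, dot_smul_left,
    dot_smul_right, dot_comm (dx N z) (N z), dot_comm (dy N z) (N z),
    dot_comm (dy N z) (dx N z)] at d1 d2 d3 d4
  -- ∂ᵧ of `e1` minus ∂ₓ of `e2`. The terms quadratic in the derivatives of N that come from X_y·N_x
  -- − X_x·N_y are removed by `quad_eq`, which is where (e2) enters.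
  have s1 : p z * (dy α z - dx β z) + dot ε (N z) (N z) * (dx a z + dy b z - f z * θ z) = 0 := by
    linear_combination d1 - d2 - θ z * hq - α z / 2 * hpy' + β z / 2 * hpx'
  -- ∂ₓ of `e3` plus ∂ᵧ of `e4`, with X·LN = f X·N = f p θ.
  have s2 : p z * (dx a z + dy b z - f z * θ z) -
      dot ε (N z) (N z) * Δ * (dy α z - dx β z) = 0 := by
    linear_combination d3 + d4 + hXN - (A z * α z + C z * β z) * hpx' -
      (C z * α z + B z * β z) * hpy' -
      (α z * dot ε (N z) (dy N z) - β z * dot ε (N z) (dx N z)) * hdisc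
  -- `s1` and `s2` are linear in the defects α_y − β_x and Lθ − fθ; eliminating the former leaves
  -- the determinant p² + r²Δ.
  refine mul_left_cancel₀ (hc.denom_ne z hz) ?_
  rw [sqNorm]
  linear_combination p z * s2 + dot ε (N z) (N z) * Δ * s1

/-- Once θ_x = α and θ_y = β, all products of first derivatives cancel and the difference of the
mixed derivatives is θ LN − (Lθ)N, which is zero. -/
theorem MoutardRel.dy_dx_eq (hc : IsNormalPair ε Δ D A B C N f p) (hz : z ∈ D)
    (hX : DifferentiableAt ℝ X z) (hθ : DifferentiableAt ℝ θ z) (hα : DifferentiableAt ℝ α z)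
    (hβ : DifferentiableAt ℝ β z)
    (hrel : ∀ᶠ w in 𝓝 z, MoutardRel ε A B C N p X θ α β w)
    (hXx : dx X z = θ z • (C z • dx N z + B z • dy N z) - (C z * α z + B z * β z) • N z)
    (hXy : dy X z = (A z * α z + C z * β z) • N z - θ z • (A z • dx N z + C z • dy N z)) :
    dy (fun w => θ w • (C w • dx N w + B w • dy N w) - (C w * α w + B w * β w) • N w) z =
      dx (fun w => (A w * α w + C w * β w) • N w - θ w • (A w • dx N w + C w • dy N w)) z := by
  have hD := hc.isOpen
  have hN := hc.contDiffOn_N.differentiableAt_of_isOpen two_ne_zero hD hz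
  have hA := hc.contDiffOn_A.differentiableAt_of_isOpen one_ne_zero hD hz
  have hB := hc.contDiffOn_B.differentiableAt_of_isOpen one_ne_zero hD hz
  have hC := hc.contDiffOn_C.differentiableAt_of_isOpen one_ne_zero hD hz
  have hNx : DifferentiableAt ℝ (dx N) z :=
    (contDiffOn_dx (n := 2) (m := 1) le_rfl hD hc.contDiffOn_N).differentiableAt_of_isOpen
      one_ne_zero hD hz
  have hNy : DifferentiableAt ℝ (dy N) z :=
    (contDiffOn_dy (n := 2) (m := 1) le_rfl hD hc.contDiffOn_N).differentiableAt_of_isOpen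
      one_ne_zero hD hz
  have hθx := MoutardRel.dx_theta hc hz hX hθ hrel hXx
  have hθy := MoutardRel.dy_theta hc hz hX hθ hrel hXy
  have hL := MoutardRel.operator_theta hc hz hX hθ hα hβ hrel hXx hXy
  set a : ℝ × ℝ → 𝕜 := fun w => A w * α w + C w * β w with ha_def
  set b : ℝ × ℝ → 𝕜 := fun w => C w * α w + B w * β w with hb_def
  have ha : DifferentiableAt ℝ a z := by fun_prop
  have hb : DifferentiableAt ℝ b z := by fun_prop
  have hLN := hc.field_eq z hz
  set m : ℝ × ℝ → Fin 3 → 𝕜 := fun w => A w • dx N w + C w • dy N w with hm_def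
  set n : ℝ × ℝ → Fin 3 → 𝕜 := fun w => C w • dx N w + B w • dy N w with hn_def
  have hm : DifferentiableAt ℝ m z := by fun_prop
  have hn : DifferentiableAt ℝ n z := by fun_prop
  simp (disch := fun_prop) only [dy_sub, dx_sub, dy_smul, dx_smul, hθx, hθy]
  ext i
  have h1 := congrFun hLN i
  simp only [Pi.add_apply, Pi.sub_apply, Pi.smul_apply, smul_eq_mul] at h1 ⊢
  linear_combination θ z * h1 - N z i * hL

end Moutard

/-! ### The frame-free linear system for X and its flatness -/

section System

variable {𝕜 : Type*} [RCLike 𝕜]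

/-- The function `θ` determined by `θ p = ξ · N`. -/
def mTheta (ε : ℝ) (N : ℝ × ℝ → Fin 3 → 𝕜) (p : ℝ × ℝ → 𝕜) (z : ℝ × ℝ) (ξ : Fin 3 → 𝕜) : 𝕜 :=
  dot ε ξ (N z) / p z

/-- The derivative of `θ` in the first variable. -/
def mAlpha (ε : ℝ) (Δ : 𝕜) (B C : ℝ × ℝ → 𝕜) (N : ℝ × ℝ → Fin 3 → 𝕜) (p : ℝ × ℝ → 𝕜)
    (z : ℝ × ℝ) (ξ : Fin 3 → 𝕜) : 𝕜 :=
  ((p z - sqNorm ε N z * C z) * (dot ε ξ (dx N z) - mTheta ε N p z ξ * dx p z / 2) -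
    sqNorm ε N z * B z * (dot ε ξ (dy N z) - mTheta ε N p z ξ * dy p z / 2)) /
      (p z ^ 2 + sqNorm ε N z ^ 2 * Δ)

/-- The derivative of `θ` in the second variable. -/
def mBeta (ε : ℝ) (Δ : 𝕜) (A C : ℝ × ℝ → 𝕜) (N : ℝ × ℝ → Fin 3 → 𝕜) (p : ℝ × ℝ → 𝕜)
    (z : ℝ × ℝ) (ξ : Fin 3 → 𝕜) : 𝕜 :=
  (sqNorm ε N z * A z * (dot ε ξ (dx N z) - mTheta ε N p z ξ * dx p z / 2) +
    (p z + sqNorm ε N z * C z) * (dot ε ξ (dy N z) - mTheta ε N p z ξ * dy p z / 2)) /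
      (p z ^ 2 + sqNorm ε N z ^ 2 * Δ)

/-- The derivative of `X = θ N'` in the first variable. -/
def mP (ε : ℝ) (Δ : 𝕜) (A B C : ℝ × ℝ → 𝕜) (N : ℝ × ℝ → Fin 3 → 𝕜) (p : ℝ × ℝ → 𝕜)
    (z : ℝ × ℝ) (ξ : Fin 3 → 𝕜) : Fin 3 → 𝕜 :=
  mTheta ε N p z ξ • (C z • dx N z + B z • dy N z) -
    (C z * mAlpha ε Δ B C N p z ξ + B z * mBeta ε Δ A C N p z ξ) • N z

/-- The derivative of `X = θ N'` in the second variable. -/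
def mQ (ε : ℝ) (Δ : 𝕜) (A B C : ℝ × ℝ → 𝕜) (N : ℝ × ℝ → Fin 3 → 𝕜) (p : ℝ × ℝ → 𝕜)
    (z : ℝ × ℝ) (ξ : Fin 3 → 𝕜) : Fin 3 → 𝕜 :=
  (A z * mAlpha ε Δ B C N p z ξ + C z * mBeta ε Δ A C N p z ξ) • N z -
    mTheta ε N p z ξ • (A z • dx N z + C z • dy N z)

variable {ε : ℝ} {Δ : 𝕜} {D : Set (ℝ × ℝ)} {A B C : ℝ × ℝ → 𝕜} {N X : ℝ × ℝ → Fin 3 → 𝕜}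
  {f p : ℝ × ℝ → 𝕜} {z : ℝ × ℝ}

/-- `mAlpha` and `mBeta` are Cramer's rule for the two relations, whose matrix with rows (p + rC,
rB) and (−rA, p − rC) has determinant p² + r²Δ. Hence the relations hold for every field `X`,
parallel or not. -/
theorem moutardRel (hc : IsNormalPair ε Δ D A B C N f p) (hz : z ∈ D) (X : ℝ × ℝ → Fin 3 → 𝕜) :
    MoutardRel ε A B C N p X (fun w => mTheta ε N p w (X w))
      (fun w => mAlpha ε Δ B C N p w (X w)) (fun w => mBeta ε Δ A C N p w (X w)) z := by
  have hp := hc.p_ne z hz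
  have hd := hc.denom_ne z hz
  have h1 := hc.disc z hz
  have key : ∀ u v r d : 𝕜, d ≠ 0 → p z ^ 2 + r ^ 2 * Δ = d →
      p z * (((p z - r * C z) * u - r * B z * v) / d) + r * (C z * (((p z - r * C z) * u -
        r * B z * v) / d) + B z * ((r * A z * u + (p z + r * C z) * v) / d)) = u ∧
      p z * ((r * A z * u + (p z + r * C z) * v) / d) - r * (A z * (((p z - r * C z) * u -
        r * B z * v) / d) + C z * ((r * A z * u + (p z + r * C z) * v) / d)) = v := by
    intro u v r d hd0 hd
    constructor
    · field_simp
      rw [← hd, ← h1]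
      ring
    · field_simp
      rw [← hd, ← h1]
      ring
  have h2 := key (dot ε (X z) (dx N z) - mTheta ε N p z (X z) * dx p z / 2)
    (dot ε (X z) (dy N z) - mTheta ε N p z (X z) * dy p z / 2) (sqNorm ε N z) _ hd rfl
  exact ⟨mul_div_cancel₀ _ hp, h2.1, h2.2⟩

theorem contDiffOn_sqNorm {n : WithTop ℕ∞} (hN : ContDiffOn ℝ n N D) :
    ContDiffOn ℝ n (sqNorm ε N) D :=
  contDiffOn_dot hN hN

theorem IsNormalPair.contDiffOn_system (hc : IsNormalPair ε Δ D A B C N f p)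
    (hX : ContDiffOn ℝ 1 X D) :
    ContDiffOn ℝ 1 (fun w => mTheta ε N p w (X w)) D ∧
    ContDiffOn ℝ 1 (fun w => mAlpha ε Δ B C N p w (X w)) D ∧
    ContDiffOn ℝ 1 (fun w => mBeta ε Δ A C N p w (X w)) D ∧
    ContDiffOn ℝ 1 (fun w => mP ε Δ A B C N p w (X w)) D ∧
    ContDiffOn ℝ 1 (fun w => mQ ε Δ A B C N p w (X w)) D := by
  have hN : ContDiffOn ℝ 1 N D := hc.contDiffOn_N.of_le one_le_two
  have hp : ContDiffOn ℝ 1 p D := hc.contDiffOn_p.of_le one_le_two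
  have hA := hc.contDiffOn_A
  have hB := hc.contDiffOn_B
  have hC := hc.contDiffOn_C
  have hNx := contDiffOn_dx (n := 2) (m := 1) le_rfl hc.isOpen hc.contDiffOn_N
  have hNy := contDiffOn_dy (n := 2) (m := 1) le_rfl hc.isOpen hc.contDiffOn_N
  have hpx := contDiffOn_dx (n := 2) (m := 1) le_rfl hc.isOpen hc.contDiffOn_p
  have hpy := contDiffOn_dy (n := 2) (m := 1) le_rfl hc.isOpen hc.contDiffOn_p
  have hr := contDiffOn_sqNorm (ε := ε) hN
  have hinv : ContDiffOn ℝ 1 (fun w => (p w ^ 2 + sqNorm ε N w ^ 2 * Δ)⁻¹) D :=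
    ((hp.pow 2).add ((hr.pow 2).mul contDiffOn_const)).inv hc.denom_ne
  have hpinv : ContDiffOn ℝ 1 (fun w => (p w)⁻¹) D := hp.inv hc.p_ne
  have hθ : ContDiffOn ℝ 1 (fun w => mTheta ε N p w (X w)) D := by
    simp only [mTheta, div_eq_mul_inv]
    exact (contDiffOn_dot hX hN).mul hpinv
  have hu : ContDiffOn ℝ 1
      (fun w => dot ε (X w) (dx N w) - mTheta ε N p w (X w) * dx p w / 2) D :=
    (contDiffOn_dot hX hNx).sub ((hθ.mul hpx).div_const 2)
  have hv : ContDiffOn ℝ 1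
      (fun w => dot ε (X w) (dy N w) - mTheta ε N p w (X w) * dy p w / 2) D :=
    (contDiffOn_dot hX hNy).sub ((hθ.mul hpy).div_const 2)
  have hα : ContDiffOn ℝ 1 (fun w => mAlpha ε Δ B C N p w (X w)) D := by
    simp only [mAlpha, div_eq_mul_inv _ (p _ ^ 2 + _)]
    exact (((hp.sub (hr.mul hC)).mul hu).sub ((hr.mul hB).mul hv)).mul hinv
  have hβ : ContDiffOn ℝ 1 (fun w => mBeta ε Δ A C N p w (X w)) D := by
    simp only [mBeta, div_eq_mul_inv _ (p _ ^ 2 + _)]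
    exact (((hr.mul hA).mul hu).add ((hp.add (hr.mul hC)).mul hv)).mul hinv
  refine ⟨hθ, hα, hβ, ?_, ?_⟩
  · exact (hθ.smul ((hC.smul hNx).add (hB.smul hNy))).sub
      (((hC.mul hα).add (hB.mul hβ)).smul hN)
  · exact (((hA.mul hα).add (hC.mul hβ)).smul hN).sub
      (hθ.smul ((hA.smul hNx).add (hC.smul hNy)))

theorem mTheta_add (ξ η : Fin 3 → 𝕜) :
    mTheta ε N p z (ξ + η) = mTheta ε N p z ξ + mTheta ε N p z η := by
  simp only [mTheta, dot_add_left]; ring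

theorem mTheta_smul (k : 𝕜) (ξ : Fin 3 → 𝕜) :
    mTheta ε N p z (k • ξ) = k * mTheta ε N p z ξ := by
  simp only [mTheta, dot_smul_left]; ring

theorem mAlpha_add (ξ η : Fin 3 → 𝕜) : mAlpha ε Δ B C N p z (ξ + η) =
    mAlpha ε Δ B C N p z ξ + mAlpha ε Δ B C N p z η := by
  simp only [mAlpha, dot_add_left, mTheta_add]; ring

theorem mAlpha_smul (k : 𝕜) (ξ : Fin 3 → 𝕜) : mAlpha ε Δ B C N p z (k • ξ) =
    k * mAlpha ε Δ B C N p z ξ := by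
  simp only [mAlpha, dot_smul_left, mTheta_smul]; ring

theorem mBeta_add (ξ η : Fin 3 → 𝕜) : mBeta ε Δ A C N p z (ξ + η) =
    mBeta ε Δ A C N p z ξ + mBeta ε Δ A C N p z η := by
  simp only [mBeta, dot_add_left, mTheta_add]; ring

theorem mBeta_smul (k : 𝕜) (ξ : Fin 3 → 𝕜) : mBeta ε Δ A C N p z (k • ξ) =
    k * mBeta ε Δ A C N p z ξ := by
  simp only [mBeta, dot_smul_left, mTheta_smul]; ring

variable (ε Δ A B C N p) in
/-- The coefficient of the linear system for `X` in the first variable. -/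
def mPL (z : ℝ × ℝ) : (Fin 3 → 𝕜) →L[ℝ] (Fin 3 → 𝕜) :=
  LinearMap.toContinuousLinearMap
    { toFun := mP ε Δ A B C N p z
      map_add' := fun ξ η => by
        simp only [mP, mTheta_add, mAlpha_add, mBeta_add]; module
      map_smul' := fun k ξ => by
        rw [RCLike.real_smul_eq_coe_smul (K := 𝕜) k ξ]
        simp only [mP, mTheta_smul, mAlpha_smul, mBeta_smul, RingHom.id_apply]
        rw [RCLike.real_smul_eq_coe_smul (K := 𝕜) k]
        module }

variable (ε Δ A B C N p) in
/-- The coefficient of the linear system for `X` in the second variable. -/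
def mQL (z : ℝ × ℝ) : (Fin 3 → 𝕜) →L[ℝ] (Fin 3 → 𝕜) :=
  LinearMap.toContinuousLinearMap
    { toFun := mQ ε Δ A B C N p z
      map_add' := fun ξ η => by
        simp only [mQ, mTheta_add, mAlpha_add, mBeta_add]; module
      map_smul' := fun k ξ => by
        rw [RCLike.real_smul_eq_coe_smul (K := 𝕜) k ξ]
        simp only [mQ, mTheta_smul, mAlpha_smul, mBeta_smul, RingHom.id_apply]
        rw [RCLike.real_smul_eq_coe_smul (K := 𝕜) k]
        module }

@[simp] theorem mPL_apply (ξ : Fin 3 → 𝕜) :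
    mPL ε Δ A B C N p z ξ = mP ε Δ A B C N p z ξ := rfl

@[simp] theorem mQL_apply (ξ : Fin 3 → 𝕜) :
    mQL ε Δ A B C N p z ξ = mQ ε Δ A B C N p z ξ := rfl

theorem IsNormalPair.contDiffOn_mPL (hc : IsNormalPair ε Δ D A B C N f p) :
    ContDiffOn ℝ 1 (mPL ε Δ A B C N p) D :=
  contDiffOn_clm_apply.2 fun _ => (hc.contDiffOn_system contDiffOn_const).2.2.2.1

theorem IsNormalPair.contDiffOn_mQL (hc : IsNormalPair ε Δ D A B C N f p) :
    ContDiffOn ℝ 1 (mQL ε Δ A B C N p) D :=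
  contDiffOn_clm_apply.2 fun _ => (hc.contDiffOn_system contDiffOn_const).2.2.2.2

theorem IsNormalPair.isFlat (hc : IsNormalPair ε Δ D A B C N f p) :
    IsFlat (mPL ε Δ A B C N p) (mQL ε Δ A B C N p) D := by
  intro z hz ξ
  let L := planeDeriv (mP ε Δ A B C N p z ξ) (mQ ε Δ A B C N p z ξ)
  -- Flatness is a pointwise identity, so it is tested on the affine field with value ξ at `z` and
  -- the prescribed first derivatives there. It solves the system at `z` only, which suffices for
  -- the Moutard identities.
  let X : ℝ × ℝ → Fin 3 → 𝕜 := fun w => ξ + L (w - z)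
  have hX0 : X z = ξ := by simp [X]
  have hX : ∀ w, HasFDerivAt X L w := fun w => by
    have := (L.hasFDerivAt.comp w ((hasFDerivAt_id w).sub_const z)).const_add ξ
    exact this
  have hXs : ContDiffOn ℝ 1 X D :=
    (contDiff_const.add (L.contDiff.comp (contDiff_id.sub contDiff_const))).contDiffOn
  obtain ⟨hθ, hα, hβ, -, -⟩ := hc.contDiffOn_system hXs
  have hrel : ∀ᶠ w in 𝓝 z, MoutardRel ε A B C N p X (fun w => mTheta ε N p w (X w))
      (fun w => mAlpha ε Δ B C N p w (X w)) (fun w => mBeta ε Δ A C N p w (X w)) w := by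
    filter_upwards [hc.isOpen.mem_nhds hz] with w hw using moutardRel hc hw X
  have h := MoutardRel.dy_dx_eq hc hz (hX z).differentiableAt
    (hθ.differentiableAt_of_isOpen one_ne_zero hc.isOpen hz)
    (hα.differentiableAt_of_isOpen one_ne_zero hc.isOpen hz)
    (hβ.differentiableAt_of_isOpen one_ne_zero hc.isOpen hz) hrel
    (by rw [dx_of_hasFDerivAt (hX z)]; simp only [hX0]; rfl)
    (by rw [dy_of_hasFDerivAt (hX z)]; simp only [hX0]; rfl)
  have hPd := hc.contDiffOn_mPL.differentiableAt_of_isOpen one_ne_zero hc.isOpen hz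
  have hQd := hc.contDiffOn_mQL.differentiableAt_of_isOpen one_ne_zero hc.isOpen hz
  have h1 : dy (fun w => mPL ε Δ A B C N p w (X w)) z =
      fderiv ℝ (mPL ε Δ A B C N p) z (0, 1) ξ + mPL ε Δ A B C N p z (mQL ε Δ A B C N p z ξ) := by
    rw [dy, fderiv_clm_apply hPd (hX z).differentiableAt, (hX z).fderiv, hX0]
    simp [L, add_comm]
  have h2 : dx (fun w => mQL ε Δ A B C N p w (X w)) z =
      fderiv ℝ (mQL ε Δ A B C N p) z (1, 0) ξ + mQL ε Δ A B C N p z (mPL ε Δ A B C N p z ξ) := by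
    rw [dx, fderiv_clm_apply hQd (hX z).differentiableAt, (hX z).fderiv, hX0]
    simp [L, add_comm]
  rw [← h1, ← h2]
  exact h

end System

/-! ### Consequences of (e1), (e2) and (P) -/

section Reduction

variable {𝕜 : Type*} [RCLike 𝕜] {ε Δ : ℝ} {D : Set (ℝ × ℝ)} {A B C : ℝ × ℝ → ℝ}
  {N R : ℝ × ℝ → Fin 3 → 𝕜} {f p : ℝ × ℝ → 𝕜} {z : ℝ × ℝ}

theorem selfAdjOp_vector (g : ℝ × ℝ → Fin 3 → 𝕜) (z : ℝ × ℝ) : selfAdjOp A B C g z =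
    dx (fun w => (A w : 𝕜) • dx g w + (C w : 𝕜) • dy g w) z +
      dy (fun w => (C w : 𝕜) • dx g w + (B w : 𝕜) • dy g w) z := by
  simp only [selfAdjOp, RCLike.real_smul_eq_coe_smul (K := 𝕜)]

theorem selfAdjOp_scalar (g : ℝ × ℝ → 𝕜) (z : ℝ × ℝ) : selfAdjOp A B C g z =
    dx (fun w => (A w : 𝕜) * dx g w + (C w : 𝕜) * dy g w) z +
      dy (fun w => (C w : 𝕜) * dx g w + (B w : 𝕜) * dy g w) z := by
  simp only [selfAdjOp, RCLike.real_smul_eq_coe_mul]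

theorem contDiffOn_ofReal {n : WithTop ℕ∞} (hA : ContDiffOn ℝ n A D) :
    ContDiffOn ℝ n (fun z => (A z : 𝕜)) D :=
  (RCLike.ofRealCLM (K := 𝕜)).contDiff.comp_contDiffOn hA

theorem IsSolution.mono {U : Set (ℝ × ℝ)} (h : IsSolution ε D A B C N f) (hU : U ⊆ D) :
    IsSolution ε U A B C N f :=
  ⟨h.contDiffOn.mono hU, fun z hz => h.field_eq z (hU hz), fun z hz => h.sqNorm_eq z (hU hz)⟩

theorem dx_sqNorm (hN : DifferentiableAt ℝ N z) :
    dx (sqNorm ε N) z = 2 * dot ε (N z) (dx N z) := by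
  have : dx (sqNorm ε N) z = _ := dx_dot hN hN
  rw [this, dot_comm (dx N z)]
  ring

theorem dy_sqNorm (hN : DifferentiableAt ℝ N z) :
    dy (sqNorm ε N) z = 2 * dot ε (N z) (dy N z) := by
  have : dy (sqNorm ε N) z = _ := dy_dot hN hN
  rw [this, dot_comm (dy N z)]
  ring

/-- Solves (P) for the derivatives of p; its matrix has determinant ±Δ, and Δ² = 1. In this form
closedness is precisely Lr = 0. -/
theorem isPotential_iff (hΔ : Δ = 1 ∨ Δ = -1) (hABC : ∀ z ∈ D, A z * B z - C z ^ 2 = Δ) :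
    IsPotential ε Δ D A B C N p ↔ DifferentiableOn ℝ p D ∧ ∀ z ∈ D,
      dx p z = (C z : 𝕜) * dx (sqNorm ε N) z + (B z : 𝕜) * dy (sqNorm ε N) z ∧
      dy p z = -((A z : 𝕜) * dx (sqNorm ε N) z + (C z : 𝕜) * dy (sqNorm ε N) z) := by
  have hsq : (Δ : 𝕜) * (Δ : 𝕜) = 1 := by rcases hΔ with rfl | rfl <;> simp
  have hd : ∀ z ∈ D, (A z : 𝕜) * (B z : 𝕜) - (C z : 𝕜) ^ 2 = (Δ : 𝕜) := fun z hz => by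
    rw [← hABC z hz]; push_cast; ring
  constructor
  · intro h
    refine ⟨h.differentiableOn, fun z hz => ?_⟩
    have h1 := h.eq_x z hz
    have h2 := h.eq_y z hz
    have h3 := hd z hz
    simp only [RCLike.real_smul_eq_coe_mul] at h1 h2
    constructor
    · linear_combination -(Δ : 𝕜) * (C z * h1 + B z * h2) - dx p z * Δ * h3 +
        (C z * dx (sqNorm ε N) z + B z * dy (sqNorm ε N) z - dx p z) * hsq
    · linear_combination (Δ : 𝕜) * (A z * h1 + C z * h2) - dy p z * Δ * h3 -
        (A z * dx (sqNorm ε N) z + C z * dy (sqNorm ε N) z + dy p z) * hsq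
  · rintro ⟨h, h'⟩
    refine ⟨h, fun z hz => ?_, fun z hz => ?_⟩
    · obtain ⟨h1, h2⟩ := h' z hz
      have h3 := hd z hz
      simp only [RCLike.real_smul_eq_coe_mul]
      rw [h1, h2]
      linear_combination -dx (sqNorm ε N) z * h3
    · obtain ⟨h1, h2⟩ := h' z hz
      have h3 := hd z hz
      simp only [RCLike.real_smul_eq_coe_mul]
      rw [h1, h2]
      linear_combination -dy (sqNorm ε N) z * h3

/-- Half of L(N·N) is N·LN plus this quadratic form; the former is f r by (e1), and the sum is zero
by (e2). -/
theorem IsSolution.quad_eq (hD : IsOpen D) (hA : ContDiffOn ℝ 1 A D) (hB : ContDiffOn ℝ 1 B D)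
    (hC : ContDiffOn ℝ 1 C D) (h : IsSolution ε D A B C N f) (hz : z ∈ D) :
    (A z : 𝕜) * dot ε (dx N z) (dx N z) + 2 * (C z : 𝕜) * dot ε (dx N z) (dy N z) +
      (B z : 𝕜) * dot ε (dy N z) (dy N z) = -(f z * sqNorm ε N z) := by
  have hN := h.contDiffOn.differentiableAt_of_isOpen two_ne_zero hD hz
  have hA' := (contDiffOn_ofReal (𝕜 := 𝕜) hA).differentiableAt_of_isOpen one_ne_zero hD hz
  have hB' := (contDiffOn_ofReal (𝕜 := 𝕜) hB).differentiableAt_of_isOpen one_ne_zero hD hz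
  have hC' := (contDiffOn_ofReal (𝕜 := 𝕜) hC).differentiableAt_of_isOpen one_ne_zero hD hz
  have hNx : DifferentiableAt ℝ (dx N) z :=
    (contDiffOn_dx (n := 2) (m := 1) le_rfl hD h.contDiffOn).differentiableAt_of_isOpen
      one_ne_zero hD hz
  have hNy : DifferentiableAt ℝ (dy N) z :=
    (contDiffOn_dy (n := 2) (m := 1) le_rfl hD h.contDiffOn).differentiableAt_of_isOpen
      one_ne_zero hD hz
  have h1 := h.field_eq z hz
  have h2 := h.sqNorm_eq z hz
  rw [selfAdjOp_vector] at h1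
  rw [selfAdjOp_scalar] at h2
  set m : ℝ × ℝ → Fin 3 → 𝕜 := fun w => (A w : 𝕜) • dx N w + (C w : 𝕜) • dy N w with hm_def
  set n : ℝ × ℝ → Fin 3 → 𝕜 := fun w => (C w : 𝕜) • dx N w + (B w : 𝕜) • dy N w with hn_def
  have hm : DifferentiableAt ℝ m z := by fun_prop
  have hn : DifferentiableAt ℝ n z := by fun_prop
  have c1 : dx (fun _ : ℝ × ℝ => (2 : 𝕜)) z = 0 := by simp [dx]
  have c2 : dy (fun _ : ℝ × ℝ => (2 : 𝕜)) z = 0 := by simp [dy]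
  have e1 : (fun w => (A w : 𝕜) * dx (sqNorm ε N) w + (C w : 𝕜) * dy (sqNorm ε N) w) =ᶠ[𝓝 z]
      fun w => 2 * dot ε (N w) (m w) := by
    filter_upwards [hD.mem_nhds hz] with w hw
    have hNw := h.contDiffOn.differentiableAt_of_isOpen two_ne_zero hD hw
    rw [dx_sqNorm hNw, dy_sqNorm hNw, hm_def]
    simp only [dot_add_right, dot_smul_right]
    ring
  have e2 : (fun w => (C w : 𝕜) * dx (sqNorm ε N) w + (B w : 𝕜) * dy (sqNorm ε N) w) =ᶠ[𝓝 z]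
      fun w => 2 * dot ε (N w) (n w) := by
    filter_upwards [hD.mem_nhds hz] with w hw
    have hNw := h.contDiffOn.differentiableAt_of_isOpen two_ne_zero hD hw
    rw [dx_sqNorm hNw, dy_sqNorm hNw, hn_def]
    simp only [dot_add_right, dot_smul_right]
    ring
  rw [dx_congr e1, dy_congr e2] at h2
  simp (disch := fun_prop) only [dx_mul, dy_mul, dx_dot, dy_dot, c1, c2] at h2
  have h3 := congrArg (dot ε (N z)) h1
  rw [dot_add_right, dot_smul_right] at h3
  have e3 : m z = (A z : 𝕜) • dx N z + (C z : 𝕜) • dy N z := rfl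
  have e4 : n z = (C z : 𝕜) • dx N z + (B z : 𝕜) • dy N z := rfl
  rw [e3, e4] at h2
  simp only [dot_add_right, dot_smul_right, dot_comm (dy N z) (dx N z)] at h2
  rw [sqNorm]
  linear_combination 2⁻¹ * h2 - h3

/-- A merely differentiable p gains regularity from the solved form of (P), whose right-hand sides
are C¹. -/
theorem IsPotential.contDiffOn (hD : IsOpen D) (hΔ : Δ = 1 ∨ Δ = -1) (hA : ContDiffOn ℝ 1 A D)
    (hB : ContDiffOn ℝ 1 B D) (hC : ContDiffOn ℝ 1 C D)
    (hABC : ∀ z ∈ D, A z * B z - C z ^ 2 = Δ) (hN : ContDiffOn ℝ 2 N D)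
    (hp : IsPotential ε Δ D A B C N p) : ContDiffOn ℝ 2 p D := by
  obtain ⟨h1, h2⟩ := (isPotential_iff hΔ hABC).1 hp
  have hr : ContDiffOn ℝ 2 (sqNorm ε N) D := contDiffOn_sqNorm hN
  have hrx := contDiffOn_dx (n := 2) (m := 1) le_rfl hD hr
  have hry := contDiffOn_dy (n := 2) (m := 1) le_rfl hD hr
  refine contDiffOn_succ_of_dx_dy (n := 1) hD h1 ?_ ?_
  · exact (((contDiffOn_ofReal hC).mul hrx).add ((contDiffOn_ofReal hB).mul hry)).congr
      fun z hz => (h2 z hz).1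
  · exact (((contDiffOn_ofReal hA).mul hrx).add ((contDiffOn_ofReal hC).mul hry)).neg.congr
      fun z hz => (h2 z hz).2

theorem IsSolution.isNormalPair (hD : IsOpen D) (hΔ : Δ = 1 ∨ Δ = -1) (hA : ContDiffOn ℝ 1 A D)
    (hB : ContDiffOn ℝ 1 B D) (hC : ContDiffOn ℝ 1 C D)
    (hABC : ∀ z ∈ D, A z * B z - C z ^ 2 = Δ) (h : IsSolution ε D A B C N f)
    (hp : IsPotential ε Δ D A B C N p) (hp0 : ∀ z ∈ D, p z ≠ 0)
    (hd : ∀ z ∈ D, p z ^ 2 + sqNorm ε N z ^ 2 * (Δ : 𝕜) ≠ 0) :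
    IsNormalPair ε (Δ : 𝕜) D (fun z => (A z : 𝕜)) (fun z => (B z : 𝕜)) (fun z => (C z : 𝕜))
      N f p where
  isOpen := hD
  contDiffOn_A := contDiffOn_ofReal hA
  contDiffOn_B := contDiffOn_ofReal hB
  contDiffOn_C := contDiffOn_ofReal hC
  contDiffOn_N := h.contDiffOn
  contDiffOn_p := hp.contDiffOn hD hΔ hA hB hC hABC h.contDiffOn
  disc_sq := by rcases hΔ with rfl | rfl <;> simp
  disc := fun z hz => by rw [← hABC z hz]; push_cast; ring
  field_eq := fun z hz => by rw [← selfAdjOp_vector, h.field_eq z hz]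
  quad_eq := fun z hz => h.quad_eq hD hA hB hC hz
  dx_p := fun z hz => by
    have hN := h.contDiffOn.differentiableAt_of_isOpen two_ne_zero hD hz
    rw [(((isPotential_iff hΔ hABC).1 hp).2 z hz).1, dx_sqNorm hN, dy_sqNorm hN]
    ring
  dy_p := fun z hz => by
    have hN := h.contDiffOn.differentiableAt_of_isOpen two_ne_zero hD hz
    rw [(((isPotential_iff hΔ hABC).1 hp).2 z hz).2, dx_sqNorm hN, dy_sqNorm hN]
    ring
  p_ne := hp0
  denom_ne := hd

theorem IsSolution.exists_isPotential (hD : IsOpen D) (hDs : IsSimplyConnected D)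
    (hΔ : Δ = 1 ∨ Δ = -1) (hA : ContDiffOn ℝ 1 A D)
    (hB : ContDiffOn ℝ 1 B D) (hC : ContDiffOn ℝ 1 C D)
    (hABC : ∀ z ∈ D, A z * B z - C z ^ 2 = Δ) (h : IsSolution ε D A B C N f) {q : ℝ × ℝ}
    (hq : q ∈ D) (k : 𝕜) : ∃ p, IsPotential ε Δ D A B C N p ∧ p q = k := by
  have hr : ContDiffOn ℝ 2 (sqNorm ε N) D := contDiffOn_sqNorm h.contDiffOn
  have hrx := contDiffOn_dx (n := 2) (m := 1) le_rfl hD hr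
  have hry := contDiffOn_dy (n := 2) (m := 1) le_rfl hD hr
  obtain ⟨p, hp0, hp⟩ := exists_hasFDerivAt_of_closed hD hDs
    (a := fun z => (C z : 𝕜) * dx (sqNorm ε N) z + (B z : 𝕜) * dy (sqNorm ε N) z)
    (b := fun z => -((A z : 𝕜) * dx (sqNorm ε N) z + (C z : 𝕜) * dy (sqNorm ε N) z))
    (((contDiffOn_ofReal hC).mul hrx).add ((contDiffOn_ofReal hB).mul hry))
    (((contDiffOn_ofReal hA).mul hrx).add ((contDiffOn_ofReal hC).mul hry)).neg
    (fun z hz => by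
      have h1 := h.sqNorm_eq z hz
      rw [selfAdjOp_scalar, add_comm] at h1
      rw [eq_neg_of_add_eq_zero_left h1, dx, dx, fderiv_fun_neg]
      rfl) hq k
  refine ⟨p, (isPotential_iff hΔ hABC).2 ⟨fun z hz =>
    (hp z hz).differentiableAt.differentiableWithinAt, fun z hz =>
    ⟨dx_of_hasFDerivAt (hp z hz), dy_of_hasFDerivAt (hp z hz)⟩⟩, hp0⟩

theorem IsPotential.eqOn (hD : IsOpen D) (hDc : IsPreconnected D) (hΔ : Δ = 1 ∨ Δ = -1)
    (hABC : ∀ z ∈ D, A z * B z - C z ^ 2 = Δ) {p' : ℝ × ℝ → 𝕜}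
    (hp : IsPotential ε Δ D A B C N p) (hp' : IsPotential ε Δ D A B C N p') {q : ℝ × ℝ}
    (hq : q ∈ D) (hpq : p q = p' q) : EqOn p p' D := by
  obtain ⟨h1, h2⟩ := (isPotential_iff hΔ hABC).1 hp
  obtain ⟨h1', h2'⟩ := (isPotential_iff hΔ hABC).1 hp'
  refine hD.eqOn_of_fderiv_eq hDc h1 h1' (fun z hz => ?_) hq hpq
  rw [fderiv_eq_planeDeriv, fderiv_eq_planeDeriv, (h2 z hz).1, (h2 z hz).2, (h2' z hz).1,
    (h2' z hz).2]

end Reduction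

/-! ### The Lelieuvre surface and its curvature -/

section Surface

variable {𝕜 : Type*} [RCLike 𝕜] {ε Δ : ℝ} {D : Set (ℝ × ℝ)} {A B C : ℝ × ℝ → ℝ}
  {N R : ℝ × ℝ → Fin 3 → 𝕜} {f : ℝ × ℝ → 𝕜} {z : ℝ × ℝ}

/-- In ∂ᵧRₓ − ∂ₓRᵧ the products of first derivatives cancel and LN × N is left, which vanishes
because LN is proportional to N. -/
theorem IsSolution.exists_isLelieuvre (hD : IsOpen D) (hDs : IsSimplyConnected D)
    (hA : ContDiffOn ℝ 1 A D) (hB : ContDiffOn ℝ 1 B D) (hC : ContDiffOn ℝ 1 C D)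
    (h : IsSolution ε D A B C N f) : ∃ R, IsLelieuvre ε D A B C N R := by
  obtain ⟨q, hq⟩ := hDs.nonempty
  have hN : ContDiffOn ℝ 1 N D := h.contDiffOn.of_le one_le_two
  have hNx := contDiffOn_dx (n := 2) (m := 1) le_rfl hD h.contDiffOn
  have hNy := contDiffOn_dy (n := 2) (m := 1) le_rfl hD h.contDiffOn
  have hm : ContDiffOn ℝ 1 (fun z => A z • dx N z + C z • dy N z) D :=
    (hA.smul hNx).add (hC.smul hNy)
  have hn : ContDiffOn ℝ 1 (fun z => C z • dx N z + B z • dy N z) D :=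
    (hC.smul hNx).add (hB.smul hNy)
  obtain ⟨R, -, hR⟩ := exists_hasFDerivAt_of_closed hD hDs
    (a := fun z => cross ε (C z • dx N z + B z • dy N z) (N z))
    (b := fun z => cross ε (N z) (A z • dx N z + C z • dy N z))
    (contDiffOn_cross hn hN) (contDiffOn_cross hN hm) (fun z hz => by
      have h1 := h.field_eq z hz
      rw [selfAdjOp, add_comm] at h1
      rw [dy_cross (hn.differentiableAt_of_isOpen one_ne_zero hD hz)
        (hN.differentiableAt_of_isOpen one_ne_zero hD hz),
        dx_cross (hN.differentiableAt_of_isOpen one_ne_zero hD hz)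
        (hm.differentiableAt_of_isOpen one_ne_zero hD hz), eq_sub_of_add_eq h1]
      ext i
      fin_cases i <;> simp [cross, RCLike.real_smul_eq_coe_mul] <;> ring) hq 0
  refine ⟨R, fun z hz => (hR z hz).differentiableAt.differentiableWithinAt, fun z hz => ?_,
    fun z hz => dy_of_hasFDerivAt (hR z hz)⟩
  rw [dx_of_hasFDerivAt (hR z hz), add_comm]

theorem dot_cross_self_left (u v : Fin 3 → 𝕜) (hε : ε = 1 ∨ ε = -1) :
    dot ε v (cross ε u v) = 0 := by
  have hε2 : (ε : 𝕜) * ε = 1 := by rcases hε with rfl | rfl <;> simp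
  simp [dot, cross]
  linear_combination (v 1 * (u 2 * v 0 - u 0 * v 2) + v 2 * (u 0 * v 1 - u 1 * v 0)) * hε2

theorem dot_cross_self_right (u v : Fin 3 → 𝕜) (hε : ε = 1 ∨ ε = -1) :
    dot ε v (cross ε v u) = 0 := by
  have hε2 : (ε : 𝕜) * ε = 1 := by rcases hε with rfl | rfl <;> simp
  simp [dot, cross]
  linear_combination (-v 1 * (u 2 * v 0 - u 0 * v 2) - v 2 * (u 0 * v 1 - u 1 * v 0)) * hε2

/-- The normal direction of the surface given by the Lelieuvre formulae. -/
theorem cross_lelieuvre (hε : ε = 1 ∨ ε = -1) (a b c : 𝕜) (u v w : Fin 3 → 𝕜) :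
    cross ε (cross ε (b • w + c • v) u) (cross ε u (a • v + c • w)) =
      ((a * b - c ^ 2) * vol u v w) • u := by
  have hε2 : (ε : 𝕜) * ε = 1 := by rcases hε with rfl | rfl <;> simp
  ext i
  rcases hε with rfl | rfl <;> fin_cases i <;>
    simp [cross, vol, Matrix.det_fin_three] <;> ring

/-- With u = N, v = N_x, w = N_y these are, up to sign, the coefficients of the second fundamental
form relative to N, obtained from N·R_x = N·R_y = 0 by differentiation. -/
theorem dot_lelieuvre (hε : ε = 1 ∨ ε = -1) (a b c : 𝕜) (u v w : Fin 3 → 𝕜) :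
    dot ε (cross ε (b • w + c • v) u) v = b * vol u v w ∧
    dot ε (cross ε (b • w + c • v) u) w = -(c * vol u v w) ∧
    dot ε (cross ε u (a • v + c • w)) w = a * vol u v w := by
  refine ⟨?_, ?_, ?_⟩ <;> rcases hε with rfl | rfl <;>
    simp [dot, cross, vol, Matrix.det_fin_three] <;> ring

theorem linearIndependent_pair_of_cross_ne_zero {u v : Fin 3 → 𝕜} (h : cross ε u v ≠ 0) :
    LinearIndependent 𝕜 ![u, v] := by
  rw [LinearIndependent.pair_iff]
  intro s t hst
  have h1 : s • cross ε u v = cross ε (s • u + t • v) v := by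
    ext i
    fin_cases i <;> simp [cross] <;> ring
  have h2 : t • cross ε u v = cross ε u (s • u + t • v) := by
    ext i
    fin_cases i <;> simp [cross] <;> ring
  have h3 : cross ε 0 v = 0 := by
    ext i
    fin_cases i <;> simp [cross]
  have h4 : cross ε u 0 = 0 := by
    ext i
    fin_cases i <;> simp [cross]
  rw [hst, h3] at h1
  rw [hst, h4] at h2
  exact ⟨(smul_eq_zero.1 h1).resolve_right h, (smul_eq_zero.1 h2).resolve_right h⟩

theorem IsLelieuvre.dx_eq' (h : IsLelieuvre ε D A B C N R) (hz : z ∈ D) :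
    dx R z = cross ε ((B z : 𝕜) • dy N z + (C z : 𝕜) • dx N z) (N z) := by
  rw [h.dx_eq z hz]
  simp only [RCLike.real_smul_eq_coe_smul (K := 𝕜)]

theorem IsLelieuvre.dy_eq' (h : IsLelieuvre ε D A B C N R) (hz : z ∈ D) :
    dy R z = cross ε (N z) ((A z : 𝕜) • dx N z + (C z : 𝕜) • dy N z) := by
  rw [h.dy_eq z hz]
  simp only [RCLike.real_smul_eq_coe_smul (K := 𝕜)]

theorem IsLelieuvre.dot_dx (hε : ε = 1 ∨ ε = -1) (h : IsLelieuvre ε D A B C N R) (hz : z ∈ D) :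
    dot ε (N z) (dx R z) = 0 := by
  rw [h.dx_eq' hz, dot_cross_self_left _ _ hε]

theorem IsLelieuvre.dot_dy (hε : ε = 1 ∨ ε = -1) (h : IsLelieuvre ε D A B C N R) (hz : z ∈ D) :
    dot ε (N z) (dy R z) = 0 := by
  rw [h.dy_eq' hz, dot_cross_self_right _ _ hε]

theorem IsLelieuvre.cross_dx_dy (hε : ε = 1 ∨ ε = -1) (h : IsLelieuvre ε D A B C N R)
    (hABC : ∀ z ∈ D, A z * B z - C z ^ 2 = Δ) (hz : z ∈ D) :
    cross ε (dx R z) (dy R z) = ((Δ : 𝕜) * vol (N z) (dx N z) (dy N z)) • N z := by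
  rw [h.dx_eq' hz, h.dy_eq' hz, cross_lelieuvre hε, ← hABC z hz]
  push_cast
  rfl

/-- With V the volume of N, N_x, N_y, the vector R_x × R_y is ΔV N, and N·R_xx = −BV, N·R_xy = CV,
N·R_yy = −AV. The powers of V cancel, leaving (AB − C²)/r². -/
theorem IsLelieuvre.gaussCurvature_eq (hε : ε = 1 ∨ ε = -1) (hΔ : Δ = 1 ∨ Δ = -1) (hD : IsOpen D)
    (hA : ContDiffOn ℝ 1 A D) (hB : ContDiffOn ℝ 1 B D) (hC : ContDiffOn ℝ 1 C D)
    (hABC : ∀ z ∈ D, A z * B z - C z ^ 2 = Δ) (hN : ContDiffOn ℝ 2 N D)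
    (h : IsLelieuvre ε D A B C N R) (hz : z ∈ D) (hr : sqNorm ε N z ≠ 0)
    (hV : vol (N z) (dx N z) (dy N z) ≠ 0) :
    gaussCurvature ε R z = (Δ : 𝕜) / sqNorm ε N z ^ 2 := by
  have hsq : (Δ : 𝕜) * (Δ : 𝕜) = 1 := by rcases hΔ with rfl | rfl <;> simp
  have hd : (A z : 𝕜) * (B z : 𝕜) - (C z : 𝕜) ^ 2 = (Δ : 𝕜) := by
    rw [← hABC z hz]; push_cast; ring
  have hN1 : ContDiffOn ℝ 1 N D := hN.of_le one_le_two
  have hNx := contDiffOn_dx (n := 2) (m := 1) le_rfl hD hN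
  have hNy := contDiffOn_dy (n := 2) (m := 1) le_rfl hD hN
  have hNd := hN1.differentiableAt_of_isOpen one_ne_zero hD hz
  have hRx : DifferentiableAt ℝ (dx R) z := ((contDiffOn_cross (ε := ε) ((hB.smul hNy).add
    (hC.smul hNx)) hN1).congr h.dx_eq).differentiableAt_of_isOpen one_ne_zero hD hz
  have hRy : DifferentiableAt ℝ (dy R) z := ((contDiffOn_cross (ε := ε) hN1 ((hA.smul hNx).add
    (hC.smul hNy))).congr h.dy_eq).differentiableAt_of_isOpen one_ne_zero hD hz
  have e1 : (fun w => dot ε (N w) (dx R w)) =ᶠ[𝓝 z] fun _ => 0 := by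
    filter_upwards [hD.mem_nhds hz] with w hw using h.dot_dx hε hw
  have e2 : (fun w => dot ε (N w) (dy R w)) =ᶠ[𝓝 z] fun _ => 0 := by
    filter_upwards [hD.mem_nhds hz] with w hw using h.dot_dy hε hw
  have c1 : dx (fun _ : ℝ × ℝ => (0 : 𝕜)) z = 0 := by simp [dx]
  have c2 : dy (fun _ : ℝ × ℝ => (0 : 𝕜)) z = 0 := by simp [dy]
  have h1 := dx_congr e1
  have h2 := dy_congr e1
  have h3 := dy_congr e2
  rw [dx_dot hNd hRx, c1, dot_comm, h.dx_eq' hz,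
    (dot_lelieuvre hε (A z : 𝕜) (B z) (C z) (N z) (dx N z) (dy N z)).1] at h1
  rw [dy_dot hNd hRx, c2, dot_comm, h.dx_eq' hz,
    (dot_lelieuvre hε (A z : 𝕜) (B z) (C z) (N z) (dx N z) (dy N z)).2.1] at h2
  rw [dy_dot hNd hRy, c2, dot_comm, h.dy_eq' hz,
    (dot_lelieuvre hε (A z : 𝕜) (B z) (C z) (N z) (dx N z) (dy N z)).2.2] at h3
  have hΔ0 : (Δ : 𝕜) ≠ 0 := left_ne_zero_of_mul_eq_one hsq
  simp only [gaussCurvature]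
  rw [h.cross_dx_dy hε hABC hz]
  simp only [dot_smul_left, dot_smul_right]
  rw [dot_comm _ (N z), dot_comm (dy (dy R) z), dot_comm (dy (dx R) z),
    eq_neg_of_add_eq_zero_right h1, eq_neg_of_add_eq_zero_right h2, eq_neg_of_add_eq_zero_right h3]
  rw [← sqNorm]
  field_simp
  linear_combination hd - (Δ:𝕜) * hsq

theorem eq_norm_gaussCurvature_smul (hΔ : Δ = 1 ∨ Δ = -1)
    (hK : gaussCurvature ε R z = (Δ : 𝕜) / sqNorm ε N z ^ 2) {ρ : ℝ} (hρ : 0 < ρ)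
    (hr : sqNorm ε N z = (ρ : 𝕜)) :
    N z = (‖gaussCurvature ε R z‖ ^ (-(1 / 4) : ℝ)) • ((√ρ)⁻¹ • N z) := by
  have h1 : ‖gaussCurvature ε R z‖ = (ρ ^ (2 : ℝ))⁻¹ := by
    rw [hK, hr, norm_div, norm_pow, RCLike.norm_ofReal, RCLike.norm_ofReal, abs_of_pos hρ]
    have : |Δ| = 1 := by rcases hΔ with rfl | rfl <;> simp
    rw [this, Real.rpow_two, one_div]
  have h2 : ‖gaussCurvature ε R z‖ ^ (-(1 / 4) : ℝ) = √ρ := by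
    rw [h1, ← Real.rpow_neg hρ.le, ← Real.rpow_mul hρ.le, Real.sqrt_eq_rpow]
    norm_num
  rw [h2, smul_smul, mul_inv_cancel₀ (Real.sqrt_pos.2 hρ).ne', one_smul]

end Surface

/-! ### Regularity of solutions and the first integral -/

section Parallel

variable {𝕜 : Type*} [RCLike 𝕜] {ε : ℝ} {Δ : 𝕜} {D : Set (ℝ × ℝ)} {A B C : ℝ × ℝ → 𝕜}
  {N X : ℝ × ℝ → Fin 3 → 𝕜} {f p : ℝ × ℝ → 𝕜} {z : ℝ × ℝ}

theorem isParallel_iff : IsParallel (mPL ε Δ A B C N p) (mQL ε Δ A B C N p) D X ↔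
    (∀ z ∈ D, DifferentiableAt ℝ X z) ∧ ∀ z ∈ D, dx X z = mP ε Δ A B C N p z (X z) ∧
      dy X z = mQ ε Δ A B C N p z (X z) := by
  constructor
  · intro h
    exact ⟨fun z hz => (h z hz).differentiableAt,
      fun z hz => ⟨dx_of_hasFDerivAt (h z hz), dy_of_hasFDerivAt (h z hz)⟩⟩
  · rintro ⟨h1, h2⟩ z hz
    have := (h1 z hz).hasFDerivAt
    rwa [fderiv_eq_planeDeriv, (h2 z hz).1, (h2 z hz).2] at this

/-- Bootstrap: a differentiable solution has continuous partial derivatives by the equation, so it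
is C¹; then its partial derivatives are C¹. -/
theorem IsNormalPair.contDiffOn_of_isParallel (hc : IsNormalPair ε Δ D A B C N f p)
    (hX : IsParallel (mPL ε Δ A B C N p) (mQL ε Δ A B C N p) D X) : ContDiffOn ℝ 2 X D := by
  obtain ⟨h1, h2⟩ := isParallel_iff.1 hX
  have hd : DifferentiableOn ℝ X D := fun z hz => (h1 z hz).differentiableWithinAt
  have hc1 : ContDiffOn ℝ 1 X D := by
    refine contDiffOn_succ_of_dx_dy (n := 0) hc.isOpen hd ?_ ?_
    · have := hc.contDiffOn_mPL.continuousOn.clm_apply hd.continuousOn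
      exact contDiffOn_zero.2 (this.congr fun z hz => (h2 z hz).1)
    · have := hc.contDiffOn_mQL.continuousOn.clm_apply hd.continuousOn
      exact contDiffOn_zero.2 (this.congr fun z hz => (h2 z hz).2)
  obtain ⟨-, -, -, hP, hQ⟩ := hc.contDiffOn_system hc1
  exact contDiffOn_succ_of_dx_dy (n := 1) hc.isOpen hd (hP.congr fun z hz => (h2 z hz).1)
    (hQ.congr fun z hz => (h2 z hz).2)

/-- The derivatives of `θ` along a solution of the linear system. -/
theorem IsNormalPair.dx_dy_mTheta (hc : IsNormalPair ε Δ D A B C N f p)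
    (hX : IsParallel (mPL ε Δ A B C N p) (mQL ε Δ A B C N p) D X) (hz : z ∈ D) :
    dx (fun w => mTheta ε N p w (X w)) z = mAlpha ε Δ B C N p z (X z) ∧
      dy (fun w => mTheta ε N p w (X w)) z = mBeta ε Δ A C N p z (X z) := by
  obtain ⟨h1, h2⟩ := isParallel_iff.1 hX
  have hX1 := (hc.contDiffOn_of_isParallel hX).of_le one_le_two
  have hθ := (hc.contDiffOn_system hX1).1.differentiableAt_of_isOpen one_ne_zero hc.isOpen hz
  have hrel : ∀ᶠ w in 𝓝 z, MoutardRel ε A B C N p X (fun w => mTheta ε N p w (X w))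
      (fun w => mAlpha ε Δ B C N p w (X w)) (fun w => mBeta ε Δ A C N p w (X w)) w := by
    filter_upwards [hc.isOpen.mem_nhds hz] with w hw using moutardRel hc hw X
  exact ⟨MoutardRel.dx_theta hc hz (h1 z hz) hθ hrel (h2 z hz).1,
    MoutardRel.dy_theta hc hz (h1 z hz) hθ hrel (h2 z hz).2⟩

variable (ε Δ N X p) in
/-- The quadratic first integral `X · X + Δ r θ²` of the linear system. -/
def firstIntegral (z : ℝ × ℝ) : 𝕜 :=
  dot ε (X z) (X z) + Δ * (sqNorm ε N z * (mTheta ε N p z (X z) * mTheta ε N p z (X z)))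

/-- X_x and X_y are combinations of N, N_x, N_y, so X·X_x and X·X_y reduce by the relations for α, β
to derivatives of r and θ; with AB − C² = Δ they cancel the derivative of Δrθ²/2. -/
theorem IsNormalPair.hasFDerivAt_firstIntegral (hc : IsNormalPair ε Δ D A B C N f p)
    (hX : IsParallel (mPL ε Δ A B C N p) (mQL ε Δ A B C N p) D X) (hz : z ∈ D) :
    HasFDerivAt (firstIntegral ε Δ N X p) (0 : ℝ × ℝ →L[ℝ] 𝕜) z := by
  obtain ⟨h1, h2⟩ := isParallel_iff.1 hX
  have hX1 := (hc.contDiffOn_of_isParallel hX).of_le one_le_two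
  have hθ := (hc.contDiffOn_system hX1).1.differentiableAt_of_isOpen one_ne_zero hc.isOpen hz
  have hN := hc.contDiffOn_N.differentiableAt_of_isOpen two_ne_zero hc.isOpen hz
  have hXd := h1 z hz
  have hr : DifferentiableAt ℝ (sqNorm ε N) z := differentiableAt_dot hN hN
  obtain ⟨hθx, hθy⟩ := hc.dx_dy_mTheta hX hz
  obtain ⟨e0, e1, e2⟩ := moutardRel hc hz X
  have hd := hc.disc z hz
  have hpx := hc.dx_p z hz
  have hpy := hc.dy_p z hz
  obtain ⟨hx, hy⟩ := h2 z hz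
  simp only [mP, mQ] at hx hy
  set θ : ℝ × ℝ → 𝕜 := fun w => mTheta ε N p w (X w) with hθd
  have hθz : mTheta ε N p z (X z) = θ z := rfl
  rw [hθz] at hx hy
  set α := mAlpha ε Δ B C N p z (X z)
  set β := mBeta ε Δ A C N p z (X z)
  have hdiff : DifferentiableAt ℝ (firstIntegral ε Δ N X p) z := by
    have : DifferentiableAt ℝ
        (fun w => dot ε (X w) (X w) + Δ * (sqNorm ε N w * (θ w * θ w))) z := by
      fun_prop
    exact this
  have hconst : DifferentiableAt ℝ (fun _ : ℝ × ℝ => Δ) z := differentiableAt_const _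
  have hcx : dx (fun _ : ℝ × ℝ => Δ) z = 0 := by simp [dx]
  have hcy : dy (fun _ : ℝ × ℝ => Δ) z = 0 := by simp [dy]
  have hxx : dx (fun w => dot ε (X w) (X w) + Δ * (sqNorm ε N w * (θ w * θ w))) z = 0 := by
    rw [dx_add (by fun_prop) (by fun_prop), dx_dot hXd hXd, dx_mul hconst (by fun_prop),
      dx_mul hr (by fun_prop), dx_mul hθ hθ, hcx, dx_sqNorm hN, hθx, hx]
    simp only [dot_sub_left, dot_add_left, dot_smul_left, dot_sub_right, dot_add_right,
      dot_smul_right]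
    rw [dot_comm (dx N z) (X z), dot_comm (dy N z) (X z), dot_comm (N z) (X z), ← e0]
    rw [sqNorm]
    rw [hpx] at e1
    rw [hpy] at e2
    linear_combination -2 * θ z * C z * e1 - 2 * θ z * B z * e2 -
      2 * θ z * (α * dot ε (N z) (N z) + θ z * dot ε (N z) (dx N z)) * hd
  have hyy : dy (fun w => dot ε (X w) (X w) + Δ * (sqNorm ε N w * (θ w * θ w))) z = 0 := by
    rw [dy_add (by fun_prop) (by fun_prop), dy_dot hXd hXd, dy_mul hconst (by fun_prop),
      dy_mul hr (by fun_prop), dy_mul hθ hθ, hcy, dy_sqNorm hN, hθy, hy]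
    simp only [dot_sub_left, dot_add_left, dot_smul_left, dot_sub_right, dot_add_right,
      dot_smul_right]
    rw [dot_comm (dx N z) (X z), dot_comm (dy N z) (X z), dot_comm (N z) (X z), ← e0]
    rw [sqNorm]
    rw [hpx] at e1
    rw [hpy] at e2
    linear_combination 2 * θ z * A z * e1 + 2 * θ z * C z * e2 -
      2 * θ z * (β * dot ε (N z) (N z) + θ z * dot ε (N z) (dy N z)) * hd
  have := hdiff.hasFDerivAt
  rw [fderiv_eq_planeDeriv] at this
  have h3 : planeDeriv (dx (firstIntegral ε Δ N X p) z) (dy (firstIntegral ε Δ N X p) z) =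
      (0 : ℝ × ℝ →L[ℝ] 𝕜) := by
    have hx' : dx (firstIntegral ε Δ N X p) z = 0 := hxx
    have hy' : dy (firstIntegral ε Δ N X p) z = 0 := hyy
    rw [hx', hy']
    ext <;> simp
  rwa [h3] at this

theorem IsNormalPair.firstIntegral_eq (hc : IsNormalPair ε Δ D A B C N f p)
    (hDc : IsPreconnected D)
    (hX : IsParallel (mPL ε Δ A B C N p) (mQL ε Δ A B C N p) D X) {w : ℝ × ℝ} (hz : z ∈ D)
    (hw : w ∈ D) : firstIntegral ε Δ N X p z = firstIntegral ε Δ N X p w :=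
  hc.isOpen.is_const_of_fderiv_eq_zero hDc
    (fun _ h => (hc.hasFDerivAt_firstIntegral hX h).differentiableAt.differentiableWithinAt)
    (fun _ h => (hc.hasFDerivAt_firstIntegral hX h).fderiv) hz hw

end Parallel

/-! ### Orthonormal frames -/

section Frame

variable {𝕜 : Type*} [RCLike 𝕜] {ε : ℝ}

theorem frameSign_mul_self (hε : ε = 1 ∨ ε = -1) (i : Fin 3) :
    (frameSign ε i : 𝕜) * (frameSign ε i : 𝕜) = 1 := by
  rcases hε with rfl | rfl <;> fin_cases i <;> simp [frameSign]

theorem dot_eq_sum (u v : Fin 3 → 𝕜) :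
    dot ε u v = ∑ k, (frameSign ε k : 𝕜) * (u k * v k) := by
  simp [dot, Fin.sum_univ_three, frameSign]
  ring

/-- The expansion of a vector in an orthonormal frame. -/
theorem sum_frame_smul (hε : ε = 1 ∨ ε = -1) {e : Fin 3 → Fin 3 → 𝕜}
    (he : ∀ i j, dot ε (e i) (e j) = if i = j then (frameSign ε i : 𝕜) else 0)
    (v : Fin 3 → 𝕜) : ∑ j, ((frameSign ε j : 𝕜) * dot ε v (e j)) • e j = v := by
  let M : Matrix (Fin 3) (Fin 3) 𝕜 := Matrix.of e
  let K : Matrix (Fin 3) (Fin 3) 𝕜 :=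
    Matrix.of fun k j => (frameSign ε k : 𝕜) * e j k * (frameSign ε j : 𝕜)
  have h : M * K = 1 := by
    ext i j
    have : (M * K) i j = dot ε (e i) (e j) * (frameSign ε j : 𝕜) := by
      rw [dot_eq_sum, Finset.sum_mul, Matrix.mul_apply]
      exact Finset.sum_congr rfl fun k _ => by simp only [M, K, Matrix.of_apply]; ring
    rw [this, he, Matrix.one_apply]
    split_ifs with hij
    · rw [hij, frameSign_mul_self hε]
    · rw [zero_mul]
  -- Orthonormality says that `K` is a right inverse of the matrix of the frame; for square matrices
  -- it is then a left inverse, which is the expansion formula.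
  have h' : K * M = 1 := mul_eq_one_comm.1 h
  have hv : Matrix.vecMul (Matrix.vecMul v K) M = v := by
    rw [Matrix.vecMul_vecMul, h', Matrix.vecMul_one]
  conv_rhs => rw [← hv]
  ext l
  simp only [Matrix.vecMul, dotProduct, Finset.sum_apply, Pi.smul_apply, smul_eq_mul]
  refine Finset.sum_congr rfl fun j _ => ?_
  rw [dot_eq_sum, Finset.mul_sum]
  congr 1
  exact Finset.sum_congr rfl fun k _ => by simp only [K, Matrix.of_apply]; ring

theorem eq_iff_frame (hε : ε = 1 ∨ ε = -1) {e : Fin 3 → Fin 3 → 𝕜}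
    (he : ∀ i j, dot ε (e i) (e j) = if i = j then (frameSign ε i : 𝕜) else 0)
    (u v : Fin 3 → 𝕜) : u = v ↔
      ∀ j, (frameSign ε j : 𝕜) * dot ε u (e j) = (frameSign ε j : 𝕜) * dot ε v (e j) := by
  refine ⟨fun h => by simp [h], fun h => ?_⟩
  rw [← sum_frame_smul hε he u, ← sum_frame_smul hε he v]
  exact Finset.sum_congr rfl fun j _ => by rw [h j]

/-- The field with components `x` in the frame `n`. -/
def frameField (n : Fin 3 → ℝ × ℝ → Fin 3 → 𝕜) (x : Fin 3 → ℝ × ℝ → 𝕜) (z : ℝ × ℝ) : Fin 3 → 𝕜 :=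
  ∑ i, x i z • n i z

variable {D : Set (ℝ × ℝ)} {N : ℝ × ℝ → Fin 3 → 𝕜} {σ : ℝ × ℝ → 𝕜}
  {n : Fin 3 → ℝ × ℝ → Fin 3 → 𝕜} {x : Fin 3 → ℝ × ℝ → 𝕜} {z : ℝ × ℝ}

theorem IsFrame.differentiableAt (hF : IsFrame ε D N σ n) (hD : IsOpen D) (hz : z ∈ D) (i : Fin 3) :
    DifferentiableAt ℝ (n i) z :=
  (hF.contDiffOn i).differentiableAt_of_isOpen two_ne_zero hD hz

theorem IsFrame.dot_frameField (hε : ε = 1 ∨ ε = -1) (hF : IsFrame ε D N σ n) (hz : z ∈ D)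
    (x : Fin 3 → ℝ × ℝ → 𝕜) (j : Fin 3) :
    (frameSign ε j : 𝕜) * dot ε (frameField n x z) (n j z) = x j z := by
  have h : dot ε (frameField n x z) (n j z) = ∑ i, x i z * dot ε (n i z) (n j z) := by
    simp [frameField, Fin.sum_univ_three]
  rw [h]
  simp only [hF.orthonormal z hz, mul_ite, mul_zero, Finset.sum_ite_eq', Finset.mem_univ, if_true]
  linear_combination x j z * frameSign_mul_self (𝕜 := 𝕜) hε j

theorem IsFrame.frameField_coord (hε : ε = 1 ∨ ε = -1) (hF : IsFrame ε D N σ n) (hz : z ∈ D)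
    (X : ℝ × ℝ → Fin 3 → 𝕜) :
    frameField n (fun j w => (frameSign ε j : 𝕜) * dot ε (X w) (n j w)) z = X z :=
  sum_frame_smul hε (hF.orthonormal z hz) (X z)

theorem IsFrame.dot_self_frameField (hF : IsFrame ε D N σ n) (hz : z ∈ D) :
    dot ε (frameField n x z) (frameField n x z) =
      x 0 z ^ 2 + (ε : 𝕜) * (x 1 z ^ 2 + x 2 z ^ 2) := by
  simp [frameField, Fin.sum_univ_three, hF.orthonormal z hz, frameSign]
  ring

theorem IsFrame.dot_normal (hF : IsFrame ε D N σ n) (hz : z ∈ D) :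
    dot ε (N z) (n 0 z) = σ z := by
  rw [hF.normal z hz]
  simp [hF.orthonormal z hz, frameSign]

theorem IsFrame.sqNorm_eq (hF : IsFrame ε D N σ n) (hz : z ∈ D) : sqNorm ε N z = σ z ^ 2 := by
  rw [sqNorm, hF.normal z hz]
  simp [hF.orthonormal z hz, frameSign, sq]

theorem IsFrame.dot_frameField_normal (hF : IsFrame ε D N σ n) (hz : z ∈ D) :
    dot ε (frameField n x z) (N z) = x 0 z * σ z := by
  rw [hF.normal z hz]
  simp [frameField, Fin.sum_univ_three, hF.orthonormal z hz, frameSign]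
  ring

/-- No smoothness of σ is assumed; it comes from σ = N·n₀. -/
theorem IsFrame.contDiffOn_sqrt (hF : IsFrame ε D N σ n) (hN : ContDiffOn ℝ 2 N D) :
    ContDiffOn ℝ 2 σ D :=
  (contDiffOn_dot (ε := ε) hN (hF.contDiffOn 0)).congr fun _ hz => (hF.dot_normal hz).symm

theorem IsFrame.dot_fderiv (hF : IsFrame ε D N σ n) (hD : IsOpen D) (hz : z ∈ D) (a : ℝ × ℝ)
    (i j : Fin 3) :
    dot ε (fderiv ℝ (n i) z a) (n j z) + dot ε (n i z) (fderiv ℝ (n j) z a) = 0 := by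
  rw [← fderiv_dot (hF.differentiableAt hD hz i) (hF.differentiableAt hD hz j)]
  have : (fun w => dot ε (n i w) (n j w)) =ᶠ[𝓝 z]
      fun _ => if i = j then (frameSign ε i : 𝕜) else 0 := by
    filter_upwards [hD.mem_nhds hz] with w hw using hF.orthonormal w hw i j
  rw [this.fderiv_eq]
  simp

theorem IsFrame.fderiv_normal (hF : IsFrame ε D N σ n) (hD : IsOpen D) (hN : ContDiffOn ℝ 2 N D)
    (hz : z ∈ D) (a : ℝ × ℝ) :
    fderiv ℝ N z a = fderiv ℝ σ z a • n 0 z + σ z • fderiv ℝ (n 0) z a := by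
  have : N =ᶠ[𝓝 z] fun w => σ w • n 0 w := by
    filter_upwards [hD.mem_nhds hz] with w hw using hF.normal w hw
  rw [this.fderiv_eq, fderiv_smul_apply
    ((hF.contDiffOn_sqrt hN).differentiableAt_of_isOpen two_ne_zero hD hz)
    (hF.differentiableAt hD hz 0)]

theorem IsFrame.fderiv_frameField (hF : IsFrame ε D N σ n) (hD : IsOpen D)
    (hz : z ∈ D) (hx : ∀ i, DifferentiableAt ℝ (x i) z) (a : ℝ × ℝ) :
    fderiv ℝ (frameField n x) z a =
      ∑ i, (fderiv ℝ (x i) z a • n i z + x i z • fderiv ℝ (n i) z a) := by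
  have hn := hF.differentiableAt hD hz
  have h : frameField n x = fun w => x 0 w • n 0 w + x 1 w • n 1 w + x 2 w • n 2 w := by
    ext1 w; simp [frameField, Fin.sum_univ_three]
  have h0 : DifferentiableAt ℝ (fun w => x 0 w • n 0 w) z := (hx 0).smul (hn 0)
  have h1 : DifferentiableAt ℝ (fun w => x 1 w • n 1 w) z := (hx 1).smul (hn 1)
  have h2 : DifferentiableAt ℝ (fun w => x 2 w • n 2 w) z := (hx 2).smul (hn 2)
  rw [h, fderiv_add_apply (h0.fun_add h1) h2, fderiv_add_apply h0 h1,
    fderiv_smul_apply (hx 0) (hn 0), fderiv_smul_apply (hx 1) (hn 1), fderiv_smul_apply (hx 2) (hn 2), Fin.sum_univ_three]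

theorem IsFrame.coord_fderiv_frameField (hε : ε = 1 ∨ ε = -1) (hF : IsFrame ε D N σ n)
    (hD : IsOpen D) (hz : z ∈ D) (hx : ∀ i, DifferentiableAt ℝ (x i) z) (a : ℝ × ℝ) (j : Fin 3) :
    (frameSign ε j : 𝕜) * dot ε (fderiv ℝ (frameField n x) z a) (n j z) = fderiv ℝ (x j) z a +
      ∑ i, x i z * ((frameSign ε j : 𝕜) * dot ε (fderiv ℝ (n i) z a) (n j z)) := by
  have h1 := hF.dot_frameField hε hz (fun i _ => fderiv ℝ (x i) z a) j
  simp only [frameField] at h1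
  rw [hF.fderiv_frameField hD hz hx, ← h1]
  simp only [Fin.sum_univ_three, dot_add_left, dot_smul_left]
  ring

end Frame

/-! ### (LS) as the frame form of the system for X -/

section LinearSystem

variable {𝕜 : Type*} [RCLike 𝕜] {ε Δ : ℝ} {D : Set (ℝ × ℝ)} {A B C : ℝ × ℝ → ℝ}
  {N : ℝ × ℝ → Fin 3 → 𝕜} {σ p f : ℝ × ℝ → 𝕜} {n : Fin 3 → ℝ × ℝ → Fin 3 → 𝕜}
  {x : Fin 3 → ℝ × ℝ → 𝕜} {z : ℝ × ℝ}

/-- The n₀-component of the equation for X_x, with t = x⁰, sx and sy the derivatives of σ, and P, Q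
the sums of p_μ⁰x^μ and q_μ⁰x^μ. It is a rational identity in these once r = σ² and p_x, p_y are
expressed by (P). -/
theorem linear_zero_x_identity {a b c Δ σ p sx sy t P Q : 𝕜} (hd : a * b - c ^ 2 = Δ) (hp : p ≠ 0)
    (hq : p ^ 2 + (σ ^ 2) ^ 2 * Δ ≠ 0) :
    p ^ 2 / (p ^ 2 + (σ ^ 2) ^ 2 * Δ) * (((σ ^ 2 / p * c - 1) * P + σ ^ 2 / p * b * Q) +
      σ ^ 2 / p ^ 2 * ((c + σ ^ 2 / p * Δ) * (2 * σ * (c * sx + b * sy)) +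
        b * (-2 * σ * (a * sx + c * sy))) * t) + P =
    t * σ / p * (c * sx + b * sy) - (c *
      (((p - σ ^ 2 * c) * (t * sx - σ * P - t * σ / p * (2 * σ * (c * sx + b * sy)) / 2) -
        σ ^ 2 * b * (t * sy - σ * Q - t * σ / p * (-2 * σ * (a * sx + c * sy)) / 2)) /
          (p ^ 2 + (σ ^ 2) ^ 2 * Δ)) + b *
      ((σ ^ 2 * a * (t * sx - σ * P - t * σ / p * (2 * σ * (c * sx + b * sy)) / 2) +
        (p + σ ^ 2 * c) * (t * sy - σ * Q - t * σ / p * (-2 * σ * (a * sx + c * sy)) / 2)) /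
          (p ^ 2 + (σ ^ 2) ^ 2 * Δ))) * σ := by
  obtain ⟨d, hd'⟩ : ∃ d, d = p ^ 2 + (σ ^ 2) ^ 2 * Δ := ⟨_, rfl⟩
  rw [← hd'] at hq ⊢
  field_simp
  rw [hd', ← hd]
  ring

theorem linear_zero_y_identity {a b c Δ σ p sx sy t P Q : 𝕜} (hd : a * b - c ^ 2 = Δ) (hp : p ≠ 0)
    (hq : p ^ 2 + (σ ^ 2) ^ 2 * Δ ≠ 0) :
    -(p ^ 2 / (p ^ 2 + (σ ^ 2) ^ 2 * Δ)) * (((σ ^ 2 / p * c + 1) * Q + σ ^ 2 / p * a * P) +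
      σ ^ 2 / p ^ 2 * ((c - σ ^ 2 / p * Δ) * (-2 * σ * (a * sx + c * sy)) +
        a * (2 * σ * (c * sx + b * sy))) * t) + Q =
    (a *
      (((p - σ ^ 2 * c) * (t * sx - σ * P - t * σ / p * (2 * σ * (c * sx + b * sy)) / 2) -
        σ ^ 2 * b * (t * sy - σ * Q - t * σ / p * (-2 * σ * (a * sx + c * sy)) / 2)) /
          (p ^ 2 + (σ ^ 2) ^ 2 * Δ)) + c *
      ((σ ^ 2 * a * (t * sx - σ * P - t * σ / p * (2 * σ * (c * sx + b * sy)) / 2) +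
        (p + σ ^ 2 * c) * (t * sy - σ * Q - t * σ / p * (-2 * σ * (a * sx + c * sy)) / 2)) /
          (p ^ 2 + (σ ^ 2) ^ 2 * Δ))) * σ - t * σ / p * (a * sx + c * sy) := by
  obtain ⟨d, hd'⟩ : ∃ d, d = p ^ 2 + (σ ^ 2) ^ 2 * Δ := ⟨_, rfl⟩
  rw [← hd'] at hq ⊢
  field_simp
  rw [hd', ← hd]
  ring

/-- N = σn₀ and the skew symmetry n_μ·dn₀ = −n₀·dn_μ express X·dN through the coefficients p_μ⁰,
q_μ⁰ that occur in (LS). -/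
theorem IsFrame.dot_frameField_fderiv_normal (hF : IsFrame ε D N σ n) (hD : IsOpen D)
    (hN : ContDiffOn ℝ 2 N D) (hz : z ∈ D) (x : Fin 3 → ℝ × ℝ → 𝕜) (a : ℝ × ℝ) :
    dot ε (frameField n x z) (fderiv ℝ N z a) = x 0 z * fderiv ℝ σ z a - σ z *
      (((frameSign ε 0 : 𝕜) * dot ε (fderiv ℝ (n 1) z a) (n 0 z)) * x 1 z +
        ((frameSign ε 0 : 𝕜) * dot ε (fderiv ℝ (n 2) z a) (n 0 z)) * x 2 z) := by
  rw [hF.fderiv_normal hD hN hz]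
  have h0 := hF.dot_fderiv hD hz a 0 0
  have h1 := hF.dot_fderiv hD hz a 1 0
  have h2 := hF.dot_fderiv hD hz a 2 0
  rw [dot_comm (fderiv ℝ (n 0) z a)] at h0
  have hs : (frameSign ε 0 : 𝕜) = 1 := by simp [frameSign]
  have e0 : dot ε (n 0 z) (n 0 z) = 1 := by simp [hF.orthonormal z hz, frameSign]
  have e1 : dot ε (n 1 z) (n 0 z) = 0 := by simp [hF.orthonormal z hz]
  have e2 : dot ε (n 2 z) (n 0 z) = 0 := by simp [hF.orthonormal z hz]
  simp only [frameField, Fin.sum_univ_three, dot_add_left, dot_smul_left, dot_add_right,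
    dot_smul_right, hs, e0, e1, e2]
  linear_combination x 0 z * σ z / 2 * h0 + x 1 z * σ z * h1 + x 2 z * σ z * h2

theorem IsFrame.dot_fderiv_normal (hF : IsFrame ε D N σ n) (hD : IsOpen D)
    (hN : ContDiffOn ℝ 2 N D) (hz : z ∈ D) (a : ℝ × ℝ) (j : Fin 3) :
    dot ε (fderiv ℝ N z a) (n j z) = (if j = 0 then fderiv ℝ σ z a else 0) +
      σ z * dot ε (fderiv ℝ (n 0) z a) (n j z) := by
  rw [hF.fderiv_normal hD hN hz, dot_add_left, dot_smul_left, dot_smul_left, hF.orthonormal z hz]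
  by_cases h : j = 0
  · subst h; simp [frameSign]
  · simp [h, Ne.symm h]

theorem IsFrame.dot_fderiv_zero (hF : IsFrame ε D N σ n) (hD : IsOpen D) (hz : z ∈ D)
    (a : ℝ × ℝ) : dot ε (fderiv ℝ (n 0) z a) (n 0 z) = 0 := by
  have h0 := hF.dot_fderiv hD hz a 0 0
  rw [dot_comm (n 0 z)] at h0
  linear_combination h0 / 2

/-- The components of the right-hand sides of the linear system in the frame. -/
theorem IsFrame.coord_mP_mQ (hF : IsFrame ε D N σ n)
    (hc : IsNormalPair ε (Δ : 𝕜) D (fun z => (A z : 𝕜)) (fun z => (B z : 𝕜)) (fun z => (C z : 𝕜))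
      N f p) (hz : z ∈ D) (x : Fin 3 → ℝ × ℝ → 𝕜) {V W : Fin 3 → 𝕜}
    (hV : V = mP ε (Δ : 𝕜) (fun z => (A z : 𝕜)) (fun z => (B z : 𝕜)) (fun z => (C z : 𝕜))
      N p z (frameField n x z))
    (hW : W = mQ ε (Δ : 𝕜) (fun z => (A z : 𝕜)) (fun z => (B z : 𝕜)) (fun z => (C z : 𝕜))
      N p z (frameField n x z)) :
    ((frameSign ε 0 : 𝕜) * dot ε V (n 0 z) =
      p z ^ 2 / (p z ^ 2 + sqNorm ε N z ^ 2 * (Δ : 𝕜)) *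
        ((∑ μ ∈ ({1, 2} : Finset (Fin 3)),
          ((sqNorm ε N z / p z * (C z : 𝕜) - 1) * rotP ε n μ 0 z
            + sqNorm ε N z / p z * (B z : 𝕜) * rotQ ε n μ 0 z) * x μ z)
        + sqNorm ε N z / p z ^ 2 *
          (((C z : 𝕜) + sqNorm ε N z / p z * (Δ : 𝕜)) * dx p z + (B z : 𝕜) * dy p z) * x 0 z) +
        ∑ i, x i z * rotP ε n i 0 z) ∧
    (∀ μ : Fin 3, μ ≠ 0 → (frameSign ε μ : 𝕜) * dot ε V (n μ z) =
      sqNorm ε N z / p z * ((C z : 𝕜) * rotP ε n 0 μ z + (B z : 𝕜) * rotQ ε n 0 μ z) * x 0 z) ∧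
    ((frameSign ε 0 : 𝕜) * dot ε W (n 0 z) =
      -(p z ^ 2 / (p z ^ 2 + sqNorm ε N z ^ 2 * (Δ : 𝕜))) *
        ((∑ μ ∈ ({1, 2} : Finset (Fin 3)),
          ((sqNorm ε N z / p z * (C z : 𝕜) + 1) * rotQ ε n μ 0 z
            + sqNorm ε N z / p z * (A z : 𝕜) * rotP ε n μ 0 z) * x μ z)
        + sqNorm ε N z / p z ^ 2 *
          (((C z : 𝕜) - sqNorm ε N z / p z * (Δ : 𝕜)) * dy p z + (A z : 𝕜) * dx p z) * x 0 z) +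
        ∑ i, x i z * rotQ ε n i 0 z) ∧
    ∀ μ : Fin 3, μ ≠ 0 → (frameSign ε μ : 𝕜) * dot ε W (n μ z) =
      -(sqNorm ε N z / p z * ((A z : 𝕜) * rotP ε n 0 μ z + (C z : 𝕜) * rotQ ε n 0 μ z) *
        x 0 z) := by
  have hD := hc.isOpen
  have hN := hc.contDiffOn_N
  have hp := hc.p_ne z hz
  have hq := hc.denom_ne z hz
  have hd := hc.disc z hz
  have hs : (frameSign ε 0 : 𝕜) = 1 := by simp [frameSign]
  have hNj : ∀ j : Fin 3, j ≠ 0 → dot ε (N z) (n j z) = 0 := fun j hj => by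
    rw [hF.normal z hz]; simp [hF.orthonormal z hz, Ne.symm hj]
  have hNd := hN.differentiableAt_of_isOpen two_ne_zero hD hz
  have hθ : mTheta ε N p z (frameField n x z) = x 0 z * σ z / p z := by
    rw [mTheta, hF.dot_frameField_normal hz]
  have hPz : rotP ε n 0 0 z = 0 := by
    rw [rotP, dx, hF.dot_fderiv_zero hD hz, mul_zero]
  have hQz : rotQ ε n 0 0 z = 0 := by
    rw [rotQ, dy, hF.dot_fderiv_zero hD hz, mul_zero]
  have hNN : ∀ a, dot ε (N z) (fderiv ℝ N z a) = σ z * fderiv ℝ σ z a := fun a => by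
    conv_lhs => rw [hF.normal z hz]
    rw [dot_smul_left, dot_comm, hF.dot_fderiv_normal hD hN hz, hF.dot_fderiv_zero hD hz]
    simp
  have hpx : dx p z = 2 * σ z * ((C z : 𝕜) * dx σ z + (B z : 𝕜) * dy σ z) := by
    rw [hc.dx_p z hz]
    simp only [dx, dy, hNN]
    ring
  have hpy : dy p z = -2 * σ z * ((A z : 𝕜) * dx σ z + (C z : 𝕜) * dy σ z) := by
    rw [hc.dy_p z hz]
    simp only [dx, dy, hNN]
    ring
  have hu : dot ε (frameField n x z) (dx N z) = x 0 z * dx σ z - σ z *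
      (rotP ε n 1 0 z * x 1 z + rotP ε n 2 0 z * x 2 z) :=
    hF.dot_frameField_fderiv_normal hD hN hz x _
  have hv : dot ε (frameField n x z) (dy N z) = x 0 z * dy σ z - σ z *
      (rotQ ε n 1 0 z * x 1 z + rotQ ε n 2 0 z * x 2 z) :=
    hF.dot_frameField_fderiv_normal hD hN hz x _
  have hx0 : dot ε (dx N z) (n 0 z) = dx σ z := by
    rw [dx, hF.dot_fderiv_normal hD hN hz, hF.dot_fderiv_zero hD hz]; simp [dx]
  have hy0 : dot ε (dy N z) (n 0 z) = dy σ z := by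
    rw [dy, hF.dot_fderiv_normal hD hN hz, hF.dot_fderiv_zero hD hz]; simp [dy]
  have hxj : ∀ j : Fin 3, j ≠ 0 → (frameSign ε j : 𝕜) * dot ε (dx N z) (n j z) =
      σ z * rotP ε n 0 j z := fun j hj => by
    rw [dx, hF.dot_fderiv_normal hD hN hz, if_neg hj, rotP, dx]; ring
  have hyj : ∀ j : Fin 3, j ≠ 0 → (frameSign ε j : 𝕜) * dot ε (dy N z) (n j z) =
      σ z * rotQ ε n 0 j z := fun j hj => by
    rw [dy, hF.dot_fderiv_normal hD hN hz, if_neg hj, rotQ, dy]; ring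
  have h12 : (1 : Fin 3) ≠ 2 := by decide
  rw [hF.sqNorm_eq hz] at hq
  subst hV hW
  refine ⟨?_, fun j hj => ?_, ?_, fun j hj => ?_⟩
  · rw [Finset.sum_pair h12, Fin.sum_univ_three, hPz, hs, hpx, hpy]
    simp only [mP, dot_sub_left, dot_add_left, dot_smul_left, hx0, hy0, hF.dot_normal hz,
      mAlpha, mBeta, hθ, hu, hv, hF.sqNorm_eq hz, hpx, hpy]
    have := linear_zero_x_identity (σ := σ z) (t := x 0 z) (sx := dx σ z) (sy := dy σ z)
      (P := rotP ε n 1 0 z * x 1 z + rotP ε n 2 0 z * x 2 z)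
      (Q := rotQ ε n 1 0 z * x 1 z + rotQ ε n 2 0 z * x 2 z) hd hp hq
    linear_combination -this
  · simp only [mP, dot_sub_left, dot_add_left, dot_smul_left, hNj j hj, hθ, hF.sqNorm_eq hz]
    linear_combination x 0 z * σ z / p z * ((C z : 𝕜) * hxj j hj + (B z : 𝕜) * hyj j hj)
  · rw [Finset.sum_pair h12, Fin.sum_univ_three, hQz, hs, hpx, hpy]
    simp only [mQ, dot_sub_left, dot_add_left, dot_smul_left, hx0, hy0, hF.dot_normal hz,
      mAlpha, mBeta, hθ, hu, hv, hF.sqNorm_eq hz, hpx, hpy]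
    have := linear_zero_y_identity (σ := σ z) (t := x 0 z) (sx := dx σ z) (sy := dy σ z)
      (P := rotP ε n 1 0 z * x 1 z + rotP ε n 2 0 z * x 2 z)
      (Q := rotQ ε n 1 0 z * x 1 z + rotQ ε n 2 0 z * x 2 z) hd hp hq
    linear_combination -this
  · simp only [mQ, dot_sub_left, dot_add_left, dot_smul_left, hNj j hj, hθ, hF.sqNorm_eq hz]
    linear_combination -(x 0 z * σ z / p z) * ((A z : 𝕜) * hxj j hj + (C z : 𝕜) * hyj j hj)

/-- The linear system for the components `x` of a field, and the one for the field itself. -/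
theorem IsFrame.isLinearSolution_iff (hε : ε = 1 ∨ ε = -1) (hF : IsFrame ε D N σ n)
    (hc : IsNormalPair ε (Δ : 𝕜) D (fun z => (A z : 𝕜)) (fun z => (B z : 𝕜)) (fun z => (C z : 𝕜))
      N f p) : IsLinearSolution ε Δ D A B C N n p x ↔ (∀ i, DifferentiableOn ℝ (x i) D) ∧
    IsParallel (mPL ε (Δ : 𝕜) (fun z => (A z : 𝕜)) (fun z => (B z : 𝕜)) (fun z => (C z : 𝕜)) N p)
      (mQL ε (Δ : 𝕜) (fun z => (A z : 𝕜)) (fun z => (B z : 𝕜)) (fun z => (C z : 𝕜)) N p) D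
      (frameField n x) := by
  have hD := hc.isOpen
  have hcoord := fun z (hz : z ∈ D) (hx : ∀ i, DifferentiableAt ℝ (x i) z) (a : ℝ × ℝ) j =>
    hF.coord_fderiv_frameField hε hD hz hx a j
  have hsum : ∀ (g : Fin 3 → 𝕜), ∑ i, g i = g 0 + g 1 + g 2 := fun g => Fin.sum_univ_three g
  constructor
  · intro h
    have hx : ∀ z ∈ D, ∀ i, DifferentiableAt ℝ (x i) z := fun z hz i =>
      (h.differentiableOn i).differentiableAt (hD.mem_nhds hz)
    refine ⟨h.differentiableOn, isParallel_iff.2 ⟨fun z hz => ?_, fun z hz => ⟨?_, ?_⟩⟩⟩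
    · have hn := hF.differentiableAt hD hz
      unfold frameField
      exact DifferentiableAt.fun_sum fun i _ => (hx z hz i).smul (hn i)
    · obtain ⟨h0, h1, -, -⟩ := hF.coord_mP_mQ hc hz x rfl rfl
      refine (eq_iff_frame hε (hF.orthonormal z hz) _ _).2 fun j => ?_
      rw [dx, hcoord z hz (hx z hz)]
      by_cases hj : j = 0
      · subst hj
        rw [h0, ← h.zero_x z hz]; rfl
      · rw [h1 j hj]
        have := h.pos_x z hz j hj
        simp only [dx, rotP] at this ⊢
        rw [this]; ring
    · obtain ⟨-, -, h0, h1⟩ := hF.coord_mP_mQ hc hz x rfl rfl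
      refine (eq_iff_frame hε (hF.orthonormal z hz) _ _).2 fun j => ?_
      rw [dy, hcoord z hz (hx z hz)]
      by_cases hj : j = 0
      · subst hj
        rw [h0, ← h.zero_y z hz]; rfl
      · rw [h1 j hj]
        have := h.pos_y z hz j hj
        simp only [dy, rotQ] at this ⊢
        rw [this]; ring
  · rintro ⟨hxd, hX⟩
    obtain ⟨-, hX⟩ := isParallel_iff.1 hX
    have hx : ∀ z ∈ D, ∀ i, DifferentiableAt ℝ (x i) z := fun z hz i =>
      (hxd i).differentiableAt (hD.mem_nhds hz)
    refine ⟨hxd, fun z hz => ?_, fun z hz j hj => ?_, fun z hz => ?_, fun z hz j hj => ?_⟩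
    · obtain ⟨h0, -, -, -⟩ := hF.coord_mP_mQ hc hz x (hX z hz).1 (hX z hz).2
      have := hcoord z hz (hx z hz) (1, 0) 0
      rw [← dx, h0] at this
      exact (add_right_cancel this).symm
    · obtain ⟨-, h0, -, -⟩ := hF.coord_mP_mQ hc hz x (hX z hz).1 (hX z hz).2
      have := hcoord z hz (hx z hz) (1, 0) j
      rw [← dx, h0 j hj] at this
      rw [this]; simp only [dx, rotP]; ring
    · obtain ⟨-, -, h0, -⟩ := hF.coord_mP_mQ hc hz x (hX z hz).1 (hX z hz).2
      have := hcoord z hz (hx z hz) (0, 1) 0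
      rw [← dy, h0] at this
      exact (add_right_cancel this).symm
    · obtain ⟨-, -, -, h0⟩ := hF.coord_mP_mQ hc hz x (hX z hz).1 (hX z hz).2
      have := hcoord z hz (hx z hz) (0, 1) j
      rw [← dy, h0 j hj] at this
      rw [sub_eq_add_neg, this]; simp only [dy, rotQ]; ring

/-- X·N = x⁰σ gives θ = x⁰σ/p, so rθ² = (x⁰)²r²/p². -/
theorem IsFrame.firstIntegral_frameField (hF : IsFrame ε D N σ n) (hz : z ∈ D) :
    firstIntegral ε (Δ : 𝕜) N (frameField n x) p z = constraintQty ε Δ N p x z := by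
  rw [firstIntegral, constraintQty, hF.dot_self_frameField hz, mTheta, hF.dot_frameField_normal hz,
    hF.sqNorm_eq hz]
  ring

end LinearSystem

/-! ### Existence and uniqueness for (LS), constancy of Q -/

section Compatibility

variable {𝕜 : Type*} [RCLike 𝕜] {ε Δ : ℝ} {D : Set (ℝ × ℝ)} {A B C : ℝ × ℝ → ℝ}
  {N : ℝ × ℝ → Fin 3 → 𝕜} {σ p f : ℝ × ℝ → 𝕜} {n : Fin 3 → ℝ × ℝ → Fin 3 → 𝕜}
  {x : Fin 3 → ℝ × ℝ → 𝕜} {z q : ℝ × ℝ}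

theorem IsParallel.congr_of_eqOn {E : Type*} [NormedAddCommGroup E] [NormedSpace ℝ E]
    {P Q : ℝ × ℝ → E →L[ℝ] E} {X Y : ℝ × ℝ → E} (hX : IsParallel P Q D X) (hD : IsOpen D)
    (h : EqOn Y X D) : IsParallel P Q D Y := fun z hz => by
  rw [h hz]
  exact (hX z hz).congr_of_eventuallyEq (h.eventuallyEq_of_mem (hD.mem_nhds hz))

theorem IsFrame.isLinearSolution_coord (hε : ε = 1 ∨ ε = -1) (hF : IsFrame ε D N σ n)
    (hc : IsNormalPair ε (Δ : 𝕜) D (fun z => (A z : 𝕜)) (fun z => (B z : 𝕜)) (fun z => (C z : 𝕜))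
      N f p) {X : ℝ × ℝ → Fin 3 → 𝕜}
    (hX : IsParallel (mPL ε (Δ : 𝕜) (fun z => (A z : 𝕜)) (fun z => (B z : 𝕜))
      (fun z => (C z : 𝕜)) N p) (mQL ε (Δ : 𝕜) (fun z => (A z : 𝕜)) (fun z => (B z : 𝕜))
      (fun z => (C z : 𝕜)) N p) D X) :
    IsLinearSolution ε Δ D A B C N n p
      (fun j w => (frameSign ε j : 𝕜) * dot ε (X w) (n j w)) := by
  refine (hF.isLinearSolution_iff hε hc).2 ⟨fun j => ?_, hX.congr_of_eqOn hc.isOpen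
    fun z hz => hF.frameField_coord hε hz X⟩
  exact (contDiffOn_const.mul (contDiffOn_dot ((hc.contDiffOn_of_isParallel hX).of_le one_le_two)
    ((hF.contDiffOn j).of_le one_le_two))).differentiableOn one_ne_zero

theorem IsFrame.exists_isLinearSolution (hε : ε = 1 ∨ ε = -1) (hF : IsFrame ε D N σ n)
    (hc : IsNormalPair ε (Δ : 𝕜) D (fun z => (A z : 𝕜)) (fun z => (B z : 𝕜)) (fun z => (C z : 𝕜))
      N f p) (hDs : IsSimplyConnected D) (hq : q ∈ D) (ξ : Fin 3 → 𝕜) :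
    ∃ x, IsLinearSolution ε Δ D A B C N n p x ∧ ∀ i, x i q = ξ i := by
  obtain ⟨X, hXq, hX⟩ := exists_isParallel hc.isOpen hDs hc.contDiffOn_mPL hc.contDiffOn_mQL
    hc.isFlat hq (frameField n (fun i _ => ξ i) q)
  refine ⟨_, hF.isLinearSolution_coord hε hc hX, fun i => ?_⟩
  simp only [hXq]
  exact hF.dot_frameField hε hq _ i

theorem IsFrame.isLinearSolution_eqOn (hε : ε = 1 ∨ ε = -1) (hF : IsFrame ε D N σ n)
    (hc : IsNormalPair ε (Δ : 𝕜) D (fun z => (A z : 𝕜)) (fun z => (B z : 𝕜)) (fun z => (C z : 𝕜))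
      N f p) (hDc : IsPreconnected D) (hq : q ∈ D) {y : Fin 3 → ℝ × ℝ → 𝕜}
    (hx : IsLinearSolution ε Δ D A B C N n p x) (hy : IsLinearSolution ε Δ D A B C N n p y)
    (hxy : ∀ i, x i q = y i q) (i : Fin 3) : EqOn (x i) (y i) D := by
  have h := IsParallel.eqOn hc.isOpen hDc hc.contDiffOn_mPL.continuousOn
    hc.contDiffOn_mQL.continuousOn ((hF.isLinearSolution_iff hε hc).1 hx).2
    ((hF.isLinearSolution_iff hε hc).1 hy).2 hq (by simp only [frameField, hxy])
  intro z hz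
  rw [← hF.dot_frameField hε hz x, h hz, hF.dot_frameField hε hz y]

theorem IsFrame.constraintQty_eq (hε : ε = 1 ∨ ε = -1) (hF : IsFrame ε D N σ n)
    (hc : IsNormalPair ε (Δ : 𝕜) D (fun z => (A z : 𝕜)) (fun z => (B z : 𝕜)) (fun z => (C z : 𝕜))
      N f p) (hDc : IsPreconnected D) (hx : IsLinearSolution ε Δ D A B C N n p x)
    (hz : z ∈ D) (hq : q ∈ D) : constraintQty ε Δ N p x z = constraintQty ε Δ N p x q := by
  rw [← hF.firstIntegral_frameField hz, ← hF.firstIntegral_frameField hq]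
  exact hc.firstIntegral_eq hDc ((hF.isLinearSolution_iff hε hc).1 hx).2 hz hq

end Compatibility

/-! ### The transformed field N' = X/θ -/

section Transform

variable {𝕜 : Type*} [RCLike 𝕜] {ε : ℝ} {Δ : 𝕜} {D : Set (ℝ × ℝ)} {A B C : ℝ × ℝ → 𝕜}
  {N N' X : ℝ × ℝ → Fin 3 → 𝕜} {f p θ : ℝ × ℝ → 𝕜} {z : ℝ × ℝ}

/-- `X` solves the linear system of the normal field `N`, and `N' = X / θ`. -/
structure IsMoutardPair (ε : ℝ) (Δ : 𝕜) (D : Set (ℝ × ℝ)) (A B C : ℝ × ℝ → 𝕜)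
    (N : ℝ × ℝ → Fin 3 → 𝕜) (f p θ : ℝ × ℝ → 𝕜) (X N' : ℝ × ℝ → Fin 3 → 𝕜) : Prop where
  pair : IsNormalPair ε Δ D A B C N f p
  parallel : IsParallel (mPL ε Δ A B C N p) (mQL ε Δ A B C N p) D X
  theta_eq : ∀ z ∈ D, θ z = mTheta ε N p z (X z)
  theta_ne : ∀ z ∈ D, θ z ≠ 0
  field_eq : ∀ z ∈ D, N' z = (θ z)⁻¹ • X z

theorem IsMoutardPair.contDiffOn_theta (h : IsMoutardPair ε Δ D A B C N f p θ X N') :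
    ContDiffOn ℝ 2 θ D := by
  have hX := h.pair.contDiffOn_of_isParallel h.parallel
  refine ContDiffOn.congr ?_ h.theta_eq
  simp only [mTheta, div_eq_mul_inv]
  exact (contDiffOn_dot hX h.pair.contDiffOn_N).mul (h.pair.contDiffOn_p.inv h.pair.p_ne)

theorem IsMoutardPair.contDiffOn_inv_theta (h : IsMoutardPair ε Δ D A B C N f p θ X N') :
    ContDiffOn ℝ 2 (fun w => (θ w)⁻¹) D := h.contDiffOn_theta.inv h.theta_ne

theorem IsMoutardPair.contDiffOn_field (h : IsMoutardPair ε Δ D A B C N f p θ X N') :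
    ContDiffOn ℝ 2 N' D :=
  (h.contDiffOn_inv_theta.smul (h.pair.contDiffOn_of_isParallel h.parallel)).congr h.field_eq

/-- The derivatives of `X` in terms of those of `θ`. -/
theorem IsMoutardPair.dx_dy (h : IsMoutardPair ε Δ D A B C N f p θ X N') (hz : z ∈ D) :
    dx X z = θ z • (C z • dx N z + B z • dy N z) - (C z * dx θ z + B z * dy θ z) • N z ∧
      dy X z = (A z * dx θ z + C z * dy θ z) • N z - θ z • (A z • dx N z + C z • dy N z) := by
  have e : θ =ᶠ[𝓝 z] fun w => mTheta ε N p w (X w) := by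
    filter_upwards [h.pair.isOpen.mem_nhds hz] with w hw using h.theta_eq w hw
  obtain ⟨hx, hy⟩ := h.pair.dx_dy_mTheta h.parallel hz
  obtain ⟨-, h2⟩ := isParallel_iff.1 h.parallel
  rw [dx_congr e, dy_congr e, hx, hy, h.theta_eq z hz]
  exact h2 z hz

/-- The coefficient matrix applied to the gradient of X collapses by AB − C² = Δ to a rotated
gradient: A, B, C disappear from the right-hand sides. -/
theorem IsMoutardPair.flux (h : IsMoutardPair ε Δ D A B C N f p θ X N') (hz : z ∈ D) :
    A z • dx X z + C z • dy X z = Δ • (θ z • dy N z - dy θ z • N z) ∧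
      C z • dx X z + B z • dy X z = Δ • (dx θ z • N z - θ z • dx N z) := by
  obtain ⟨hx, hy⟩ := h.dx_dy hz
  rw [hx, hy, ← h.pair.disc z hz]
  constructor <;> module

theorem dx_inv {θ : ℝ × ℝ → 𝕜} (hθ : DifferentiableAt ℝ θ z) (h0 : θ z ≠ 0) :
    dx (fun w => (θ w)⁻¹) z = -dx θ z * ((θ z)⁻¹ * (θ z)⁻¹) := by
  have h1 : DifferentiableAt ℝ (fun w => (θ w)⁻¹) z := hθ.inv h0
  have h2 : (fun w => θ w * (θ w)⁻¹) =ᶠ[𝓝 z] fun _ => (1 : 𝕜) := by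
    filter_upwards [hθ.continuousAt.eventually_ne h0] with w hw using mul_inv_cancel₀ hw
  have h3 := dx_congr h2
  have h4 : dx (fun _ : ℝ × ℝ => (1 : 𝕜)) z = 0 := by simp [dx]
  rw [dx_mul hθ h1, h4] at h3
  refine mul_left_cancel₀ h0 ?_
  linear_combination h3 + dx θ z * (θ z)⁻¹ * (mul_inv_cancel₀ h0)

theorem dy_inv {θ : ℝ × ℝ → 𝕜} (hθ : DifferentiableAt ℝ θ z) (h0 : θ z ≠ 0) :
    dy (fun w => (θ w)⁻¹) z = -dy θ z * ((θ z)⁻¹ * (θ z)⁻¹) := by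
  have h1 : DifferentiableAt ℝ (fun w => (θ w)⁻¹) z := hθ.inv h0
  have h2 : (fun w => θ w * (θ w)⁻¹) =ᶠ[𝓝 z] fun _ => (1 : 𝕜) := by
    filter_upwards [hθ.continuousAt.eventually_ne h0] with w hw using mul_inv_cancel₀ hw
  have h3 := dy_congr h2
  have h4 : dy (fun _ : ℝ × ℝ => (1 : 𝕜)) z = 0 := by simp [dy]
  rw [dy_mul hθ h1, h4] at h3
  refine mul_left_cancel₀ h0 ?_
  linear_combination h3 + dy θ z * (θ z)⁻¹ * (mul_inv_cancel₀ h0)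

theorem IsMoutardPair.operator_field (h : IsMoutardPair ε Δ D A B C N f p θ X N') (hz : z ∈ D) :
    dx (fun w => A w • dx N' w + C w • dy N' w) z + dy (fun w => C w • dx N' w + B w • dy N' w) z =
      (dx (fun w => A w * dx (fun w => (θ w)⁻¹) w + C w * dy (fun w => (θ w)⁻¹) w) z +
        dy (fun w => C w * dx (fun w => (θ w)⁻¹) w + B w * dy (fun w => (θ w)⁻¹) w) z) • X z := by
  have hD := h.pair.isOpen
  have hX := h.pair.contDiffOn_of_isParallel h.parallel
  have hN := h.pair.contDiffOn_N
  have hθ := h.contDiffOn_theta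
  have hφ := h.contDiffOn_inv_theta
  have d1 {g : ℝ × ℝ → 𝕜} (hg : ContDiffOn ℝ 2 g D) : DifferentiableAt ℝ (dx g) z ∧
      DifferentiableAt ℝ (dy g) z :=
    ⟨(contDiffOn_dx (n := 2) (m := 1) le_rfl hD hg).differentiableAt_of_isOpen one_ne_zero hD hz,
    (contDiffOn_dy (n := 2) (m := 1) le_rfl hD hg).differentiableAt_of_isOpen one_ne_zero hD hz⟩
  have dA := h.pair.contDiffOn_A.differentiableAt_of_isOpen one_ne_zero hD hz
  have dB := h.pair.contDiffOn_B.differentiableAt_of_isOpen one_ne_zero hD hz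
  have dC := h.pair.contDiffOn_C.differentiableAt_of_isOpen one_ne_zero hD hz
  have dN {w} (hw : w ∈ D) := hN.differentiableAt_of_isOpen two_ne_zero hD hw
  have dX {w} (hw : w ∈ D) := hX.differentiableAt_of_isOpen two_ne_zero hD hw
  have dθ {w} (hw : w ∈ D) := hθ.differentiableAt_of_isOpen two_ne_zero hD hw
  have dφ {w} (hw : w ∈ D) := hφ.differentiableAt_of_isOpen two_ne_zero hD hw
  have dNx : DifferentiableAt ℝ (dx N) z :=
    (contDiffOn_dx (n := 2) (m := 1) le_rfl hD hN).differentiableAt_of_isOpen one_ne_zero hD hz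
  have dNy : DifferentiableAt ℝ (dy N) z :=
    (contDiffOn_dy (n := 2) (m := 1) le_rfl hD hN).differentiableAt_of_isOpen one_ne_zero hD hz
  have dNz := dN hz
  have dXz := dX hz
  have dφz := dφ hz
  obtain ⟨dθx, dθy⟩ := d1 hθ
  obtain ⟨dφx, dφy⟩ := d1 hφ
  have cN := dx_dy_comm hD hN hz
  have cθ := dx_dy_comm hD hθ hz
  have hflux := fun {w} (hw : w ∈ D) => h.flux hw
  have hinv := fun {w} (hw : w ∈ D) => mul_inv_cancel₀ (h.theta_ne w hw)
  have hφx := dx_inv (dθ hz) (h.theta_ne z hz)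
  have hφy := dy_inv (dθ hz) (h.theta_ne z hz)
  have hΔ : DifferentiableAt ℝ (fun _ : ℝ × ℝ => Δ) z := differentiableAt_const _
  have hΔx : dx (fun _ : ℝ × ℝ => Δ) z = 0 := by simp [dx]
  have hΔy : dy (fun _ : ℝ × ℝ => Δ) z = 0 := by simp [dy]
  have eN : ∀ w ∈ D, N' =ᶠ[𝓝 w] fun w => (θ w)⁻¹ • X w := fun w hw => by
    filter_upwards [hD.mem_nhds hw] with v hv using h.field_eq v hv
  set φ : ℝ × ℝ → 𝕜 := fun w => (θ w)⁻¹ with hφdef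
  have hφz : ∀ w, (θ w)⁻¹ = φ w := fun w => rfl
  simp only [hφz] at hinv hφx hφy eN
  -- Multiplying the fluxes of X by 1/θ isolates N_y and −N_x, which contribute N_yx − N_xy = 0 to
  -- the divergence.
  have eP : (fun w => A w • dx N' w + C w • dy N' w) =ᶠ[𝓝 z] fun w =>
      (A w * dx φ w + C w * dy φ w) • X w + Δ • (dy N w - (φ w * dy θ w) • N w) := by
    filter_upwards [hD.mem_nhds hz] with w hw
    rw [dx_congr (eN w hw), dy_congr (eN w hw), dx_smul (dφ hw) (dX hw), dy_smul (dφ hw) (dX hw)]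
    have e1 : A w • (dx φ w • X w + φ w • dx X w) + C w • (dy φ w • X w + φ w • dy X w) =
        (A w * dx φ w + C w * dy φ w) • X w + φ w • (A w • dx X w + C w • dy X w) := by module
    have e2 : dy N w = (θ w * φ w) • dy N w := by rw [hinv hw, one_smul]
    rw [e1, (hflux hw).1]
    conv_rhs => rw [e2]
    module
  have eQ : (fun w => C w • dx N' w + B w • dy N' w) =ᶠ[𝓝 z] fun w =>
      (C w * dx φ w + B w * dy φ w) • X w + Δ • ((φ w * dx θ w) • N w - dx N w) := by
    filter_upwards [hD.mem_nhds hz] with w hw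
    rw [dx_congr (eN w hw), dy_congr (eN w hw), dx_smul (dφ hw) (dX hw), dy_smul (dφ hw) (dX hw)]
    have e1 : C w • (dx φ w • X w + φ w • dx X w) + B w • (dy φ w • X w + φ w • dy X w) =
        (C w * dx φ w + B w * dy φ w) • X w + φ w • (C w • dx X w + B w • dy X w) := by module
    have e2 : dx N w = (θ w * φ w) • dx N w := by rw [hinv hw, one_smul]
    rw [e1, (hflux hw).2]
    conv_rhs => rw [e2]
    module
  rw [dx_congr eP, dy_congr eQ]
  set S : ℝ × ℝ → 𝕜 := fun w => A w * dx φ w + C w * dy φ w with hS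
  set T : ℝ × ℝ → 𝕜 := fun w => C w * dx φ w + B w * dy φ w with hT
  have dS : DifferentiableAt ℝ S z := by fun_prop
  have dT : DifferentiableAt ℝ T z := by fun_prop
  have hSz : ∀ w, A w * dx φ w + C w * dy φ w = S w := fun w => rfl
  have hTz : ∀ w, C w * dx φ w + B w * dy φ w = T w := fun w => rfl
  simp only [hSz, hTz]
  rw [dx_add (by fun_prop) (by fun_prop), dx_smul dS dXz, dx_smul hΔ (by fun_prop),
    dx_sub dNy (by fun_prop), dx_smul (by fun_prop) dNz, dx_mul dφz dθy,
    dy_add (by fun_prop) (by fun_prop), dy_smul dT dXz, dy_smul hΔ (by fun_prop),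
    dy_sub (by fun_prop) dNx, dy_smul (by fun_prop) dNz, dy_mul dφz dθx, hΔx, hΔy, cN, cθ]
  have e3 : S z • dx X z + T z • dy X z = dx φ z • (A z • dx X z + C z • dy X z) +
      dy φ z • (C z • dx X z + B z • dy X z) := by
    rw [← hSz, ← hTz]; module
  rw [(hflux hz).1, (hflux hz).2] at e3
  -- This cross term cancels the remaining first-order terms Δφ(θ_x N_y − θ_y N_x), where φ = 1/θ.
  -- The terms in N cancel because φ_xθ_y = φ_yθ_x.
  have e4 : S z • dx X z + T z • dy X z =
      (Δ * φ z) • (dy θ z • dx N z - dx θ z • dy N z) := by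
    rw [e3, hφx, hφy]
    have h1 := hinv hz
    have e5 : φ z = θ z * φ z * φ z := by rw [h1, one_mul]
    conv_rhs => rw [e5]
    module
  rw [hφx, hφy]
  linear_combination (norm := module) e4

/-- The derivatives of the transform. -/
theorem IsMoutardPair.dx_dy_field (h : IsMoutardPair ε Δ D A B C N f p θ X N') (hz : z ∈ D) :
    ∃ l m : 𝕜, dx N' z = (C z • dx N z + B z • dy N z) - (C z * l + B z * m) • N z - l • N' z ∧
      dy N' z = (A z * l + C z * m) • N z - (A z • dx N z + C z • dy N z) - m • N' z := by
  have hD := h.pair.isOpen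
  have hX := (h.pair.contDiffOn_of_isParallel h.parallel).differentiableAt_of_isOpen two_ne_zero
    hD hz
  have hθ := h.contDiffOn_theta.differentiableAt_of_isOpen two_ne_zero hD hz
  have hφ := h.contDiffOn_inv_theta.differentiableAt_of_isOpen two_ne_zero hD hz
  have eN : N' =ᶠ[𝓝 z] fun w => (θ w)⁻¹ • X w := by
    filter_upwards [hD.mem_nhds hz] with v hv using h.field_eq v hv
  have h0 := h.theta_ne z hz
  have h1 : ∀ v : Fin 3 → 𝕜, v = ((θ z)⁻¹ * θ z) • v := fun v => by
    rw [inv_mul_cancel₀ h0, one_smul]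
  refine ⟨(θ z)⁻¹ * dx θ z, (θ z)⁻¹ * dy θ z, ?_, ?_⟩
  · rw [dx_congr eN, dx_smul hφ hX, (h.dx_dy hz).1, dx_inv hθ h0, h.field_eq z hz]
    conv_rhs => rw [h1 (dx N z), h1 (dy N z)]
    module
  · rw [dy_congr eN, dy_smul hφ hX, (h.dx_dy hz).2, dy_inv hθ h0, h.field_eq z hz]
    conv_rhs => rw [h1 (dx N z), h1 (dy N z)]
    module

theorem IsMoutardPair.dot_eq (h : IsMoutardPair ε Δ D A B C N f p θ X N') (hz : z ∈ D) :
    dot ε (N z) (N' z) = p z := by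
  have h0 := h.theta_ne z hz
  have h1 := (moutardRel h.pair hz X).theta_eq
  rw [← h.theta_eq z hz] at h1
  rw [h.field_eq z hz, dot_smul_right, dot_comm, ← h1]
  field_simp

theorem IsMoutardPair.dot_self_eq (h : IsMoutardPair ε Δ D A B C N f p θ X N') (hz : z ∈ D)
    (hI : firstIntegral ε Δ N X p z = 0) : sqNorm ε N' z = -(Δ * sqNorm ε N z) := by
  have h0 := h.theta_ne z hz
  rw [firstIntegral, ← h.theta_eq z hz] at hI
  have h1 : sqNorm ε N' z = (θ z)⁻¹ * ((θ z)⁻¹ * dot ε (X z) (X z)) := by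
    rw [sqNorm, h.field_eq z hz, dot_smul_left, dot_smul_right]
  rw [h1]
  field_simp
  linear_combination hI

end Transform

/-! ### Scaling of the operator L -/

section SelfAdjoint

variable {E : Type*} [NormedAddCommGroup E] [NormedSpace ℝ E] {A B C : ℝ × ℝ → ℝ} {Δ : ℝ}
  {z : ℝ × ℝ}

theorem dx_const_smul (c : ℝ) (g : ℝ × ℝ → E) : dx (fun w => c • g w) z = c • dx g z := by
  have : fderiv ℝ (fun w => c • g w) z = c • fderiv ℝ g z := congrFun (fderiv_const_smul_field c) z
  simp [dx, this]

theorem dy_const_smul (c : ℝ) (g : ℝ × ℝ → E) : dy (fun w => c • g w) z = c • dy g z := by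
  have : fderiv ℝ (fun w => c • g w) z = c • fderiv ℝ g z := congrFun (fderiv_const_smul_field c) z
  simp [dy, this]

theorem selfAdjOp_congr {g h : ℝ × ℝ → E} (hgh : g =ᶠ[𝓝 z] h) :
    selfAdjOp A B C g z = selfAdjOp A B C h z := by
  have h1 : (fun w => A w • dx g w + C w • dy g w) =ᶠ[𝓝 z]
      fun w => A w • dx h w + C w • dy h w := by
    filter_upwards [hgh.eventuallyEq_nhds] with w hw
    rw [dx_congr hw, dy_congr hw]
  have h2 : (fun w => C w • dx g w + B w • dy g w) =ᶠ[𝓝 z]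
      fun w => C w • dx h w + B w • dy h w := by
    filter_upwards [hgh.eventuallyEq_nhds] with w hw
    rw [dx_congr hw, dy_congr hw]
  rw [selfAdjOp, selfAdjOp, dx_congr h1, dy_congr h2]

theorem selfAdjOp_const_smul (c : ℝ) (g : ℝ × ℝ → E) :
    selfAdjOp A B C (fun w => c • g w) z = c • selfAdjOp A B C g z := by
  simp only [selfAdjOp, dx_const_smul, dy_const_smul]
  have h1 : (fun w => A w • c • dx g w + C w • c • dy g w) =
      fun w => c • (A w • dx g w + C w • dy g w) := by ext1 w; module
  have h2 : (fun w => C w • c • dx g w + B w • c • dy g w) =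
      fun w => c • (C w • dx g w + B w • dy g w) := by ext1 w; module
  rw [h1, h2, dx_const_smul, dy_const_smul, smul_add]

theorem newCoeff_eq (hΔ : Δ = 1 ∨ Δ = -1) (a : ℝ × ℝ → ℝ) (z : ℝ × ℝ) :
    newCoeff Δ a z = -Δ * a z := by
  rcases hΔ with rfl | rfl <;> simp [newCoeff]

theorem selfAdjOp_newCoeff (hΔ : Δ = 1 ∨ Δ = -1) (g : ℝ × ℝ → E) :
    selfAdjOp (newCoeff Δ A) (newCoeff Δ B) (newCoeff Δ C) g z = (-Δ) • selfAdjOp A B C g z := by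
  simp only [selfAdjOp, newCoeff_eq hΔ]
  have h1 : (fun w => (-Δ * A w) • dx g w + (-Δ * C w) • dy g w) =
      fun w => (-Δ) • (A w • dx g w + C w • dy g w) := by ext1 w; module
  have h2 : (fun w => (-Δ * C w) • dx g w + (-Δ * B w) • dy g w) =
      fun w => (-Δ) • (C w • dx g w + B w • dy g w) := by ext1 w; module
  rw [h1, h2, dx_const_smul, dy_const_smul, smul_add]

end SelfAdjoint

/-! ### The auto-Bäcklund property -/

section Backlund

variable {𝕜 : Type*} [RCLike 𝕜] {ε Δ : ℝ} {U : Set (ℝ × ℝ)} {A B C : ℝ × ℝ → ℝ}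
  {N N' R : ℝ × ℝ → Fin 3 → 𝕜} {σ p f : ℝ × ℝ → 𝕜} {n : Fin 3 → ℝ × ℝ → Fin 3 → 𝕜}
  {x : Fin 3 → ℝ × ℝ → 𝕜} {z : ℝ × ℝ}

theorem IsTransform.isMoutardPair (hε : ε = 1 ∨ ε = -1)
    (hc : IsNormalPair ε (Δ : 𝕜) U (fun z => (A z : 𝕜)) (fun z => (B z : 𝕜)) (fun z => (C z : 𝕜))
      N f p) (hr : ∀ z ∈ U, sqNorm ε N z ≠ 0) (h : IsTransform ε Δ U A B C N σ n p x N') :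
    IsMoutardPair ε (Δ : 𝕜) U (fun z => (A z : 𝕜)) (fun z => (B z : 𝕜)) (fun z => (C z : 𝕜))
      N f p (theta σ p x) (frameField n x) N' := by
  have hσ : ∀ z ∈ U, σ z ≠ 0 := fun z hz h0 => hr z hz (by rw [h.frame.sqNorm_eq hz, h0]; simp)
  refine ⟨hc, ((h.frame.isLinearSolution_iff hε hc).1 h.linear).2, fun z hz => ?_, fun z hz => ?_,
    fun z hz => ?_⟩
  · rw [theta, mTheta, h.frame.dot_frameField_normal hz]
  · exact div_ne_zero (mul_ne_zero (h.x_ne z hz) (hσ z hz)) (h.p_ne z hz)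
  · rw [h.field_eq z hz, frameField, Finset.smul_sum]
    refine Finset.sum_congr rfl fun i _ => ?_
    rw [smul_smul, theta]
    congr 1
    have := hσ z hz
    have := h.x_ne z hz
    have := h.p_ne z hz
    field_simp

theorem IsMoutardPair.selfAdjOp_field {θ : ℝ × ℝ → 𝕜} {X : ℝ × ℝ → Fin 3 → 𝕜}
    (h : IsMoutardPair ε (Δ : 𝕜) U (fun z => (A z : 𝕜)) (fun z => (B z : 𝕜)) (fun z => (C z : 𝕜))
      N f p θ X N') (hz : z ∈ U) :
    selfAdjOp A B C N' z = (θ z * selfAdjOp A B C (fun w => (θ w)⁻¹) z) • N' z := by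
  have h0 := h.theta_ne z hz
  rw [selfAdjOp_vector, h.operator_field hz, ← selfAdjOp_scalar, h.field_eq z hz, smul_smul]
  congr 1
  field_simp

/-- Here v = N, u = N_x, w = N_y, M = N', and l, m are the logarithmic derivatives of θ. With the
new coefficients, B'N'_y + C'N'_x is N_x − lN plus a multiple of N', and that multiple is killed by
the product with N'. -/
theorem cross_transform_x {a b c δ : 𝕜} (hd : a * b - c ^ 2 = δ) (hδ : δ * δ = 1)
    (v u w M : Fin 3 → 𝕜) (l m : 𝕜) :
    cross ε (b • w + c • u) v +
      (cross ε u M + cross ε v ((c • u + b • w) - (c * l + b * m) • v - l • M)) =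
    cross ε ((-δ * b) • ((a * l + c * m) • v - (a • u + c • w) - m • M) +
      (-δ * c) • ((c • u + b • w) - (c * l + b * m) • v - l • M)) M := by
  have h1 : (-δ * b) • ((a * l + c * m) • v - (a • u + c • w) - m • M) +
      (-δ * c) • ((c • u + b • w) - (c * l + b * m) • v - l • M) =
      u - l • v + (δ * (b * m + c * l)) • M := by
    have e1 : u = (δ * (a * b - c ^ 2)) • u := by rw [hd, hδ, one_smul]
    have e2 : l • v = (δ * (a * b - c ^ 2)) • (l • v) := by rw [hd, hδ, one_smul]
    conv_rhs => rw [e1, e2]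
    module
  rw [h1]
  ext i
  fin_cases i <;> simp [cross] <;> ring

theorem cross_transform_y {a b c δ : 𝕜} (hd : a * b - c ^ 2 = δ) (hδ : δ * δ = 1)
    (v u w M : Fin 3 → 𝕜) (l m : 𝕜) :
    cross ε v (a • u + c • w) +
      (cross ε w M + cross ε v ((a * l + c * m) • v - (a • u + c • w) - m • M)) =
    cross ε M ((-δ * a) • ((c • u + b • w) - (c * l + b * m) • v - l • M) +
      (-δ * c) • ((a * l + c * m) • v - (a • u + c • w) - m • M)) := by
  have h1 : (-δ * a) • ((c • u + b • w) - (c * l + b * m) • v - l • M) +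
      (-δ * c) • ((a * l + c * m) • v - (a • u + c • w) - m • M) =
      -w + m • v + (δ * (a * l + c * m)) • M := by
    have e1 : w = (δ * (a * b - c ^ 2)) • w := by rw [hd, hδ, one_smul]
    have e2 : m • v = (δ * (a * b - c ^ 2)) • (m • v) := by rw [hd, hδ, one_smul]
    conv_rhs => rw [e1, e2]
    module
  rw [h1]
  ext i
  fin_cases i <;> simp [cross] <;> ring

theorem IsMoutardPair.isLelieuvre {θ : ℝ × ℝ → 𝕜} {X : ℝ × ℝ → Fin 3 → 𝕜} (hΔ : Δ = 1 ∨ Δ = -1)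
    (h : IsMoutardPair ε (Δ : 𝕜) U (fun z => (A z : 𝕜)) (fun z => (B z : 𝕜)) (fun z => (C z : 𝕜))
      N f p θ X N') (hR : IsLelieuvre ε U A B C N R) (c : Fin 3 → 𝕜) :
    IsLelieuvre ε U (newCoeff Δ A) (newCoeff Δ B) (newCoeff Δ C) N'
      (fun z => R z + cross ε (N z) (N' z) + c) := by
  have hU := h.pair.isOpen
  have dR : ∀ z ∈ U, DifferentiableAt ℝ R z := fun z hz =>
    hR.differentiableOn.differentiableAt (hU.mem_nhds hz)
  have dN : ∀ z ∈ U, DifferentiableAt ℝ N z := fun z hz =>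
    h.pair.contDiffOn_N.differentiableAt_of_isOpen two_ne_zero hU hz
  have dN' : ∀ z ∈ U, DifferentiableAt ℝ N' z := fun z hz =>
    h.contDiffOn_field.differentiableAt_of_isOpen two_ne_zero hU hz
  have dc : ∀ z ∈ U, DifferentiableAt ℝ (fun w => cross ε (N w) (N' w)) z := fun z hz =>
    differentiableAt_cross (dN z hz) (dN' z hz)
  have hcx : ∀ z, dx (fun _ : ℝ × ℝ => c) z = 0 := fun z => by simp [dx]
  have hcy : ∀ z, dy (fun _ : ℝ × ℝ => c) z = 0 := fun z => by simp [dy]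
  have hn : ∀ (a : ℝ × ℝ → ℝ) (z : ℝ × ℝ) (v : Fin 3 → 𝕜),
      newCoeff Δ a z • v = (-(Δ : 𝕜) * (a z : 𝕜)) • v := fun a z v => by
    rw [newCoeff_eq hΔ, RCLike.real_smul_eq_coe_smul (K := 𝕜)]
    push_cast
    rfl
  refine ⟨fun z hz => (((dR z hz).add (dc z hz)).add_const c).differentiableWithinAt,
    fun z hz => ?_, fun z hz => ?_⟩
  · obtain ⟨l, m, h1, h2⟩ := h.dx_dy_field hz
    rw [dx_add ((dR z hz).fun_add (dc z hz)) (differentiableAt_const c), dx_add (dR z hz) (dc z hz),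
      dx_cross (dN z hz) (dN' z hz), hcx, add_zero, hR.dx_eq' hz, hn, hn, h1, h2]
    exact cross_transform_x (h.pair.disc z hz) h.pair.disc_sq _ _ _ _ _ _
  · obtain ⟨l, m, h1, h2⟩ := h.dx_dy_field hz
    rw [dy_add ((dR z hz).fun_add (dc z hz)) (differentiableAt_const c), dy_add (dR z hz) (dc z hz),
      dy_cross (dN z hz) (dN' z hz), hcy, add_zero, hR.dy_eq' hz, hn, hn, h1, h2]
    exact cross_transform_y (h.pair.disc z hz) h.pair.disc_sq _ _ _ _ _ _

theorem IsTransform.backlund (hε : ε = 1 ∨ ε = -1) (hΔ : Δ = 1 ∨ Δ = -1) (hU : IsOpen U)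
    (hA : ContDiffOn ℝ 1 A U) (hB : ContDiffOn ℝ 1 B U) (hC : ContDiffOn ℝ 1 C U)
    (hABC : ∀ z ∈ U, A z * B z - C z ^ 2 = Δ) (hN : IsSolution ε U A B C N f)
    (hr : ∀ z ∈ U, sqNorm ε N z ≠ 0) (h : IsTransform ε Δ U A B C N σ n p x N') :
    (∀ z ∈ U, newCoeff Δ A z * newCoeff Δ B z - newCoeff Δ C z ^ 2 = Δ) ∧
    IsSolution ε U (newCoeff Δ A) (newCoeff Δ B) (newCoeff Δ C) N' (newF Δ A B C σ p x) ∧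
    IsSolution ε U A B C N' (fun z => -(Δ : 𝕜) * newF Δ A B C σ p x z) ∧
    (∀ z ∈ U, dot ε (N z) (N' z) = p z) ∧
    (∀ z ∈ U, sqNorm ε N' z = -((Δ : 𝕜) * sqNorm ε N z)) ∧
    (∀ R, IsLelieuvre ε U A B C N R → ∀ c : Fin 3 → 𝕜,
      IsLelieuvre ε U (newCoeff Δ A) (newCoeff Δ B) (newCoeff Δ C) N'
        (fun z => R z + cross ε (N z) (N' z) + c)) := by
  have hc := hN.isNormalPair hU hΔ hA hB hC hABC h.potential h.p_ne h.denom_ne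
  have hM := h.isMoutardPair hε hc hr
  have hsq : Δ * Δ = 1 := by rcases hΔ with rfl | rfl <;> norm_num
  have hsq' : (Δ : 𝕜) * (Δ : 𝕜) = 1 := hM.pair.disc_sq
  have hself : ∀ z ∈ U, sqNorm ε N' z = -((Δ : 𝕜) * sqNorm ε N z) := fun z hz =>
    hM.dot_self_eq hz ((h.frame.firstIntegral_frameField hz).trans (h.constraint z hz))
  have hF : ∀ z, newF Δ A B C σ p x z = -(Δ : 𝕜) * (theta σ p x z *
      selfAdjOp A B C (fun w => (theta σ p x w)⁻¹) z) := fun z => by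
    rw [newF, selfAdjOp_newCoeff hΔ, RCLike.real_smul_eq_coe_mul]
    push_cast
    ring
  have hL : ∀ z ∈ U, selfAdjOp A B C (sqNorm ε N') z = 0 := fun z hz => by
    -- (e2) for N' is (e2) for N, since N'·N' is the constant multiple −Δ of N·N.
    have e : sqNorm ε N' =ᶠ[𝓝 z] fun w => (-Δ) • sqNorm ε N w := by
      filter_upwards [hU.mem_nhds hz] with w hw
      rw [hself w hw, RCLike.real_smul_eq_coe_mul]
      push_cast
      ring
    rw [selfAdjOp_congr e, selfAdjOp_const_smul, hN.sqNorm_eq z hz, smul_zero]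
  refine ⟨fun z hz => ?_, ⟨hM.contDiffOn_field, fun z hz => ?_, fun z hz => ?_⟩,
    ⟨hM.contDiffOn_field, fun z hz => ?_, hL⟩, fun z hz => hM.dot_eq hz, hself,
    fun R hR c => hM.isLelieuvre hΔ hR c⟩
  · simp only [newCoeff_eq hΔ]
    linear_combination (Δ * Δ) * hABC z hz + Δ * hsq
  · rw [selfAdjOp_newCoeff hΔ, hM.selfAdjOp_field hz, hF,
      RCLike.real_smul_eq_coe_smul (K := 𝕜), smul_smul]
    push_cast
    rfl
  · rw [selfAdjOp_newCoeff hΔ, hL z hz, smul_zero]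
  · rw [hM.selfAdjOp_field hz, hF, ← mul_assoc, neg_mul_neg, hsq', one_mul]

end Backlund

/-! ### Local square roots and frames -/

section LocalFrame

variable {𝕜 : Type*} [RCLike 𝕜] {ε : ℝ} {D U : Set (ℝ × ℝ)} {N : ℝ × ℝ → Fin 3 → 𝕜}
  {q : ℝ × ℝ}

/-- A nonvanishing function with a square root at a point has one near this point. -/
theorem exists_local_sqrt {g : ℝ × ℝ → 𝕜} (hD : IsOpen D) (hg : ContDiffOn ℝ 2 g D) (hq : q ∈ D)
    {s : 𝕜} (hs : s ≠ 0) (hgs : g q = s ^ 2) :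
    ∃ V, IsOpen V ∧ q ∈ V ∧ V ⊆ D ∧ ∃ σ : ℝ × ℝ → 𝕜, ContDiffOn ℝ 2 σ V ∧
      ∀ z ∈ V, g z = σ z ^ 2 := by
  have hf : ContDiffAt 𝕜 2 (fun t : 𝕜 => t ^ 2) s := contDiffAt_id.pow 2
  have hf' : HasFDerivAt (fun t : 𝕜 => t ^ 2)
      ((ContinuousLinearEquiv.unitsEquivAut 𝕜 (Units.mk0 (2 * s) (by simp [hs])) :
        𝕜 ≃L[𝕜] 𝕜) : 𝕜 →L[𝕜] 𝕜) s := by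
    have h : HasDerivAt (fun t : 𝕜 => t ^ 2) (2 * s) s := by simpa using hasDerivAt_pow 2 s
    convert h.hasFDerivAt using 1
    ext
    simp
  let ψ := hf.localInverse hf' two_ne_zero
  have hψ : ContDiffAt ℝ 2 ψ (g q) := by
    rw [hgs]
    exact (hf.to_localInverse hf' two_ne_zero).restrict_scalars ℝ
  have hψ2 : ∀ᶠ y in 𝓝 (g q), ψ y ^ 2 = y := by
    rw [hgs]
    exact (hf.hasStrictFDerivAt' hf' two_ne_zero).eventually_right_inverse
  have hgq := hg.contDiffAt (hD.mem_nhds hq)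
  obtain ⟨u, hu, hσ⟩ := (hψ.comp q hgq).contDiffOn le_rfl (by simp)
  have h1 : ∀ᶠ z in 𝓝 q, ψ (g z) ^ 2 = g z := hgq.continuousAt.eventually hψ2
  obtain ⟨V, hV, hVo, hqV⟩ := mem_nhds_iff.1 (inter_mem (inter_mem hu h1) (hD.mem_nhds hq))
  exact ⟨V, hVo, hqV, fun z hz => (hV hz).2, ψ ∘ g, hσ.mono fun z hz => (hV hz).1.1,
    fun z hz => (hV hz).1.2.symm⟩

/-- A frame whose first vector is `u`, obtained from the standard basis by a reflection. -/
def reflFrame (ε : ℝ) (τ : 𝕜) (i : Fin 3) (u : Fin 3 → 𝕜) : Fin 3 → 𝕜 :=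
  if i = 0 then u else
    Pi.single i 1 - (2 * (τ * ((ε : 𝕜) * u i)) * (2 + 2 * τ * u 0)⁻¹) • (Pi.single 0 1 + τ • u)

/-- Since τ² = 1, the vector w = e₀ + τu has w·w = 2 + 2τu₀, and the reflection in w sends e₀ to
−τu. The images of e₁, e₂ are therefore orthogonal to u and keep their products. -/
theorem dot_reflFrame {τ : 𝕜} (hτ : τ * τ = 1) {u : Fin 3 → 𝕜}
    (hu : dot ε u u = 1) (h0 : 2 + 2 * τ * u 0 ≠ 0) (i j : Fin 3) :
    dot ε (reflFrame ε τ i u) (reflFrame ε τ j u) =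
      if i = j then (frameSign ε i : 𝕜) else 0 := by
  have hk := mul_inv_cancel₀ h0
  have hE : ∀ (i : Fin 3) (v : Fin 3 → 𝕜),
      dot ε (Pi.single i 1) v = (frameSign ε i : 𝕜) * v i := fun i v => by
    rw [dot_eq_sum, Finset.sum_eq_single i (fun j _ hj => by simp [hj]) (by simp)]
    simp
  have hE' : ∀ (i : Fin 3) (v : Fin 3 → 𝕜),
      dot ε v (Pi.single i 1) = (frameSign ε i : 𝕜) * v i := fun i v => by rw [dot_comm, hE]
  have hs : (frameSign ε 0 : 𝕜) = 1 := by simp [frameSign]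
  have hs' : ∀ i : Fin 3, i ≠ 0 → (frameSign ε i : 𝕜) = (ε : 𝕜) := fun i hi => by
    simp [frameSign, hi]
  by_cases hi : i = 0 <;> by_cases hj : j = 0
  · simp [reflFrame, hi, hj, hu, hs]
  · simp only [reflFrame, hi, hj, Ne.symm hj, if_true, if_false, dot_sub_right, dot_smul_right,
      dot_add_right, hE', hu, hs, hs' j hj]
    linear_combination -(ε : 𝕜) * u j * hk - 2 * (ε : 𝕜) * u j * (2 + 2 * τ * u 0)⁻¹ * hτ
  · simp only [reflFrame, hi, hj, if_true, if_false, dot_sub_left, dot_smul_left,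
      dot_add_left, hE, hu, hs, hs' i hi]
    linear_combination -(ε : 𝕜) * u i * hk - 2 * (ε : 𝕜) * u i * (2 + 2 * τ * u 0)⁻¹ * hτ
  · simp only [reflFrame, hi, hj, if_false, dot_sub_left, dot_smul_left,
      dot_add_left, dot_sub_right, dot_smul_right, dot_add_right, hE, hE', hu, hs, hs' i hi,
      hs' j hj, Pi.sub_apply, Pi.smul_apply, Pi.add_apply, smul_eq_mul, Pi.single_apply,
      Ne.symm hi, if_true, @eq_comm _ j i]
    have e : (ε : 𝕜) * (if i = j then (1 : 𝕜) else 0) = if i = j then (ε : 𝕜) else 0 := by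
      split_ifs <;> simp
    rw [mul_sub, e]
    generalize (2 + 2 * τ * u 0)⁻¹ = k at hk ⊢
    linear_combination 4 * τ * τ * (ε : 𝕜) * (ε : 𝕜) * u i * u j * k * hk +
      4 * τ * τ * (ε : 𝕜) * (ε : 𝕜) * u i * u j * k * k * hτ

theorem contDiffOn_reflFrame {u : ℝ × ℝ → Fin 3 → 𝕜} {τ : 𝕜} (hu : ContDiffOn ℝ 2 u D)
    (h0 : ∀ z ∈ D, 2 + 2 * τ * u z 0 ≠ 0) (i : Fin 3) :
    ContDiffOn ℝ 2 (fun z => reflFrame ε τ i (u z)) D := by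
  have hui := contDiffOn_pi.1 hu
  by_cases hi : i = 0
  · simpa only [reflFrame, hi, if_true] using hu
  · simp only [reflFrame, hi, if_false]
    have h1 : ContDiffOn ℝ 2
        (fun z => 2 * (τ * ((ε : 𝕜) * u z i)) * (2 + 2 * τ * u z 0)⁻¹) D :=
      (contDiffOn_const.mul (contDiffOn_const.mul (contDiffOn_const.mul (hui i)))).mul
        ((contDiffOn_const.add (contDiffOn_const.mul (hui 0))).inv h0)
    have h2 : ContDiffOn ℝ 2 (fun z => Pi.single 0 1 + τ • u z) D :=
      contDiffOn_const.add (hu.const_smul τ)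
    exact contDiffOn_const.sub (h1.smul h2)

theorem exists_local_frame (hD : IsOpen D) (hN : ContDiffOn ℝ 2 N D)
    (hq : q ∈ D) {s : 𝕜} (hs : s ≠ 0) (hr : sqNorm ε N q = s ^ 2) :
    ∃ U, IsOpen U ∧ q ∈ U ∧ U ⊆ D ∧ ∃ σ n, IsFrame ε U N σ n := by
  obtain ⟨V, hV, hqV, hVD, σ, hσ, hσ2⟩ := exists_local_sqrt hD (contDiffOn_sqNorm hN) hq hs hr
  have hσq : σ q ≠ 0 := fun h => hs (by
    have := hσ2 q hqV
    rw [hr, h] at this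
    exact pow_eq_zero_iff two_ne_zero |>.1 (this.trans (by simp)))
  have hσc : ContinuousAt σ q := hσ.continuousOn.continuousAt (hV.mem_nhds hqV)
  let u : ℝ × ℝ → Fin 3 → 𝕜 := fun z => (σ z)⁻¹ • N z
  -- The vectors e₀ + u and e₀ − u cannot both be isotropic, because their squares add up to 4. In
  -- the Minkowski or complex case one of them may be, whence the choice of sign.
  obtain ⟨τ, hτ, h0⟩ : ∃ τ : 𝕜, τ * τ = 1 ∧ 2 + 2 * τ * u q 0 ≠ 0 := by
    by_cases h : 2 + 2 * (1 : 𝕜) * u q 0 = 0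
    · refine ⟨-1, by ring, fun h' => ?_⟩
      have h4 : (4 : 𝕜) = 0 := by linear_combination h + h'
      norm_num at h4
    · exact ⟨1, by ring, h⟩
  have huc : ContinuousAt (fun z => 2 + 2 * τ * u z 0) q := by
    have : ContinuousAt u q := (hσc.inv₀ hσq).smul
      ((hN.continuousOn.continuousAt (hD.mem_nhds hq)))
    exact (continuousAt_const.mul ((continuous_apply 0).continuousAt.comp this)).const_add 2
  obtain ⟨U, hU, hUo, hqU⟩ := mem_nhds_iff.1 (inter_mem (hV.mem_nhds hqV)
    ((hσc.eventually_ne hσq).and (huc.eventually_ne h0)))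
  have hu2 : ContDiffOn ℝ 2 u U := ((hσ.mono fun z hz => (hU hz).1).inv
    fun z hz => (hU hz).2.1).smul (hN.mono fun z hz => hVD (hU hz).1)
  refine ⟨U, hUo, hqU, fun z hz => hVD (hU hz).1, σ, fun i z => reflFrame ε τ i (u z),
    fun i => contDiffOn_reflFrame hu2 (fun z hz => (hU hz).2.2) i, fun z hz i j => ?_,
    fun z hz => ?_⟩
  · refine dot_reflFrame hτ ?_ (hU hz).2.2 i j
    have h1 := hσ2 z (hU hz).1
    have h2 := (hU hz).2.1
    simp only [u, dot_smul_left, dot_smul_right]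
    rw [← sqNorm, h1]
    field_simp
  · simp [reflFrame, u, smul_smul, mul_inv_cancel₀ (hU hz).2.1]

end LocalFrame

/-! ### Local existence of transforms -/

section LocalTransform

variable {𝕜 : Type*} [RCLike 𝕜] {ε Δ : ℝ} {D U : Set (ℝ × ℝ)} {A B C : ℝ × ℝ → ℝ}
  {N : ℝ × ℝ → Fin 3 → 𝕜} {f p σ : ℝ × ℝ → 𝕜} {n : Fin 3 → ℝ × ℝ → Fin 3 → 𝕜} {q : ℝ × ℝ}

theorem IsFrame.mono (h : IsFrame ε D N σ n) (hU : U ⊆ D) : IsFrame ε U N σ n :=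
  ⟨fun i => (h.contDiffOn i).mono hU, fun z hz => h.orthonormal z (hU hz),
    fun z hz => h.normal z (hU hz)⟩

theorem IsPotential.mono (h : IsPotential ε Δ D A B C N p) (hU : U ⊆ D) :
    IsPotential ε Δ U A B C N p :=
  ⟨h.differentiableOn.mono hU, fun z hz => h.eq_x z (hU hz), fun z hz => h.eq_y z (hU hz)⟩

theorem isSimplyConnected_ball (q : ℝ × ℝ) {δ : ℝ} (hδ : 0 < δ) :
    IsSimplyConnected (Metric.ball q δ) := by
  have : ContractibleSpace (Metric.ball q δ) :=
    (convex_ball q δ).contractibleSpace ⟨q, Metric.mem_ball_self hδ⟩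
  exact SimplyConnectedSpace.ofContractible _

theorem IsSolution.exists_isTransform (hε : ε = 1 ∨ ε = -1) (hΔ : Δ = 1 ∨ Δ = -1) (hD : IsOpen D)
    (hA : ContDiffOn ℝ 1 A D) (hB : ContDiffOn ℝ 1 B D) (hC : ContDiffOn ℝ 1 C D)
    (hABC : ∀ z ∈ D, A z * B z - C z ^ 2 = Δ) (hN : IsSolution ε D A B C N f)
    (hr : ∀ z ∈ D, ∃ s : 𝕜, s ≠ 0 ∧ sqNorm ε N z = s ^ 2) (hq : q ∈ D) {ν : Fin 3 → 𝕜}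
    (h1 : dot ε (N q) ν ≠ 0) (h2 : dot ε (N q) ν ^ 2 + sqNorm ε N q ^ 2 * (Δ : 𝕜) ≠ 0)
    (h3 : dot ε ν ν = -((Δ : 𝕜) * sqNorm ε N q)) :
    ∃ U, IsOpen U ∧ q ∈ U ∧ U ⊆ D ∧ ∃ σ n p x N',
      IsTransform ε Δ U A B C N σ n p x N' ∧ N' q = ν := by
  obtain ⟨s, hs, hrs⟩ := hr q hq
  obtain ⟨V, hV, hqV, hVD, σ, n, hF⟩ := exists_local_frame hD hN.contDiffOn hq hs hrs
  obtain ⟨δ, hδ, hδV⟩ := Metric.isOpen_iff.1 hV q hqV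
  have hq1 := Metric.mem_ball_self (x := q) hδ
  have hδD := hδV.trans hVD
  obtain ⟨p, hp, hpq⟩ := (hN.mono hδD).exists_isPotential Metric.isOpen_ball
    (isSimplyConnected_ball q hδ) hΔ (hA.mono hδD) (hB.mono hδD) (hC.mono hδD)
    (fun z hz => hABC z (hδD hz)) hq1 (dot ε (N q) ν)
  have hpc : ContinuousAt p q :=
    hp.differentiableOn.continuousOn.continuousAt (Metric.isOpen_ball.mem_nhds hq1)
  have hrc : ContinuousAt (sqNorm ε N) q :=
    (contDiffOn_sqNorm hN.contDiffOn).continuousOn.continuousAt (hD.mem_nhds hq)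
  have hdc : ContinuousAt (fun z => p z ^ 2 + sqNorm ε N z ^ 2 * (Δ : 𝕜)) q :=
    (hpc.pow 2).add ((hrc.pow 2).mul continuousAt_const)
  -- The conditions on ν make p and p² + r²Δ nonzero at `q`; by continuity they stay so on a smaller
  -- square, which is again simply connected.
  obtain ⟨δ', hδ', hball⟩ := Metric.nhds_basis_ball.mem_iff.1
    (inter_mem (Metric.isOpen_ball.mem_nhds hq1)
      ((hpc.eventually_ne (hpq ▸ h1)).and (hdc.eventually_ne (by rw [hpq]; exact h2))))
  have hq2 := Metric.mem_ball_self (x := q) hδ'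
  have hδ'δ : Metric.ball q δ' ⊆ Metric.ball q δ := fun z hz => (hball hz).1
  have hδ'D := hδ'δ.trans hδD
  have hc := (hN.mono hδ'D).isNormalPair Metric.isOpen_ball hΔ (hA.mono hδ'D) (hB.mono hδ'D)
    (hC.mono hδ'D) (fun z hz => hABC z (hδ'D hz)) (hp.mono hδ'δ) (fun z hz => (hball hz).2.1)
    (fun z hz => (hball hz).2.2)
  obtain ⟨X, hXq, hX⟩ := exists_isParallel Metric.isOpen_ball (isSimplyConnected_ball q hδ')
    hc.contDiffOn_mPL hc.contDiffOn_mQL hc.isFlat hq2 ν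
  have hF2 := hF.mono (hδ'δ.trans hδV)
  -- The choice p(q) = N·ν normalises θ to 1 at `q`, so that N' = X/θ takes the value ν there.
  have hθq : mTheta ε N p q (X q) = 1 := by
    rw [mTheta, hXq, hpq, dot_comm]
    exact div_self h1
  have hIq : firstIntegral ε (Δ : 𝕜) N X p q = 0 := by
    rw [firstIntegral, hθq, hXq, h3]
    ring
  set x : Fin 3 → ℝ × ℝ → 𝕜 := fun j w => (frameSign ε j : 𝕜) * dot ε (X w) (n j w) with hx
  have hfx : ∀ z ∈ Metric.ball q δ', frameField n x z = X z := fun z hz =>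
    hF2.frameField_coord hε hz X
  have hL := hF2.isLinearSolution_coord hε hc hX
  have hx0q : x 0 q ≠ 0 := fun h => h1 <| by
    have := hF2.dot_frameField_normal (x := x) hq2
    rwa [hfx q hq2, hXq, h, zero_mul, dot_comm] at this
  have hx0c : ContinuousAt (x 0) q :=
    (hL.differentiableOn 0).continuousOn.continuousAt (Metric.isOpen_ball.mem_nhds hq2)
  obtain ⟨U, hU, hUo, hqU⟩ := mem_nhds_iff.1 (inter_mem (Metric.isOpen_ball.mem_nhds hq2)
    (hx0c.eventually_ne hx0q))
  have hUδ : U ⊆ Metric.ball q δ' := fun z hz => (hU hz).1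
  have hUD := hUδ.trans hδ'D
  have hcU := (hN.mono hUD).isNormalPair hUo hΔ (hA.mono hUD) (hB.mono hUD)
    (hC.mono hUD) (fun z hz => hABC z (hUD hz)) (hp.mono (hUδ.trans hδ'δ))
    (fun z hz => (hball (hUδ hz)).2.1) (fun z hz => (hball (hUδ hz)).2.2)
  have hFU := hF2.mono hUδ
  have hT : IsTransform ε Δ U A B C N σ n p x
      (fun z => ∑ i, (p z / σ z * (x i z / x 0 z)) • n i z) :=
    { frame := hFU
      potential := hp.mono (hUδ.trans hδ'δ)
      p_ne := fun z hz => (hball (hUδ hz)).2.1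
      denom_ne := fun z hz => (hball (hUδ hz)).2.2
      linear := hFU.isLinearSolution_coord hε hcU (hX.mono hUδ)
      x_ne := fun z hz => (hU hz).2
      constraint := fun z hz => by
        rw [← hFU.firstIntegral_frameField hz, firstIntegral, hfx z (hUδ hz), ← firstIntegral]
        exact (hc.firstIntegral_eq (convex_ball q δ').isPreconnected hX (hUδ hz) hq2).trans hIq
      field_eq := fun _ _ => rfl }
  refine ⟨U, hUo, hqU, hUD, σ, n, p, x, _, hT, ?_⟩
  have hM := hT.isMoutardPair hε hcU fun z hz h0 => by
    obtain ⟨t, ht, hrt⟩ := hr z (hUD hz)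
    exact pow_ne_zero 2 ht (hrt.symm.trans h0)
  rw [hM.field_eq q hqU, hM.theta_eq q hqU, hfx q hq2, hθq, hXq, inv_one, one_smul]

end LocalTransform

end

end Bianchi

/-! ### Assembly of the claims -/

theorem mainTheorem3 {𝕜 : Type*} [RCLike 𝕜]
    (ε : ℝ) (hε : ε = 1 ∨ ε = -1) (Δ : ℝ) (hΔ : Δ = 1 ∨ Δ = -1)
    (D : Set (ℝ × ℝ)) (hD : IsOpen D)
    (A B C : ℝ × ℝ → ℝ)
    (hA : ContDiffOn ℝ 1 A D) (hB : ContDiffOn ℝ 1 B D) (hC : ContDiffOn ℝ 1 C D)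
    (hABC : ∀ z ∈ D, A z * B z - C z ^ 2 = Δ)
    (N : ℝ × ℝ → Fin 3 → 𝕜) (f : ℝ × ℝ → 𝕜)
    (hN : Bianchi.IsSolution ε D A B C N f)
    (hr : ∀ z ∈ D, ∃ s : 𝕜, s ≠ 0 ∧ Bianchi.sqNorm ε N z = s ^ 2) :
    -- the surface of `N`, for which `N` is the distinguished normal field
    (IsSimplyConnected D → ∃ R, Bianchi.IsLelieuvre ε D A B C N R) ∧
    (∀ R, Bianchi.IsLelieuvre ε D A B C N R →
      ∀ z ∈ D, Bianchi.vol (N z) (Bianchi.dx N z) (Bianchi.dy N z) ≠ 0 →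
        LinearIndependent 𝕜 ![Bianchi.dx R z, Bianchi.dy R z] ∧
        Bianchi.dot ε (N z) (Bianchi.dx R z) = 0 ∧ Bianchi.dot ε (N z) (Bianchi.dy R z) = 0 ∧
        Bianchi.gaussCurvature ε R z = (Δ : 𝕜) / Bianchi.sqNorm ε N z ^ 2 ∧
        (∀ ρ : ℝ, 0 < ρ → Bianchi.sqNorm ε N z = (ρ : 𝕜) →
          N z = (‖Bianchi.gaussCurvature ε R z‖ ^ (-(1 / 4) : ℝ)) • ((√ρ)⁻¹ • N z))) ∧
    -- compatibility of the system for `p`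
    (IsSimplyConnected D → ∀ q ∈ D, ∀ k : 𝕜,
      ∃ p, Bianchi.IsPotential ε Δ D A B C N p ∧ p q = k ∧
        ∀ p₂, Bianchi.IsPotential ε Δ D A B C N p₂ → p₂ q = k → Set.EqOn p₂ p D) ∧
    -- compatibility of the linear system, and its first integral
    (∀ σ n p, Bianchi.IsFrame ε D N σ n → Bianchi.IsPotential ε Δ D A B C N p →
      (∀ z ∈ D, p z ≠ 0) →
      (∀ z ∈ D, p z ^ 2 + Bianchi.sqNorm ε N z ^ 2 * (Δ : 𝕜) ≠ 0) →
      (IsSimplyConnected D → ∀ q ∈ D, ∀ ξ : Fin 3 → 𝕜,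
        ∃ x, Bianchi.IsLinearSolution ε Δ D A B C N n p x ∧ (∀ i, x i q = ξ i) ∧
          ∀ x₂, Bianchi.IsLinearSolution ε Δ D A B C N n p x₂ → (∀ i, x₂ i q = ξ i) →
            ∀ i, Set.EqOn (x₂ i) (x i) D) ∧
      (IsPreconnected D → ∀ x, Bianchi.IsLinearSolution ε Δ D A B C N n p x →
        ∀ z ∈ D, ∀ w ∈ D,
          Bianchi.constraintQty ε Δ N p x z = Bianchi.constraintQty ε Δ N p x w)) ∧
    -- local existence of transforms with prescribed value at a point
    (∀ q ∈ D, ∀ ν : Fin 3 → 𝕜, Bianchi.dot ε (N q) ν ≠ 0 →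
      Bianchi.dot ε (N q) ν ^ 2 + Bianchi.sqNorm ε N q ^ 2 * (Δ : 𝕜) ≠ 0 →
      Bianchi.dot ε ν ν = -((Δ : 𝕜) * Bianchi.sqNorm ε N q) →
      ∃ U, IsOpen U ∧ q ∈ U ∧ U ⊆ D ∧ ∃ σ n p x N',
        Bianchi.IsTransform ε Δ U A B C N σ n p x N' ∧ N' q = ν) ∧
    -- every transform is a solution of the same system, up to the sign of the coefficients
    (∀ U, IsOpen U → U ⊆ D → ∀ σ n p x N', Bianchi.IsTransform ε Δ U A B C N σ n p x N' →
      (∀ z ∈ U, Bianchi.newCoeff Δ A z * Bianchi.newCoeff Δ B z - Bianchi.newCoeff Δ C z ^ 2 = Δ) ∧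
      Bianchi.IsSolution ε U (Bianchi.newCoeff Δ A) (Bianchi.newCoeff Δ B) (Bianchi.newCoeff Δ C)
        N' (Bianchi.newF Δ A B C σ p x) ∧
      Bianchi.IsSolution ε U A B C N' (fun z => -(Δ : 𝕜) * Bianchi.newF Δ A B C σ p x z) ∧
      (∀ z ∈ U, Bianchi.dot ε (N z) (N' z) = p z) ∧
      (∀ z ∈ U, Bianchi.sqNorm ε N' z = -((Δ : 𝕜) * Bianchi.sqNorm ε N z)) ∧
      (∀ R, Bianchi.IsLelieuvre ε U A B C N R → ∀ c : Fin 3 → 𝕜,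
        Bianchi.IsLelieuvre ε U (Bianchi.newCoeff Δ A) (Bianchi.newCoeff Δ B)
          (Bianchi.newCoeff Δ C) N' (fun z => R z + Bianchi.cross ε (N z) (N' z) + c))) := by
  have hr0 : ∀ z ∈ D, Bianchi.sqNorm ε N z ≠ 0 := fun z hz h0 => by
    obtain ⟨s, hs, hrs⟩ := hr z hz
    exact pow_ne_zero 2 hs (hrs.symm.trans h0)
  refine ⟨fun hDs => hN.exists_isLelieuvre hD hDs hA hB hC, fun R hR z hz hV => ?_,
    fun hDs q hq k => ?_, fun σ n p hF hp hp0 hd => ?_, fun q hq ν h1 h2 h3 =>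
      hN.exists_isTransform hε hΔ hD hA hB hC hABC hr hq h1 h2 h3,
    fun U hU hUD σ n p x N' hT => hT.backlund hε hΔ hU (hA.mono hUD) (hB.mono hUD) (hC.mono hUD)
      (fun z hz => hABC z (hUD hz)) (hN.mono hUD) (fun z hz => hr0 z (hUD hz))⟩
  · have hK := hR.gaussCurvature_eq hε hΔ hD hA hB hC hABC hN.contDiffOn hz (hr0 z hz) hV
    refine ⟨?_, hR.dot_dx hε hz, hR.dot_dy hε hz, hK, fun ρ hρ hrρ =>
      Bianchi.eq_norm_gaussCurvature_smul hΔ hK hρ hrρ⟩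
    -- R_x × R_y is Δ times the volume times N, and N ≠ 0 because N·N ≠ 0.
    refine Bianchi.linearIndependent_pair_of_cross_ne_zero (ε := ε) ?_
    rw [hR.cross_dx_dy hε hABC hz]
    refine smul_ne_zero (mul_ne_zero ?_ hV) fun h0 => hr0 z hz ?_
    · rcases hΔ with rfl | rfl <;> simp
    · rw [Bianchi.sqNorm, h0]
      simp [Bianchi.dot]
  · obtain ⟨p, hp, hpq⟩ := hN.exists_isPotential hD hDs hΔ hA hB hC hABC hq k
    exact ⟨p, hp, hpq, fun p₂ hp₂ hp₂q => hp₂.eqOn hD hDs.isPathConnected.isConnected.isPreconnected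
      hΔ hABC hp hq (hp₂q.trans hpq.symm)⟩
  · have hc := hN.isNormalPair hD hΔ hA hB hC hABC hp hp0 hd
    refine ⟨fun hDs q hq ξ => ?_, fun hDc x hx z hz w hw => hF.constraintQty_eq hε hc hDc hx hz hw⟩
    obtain ⟨x, hx, hxq⟩ := hF.exists_isLinearSolution hε hc hDs hq ξ
    exact ⟨x, hx, hxq, fun x₂ hx₂ hx₂q => hF.isLinearSolution_eqOn hε hc
      hDs.isPathConnected.isConnected.isPreconnected hq hx₂ hx fun i => (hx₂q i).trans (hxq i).symm⟩
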